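/- Let $D\ge 4$ and $\theta_0\in\mathbb R$, and let $I,J$ run over $3,\dots,D-1$. Write $\mathcal D=t\,\partial_t$ and $P=\sum_J P_J$. The reduced vacuum $T^{D-2}$-symmetric evolution equations in areal time $t>0$ (under the ansatz $f_{IJ}=e^{2P_I}\delta_{IJ}$), for functions $P_I(t,\theta)$, $Q_I(t,\theta)$, are $$\mathcal D^2P_I-t^2\partial_\theta^2P_I=-\tfrac12 e^{-2(P+P_I)}\big[(\mathcal DQ_I)^2-(t\,\partial_\theta Q_I)^2\big],$$ $$\mathcal D^2Q_I-t^2\partial_\theta^2Q_I=2\big[\mathcal D(P+P_I)\,\mathcal DQ_I-t^2\,\partial_\theta(P+P_I)\,\partial_\theta Q_I\big].$$ Let $p_{IA},q_{IA}$ ($A=0,1$) be real-valued functions that are real analytic near $\theta_0$, put $k_I=\sum_J p_{J0}+p_{I0}$, and assume $0<k_I<1$ near $\theta_0$ for all $I$. For constants $\varepsilon_I>0$, a local solution of the form $(*)$ with exponents $\varepsilon_I$ is a pair of families $P_I,Q_I$ that are $C^2$ and satisfy the equations on some $(0,T)\times(\theta_0-r,\theta_0+r)$ with $T,r>0$, and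 can be written there as $$P_I=p_{I0}\ln t+p_{I1}+t^{\varepsilon_I}\pi_I,\qquad Q_I=q_{I0}+t^{2k_I}q_{I1}+t^{2k_I}\kappa_I,\qquad(*)$$ where $\pi_I,\kappa_I$ are analytic in $\theta$ and tend to zero as $t\to0^+$, in the following sense: each extends to a $C^2$ function of $(t,z)\in(0,T)\times\{z\in\mathbb C:|z-\theta_0|<r\}$ that is holomorphic in $z$ and tends to $0$ as $t\to0^+$, uniformly in $z$. Then: 1. (Existence, AVTD behaviour.) For all constants $\varepsilon_I$ with $0<\varepsilon_I<\min\{2k_I(\theta_0),\,2(1-k_I(\theta_0))\}$ there is a local solution of the form $(*)$. It can be chosen asymptotically velocity-terms dominated: the equations without spatial derivatives hold asymptotically, that is, $\mathcal D^2P_I+\frac12e^{-2(P+P_I)}(\mathcal DQ_I)^2\to0$ and $t^{-2k_I}\big[\mathcal D^2Q_I-2\mathcal D(P+P_I)\mathcal DQ_I\big]\to0$ as $t\to0^+$, locally uniformly in $\theta\in(\theta_0-r,\theta_0+r)$. 2. (Uniqueness.) Any two local solutions of the form $(*)$ with the same $p_{IA},q_{IA}$ (and any positive exponents $\varepsilon_I$,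 not necessarily the same) coincide on $(0,T_1)\times(\theta_0-r_1,\theta_0+r_1)$ for some $T_1,r_1>0$. 3. (The $4(D-3)$ functions $p_{IA},q_{IA}$ are free.) Every choice of $p_{IA},q_{IA}$ as above is realized, by 1, and different choices have different solutions: if the same functions $P_I,Q_I$ are, possibly on different domains and with different positive exponents, a local solution of the form $(*)$ both for $p_{IA},q_{IA}$ and for $p'_{IA},q'_{IA}$ (which satisfy the same hypotheses), then $p_{IA}=p'_{IA}$ and $q_{IA}=q'_{IA}$ near $\theta_0$ for all $I,A$. -/

import Mathlib

open Filter Topology Set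

/-- The operator `𝒟 = t ∂ₜ`, acting on functions of `(t, θ)`. -/
noncomputable def eulerD (f : ℝ → ℝ → ℝ) (t θ : ℝ) : ℝ :=
  t * deriv (fun s => f s θ) t

/-- The spatial derivative `∂_θ`. -/
noncomputable def dTheta (f : ℝ → ℝ → ℝ) (t θ : ℝ) : ℝ :=
  deriv (f t) θ

/-- The function `P + P_I`, where `P = ∑_J P_J`. -/
noncomputable def sumPlus {n : ℕ} (P : Fin n → ℝ → ℝ → ℝ) (I : Fin n) (t θ : ℝ) : ℝ :=
  (∑ J, P J t θ) + P I t θ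

/-- The reduced vacuum evolution equations for `(P_I, Q_I)`, in areal time `t`, hold classically
(for functions of class `C²` in `(t, θ)`) on `(0, T) × U`. -/
def SolvesVacuum {n : ℕ} (P Q : Fin n → ℝ → ℝ → ℝ) (T : ℝ) (U : Set ℝ) : Prop :=
  (∀ I, ContDiffOn ℝ 2 (Function.uncurry (P I)) (Ioo 0 T ×ˢ U)) ∧
  (∀ I, ContDiffOn ℝ 2 (Function.uncurry (Q I)) (Ioo 0 T ×ˢ U)) ∧
  ∀ t ∈ Ioo 0 T, ∀ θ ∈ U, ∀ I,
    eulerD (eulerD (P I)) t θ - t ^ 2 * dTheta (dTheta (P I)) t θ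
        = -(1 / 2) * Real.exp (-2 * sumPlus P I t θ)
            * ((eulerD (Q I) t θ) ^ 2 - (t * dTheta (Q I) t θ) ^ 2) ∧
    eulerD (eulerD (Q I)) t θ - t ^ 2 * dTheta (dTheta (Q I)) t θ
        = 2 * (eulerD (sumPlus P I) t θ * eulerD (Q I) t θ
            - t ^ 2 * (dTheta (sumPlus P I) t θ * dTheta (Q I) t θ))

/-- The exponent `k_I = p₀ + p_{I0}`, where `p₀ = ∑_J p_{J0}`. -/
noncomputable def kExp {n : ℕ} (p : Fin n → Fin 2 → ℝ → ℝ) (I : Fin n) (θ : ℝ) : ℝ :=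
  (∑ J, p J 0 θ) + p I 0 θ

/-- `P_I^VTD = p_{I0} ln t + p_{I1}`. -/
noncomputable def pVTD {n : ℕ} (p : Fin n → Fin 2 → ℝ → ℝ) (I : Fin n) (t θ : ℝ) : ℝ :=
  p I 0 θ * Real.log t + p I 1 θ

/-- `Q_I^VTD = q_{I0} + t^{2 k_I} q_{I1}`. -/
noncomputable def qVTD {n : ℕ} (p q : Fin n → Fin 2 → ℝ → ℝ) (I : Fin n) (t θ : ℝ) : ℝ :=
  q I 0 θ + t ^ (2 * kExp p I θ) * q I 1 θ

/-- `f` is analytic in space, uniformly in time, and tends to zero as `t → 0⁺`: on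
`(0, T) × (θ₀ - r, θ₀ + r)` it is the restriction of a function `F` on `(0, T) × B(θ₀, r)`,
`B(θ₀, r)` the complex disc, which is twice continuously differentiable, holomorphic in the space
variable, and tends to zero uniformly on the disc as `t → 0⁺`. -/
def IsAnalyticRemainder (θ₀ T r : ℝ) (f : ℝ → ℝ → ℝ) : Prop :=
  ∃ F : ℝ → ℂ → ℂ,
    ContDiffOn ℝ 2 (Function.uncurry F) (Ioo 0 T ×ˢ Metric.ball (θ₀ : ℂ) r) ∧
    (∀ t ∈ Ioo 0 T, DifferentiableOn ℂ (F t) (Metric.ball (θ₀ : ℂ) r)) ∧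
    TendstoUniformlyOn F (fun _ => 0) (𝓝[>] (0 : ℝ)) (Metric.ball (θ₀ : ℂ) r) ∧
    ∀ t ∈ Ioo 0 T, ∀ θ ∈ Ioo (θ₀ - r) (θ₀ + r), F t (θ : ℂ) = (f t θ : ℂ)

/-- `(P, Q)` solves the vacuum equations on `(0, T) × (θ₀ - r, θ₀ + r)` and has there the form
`P_I = P_I^VTD + t^{ε_I} π_I`, `Q_I = Q_I^VTD + t^{2 k_I} κ_I`, with `π_I`, `κ_I` analytic in space
and tending to zero as `t → 0⁺`. -/
def IsSolutionOfForm {n : ℕ} (θ₀ : ℝ) (p q : Fin n → Fin 2 → ℝ → ℝ) (ε : Fin n → ℝ)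
    (T r : ℝ) (P Q : Fin n → ℝ → ℝ → ℝ) : Prop :=
  0 < T ∧ 0 < r ∧ SolvesVacuum P Q T (Ioo (θ₀ - r) (θ₀ + r)) ∧
  ∃ π κ : Fin n → ℝ → ℝ → ℝ,
    (∀ I, IsAnalyticRemainder θ₀ T r (π I)) ∧
    (∀ I, IsAnalyticRemainder θ₀ T r (κ I)) ∧
    ∀ t ∈ Ioo 0 T, ∀ θ ∈ Ioo (θ₀ - r) (θ₀ + r), ∀ I,
      P I t θ = pVTD p I t θ + t ^ (ε I) * π I t θ ∧
      Q I t θ = qVTD p q I t θ + t ^ (2 * kExp p I θ) * κ I t θ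

/-- `(P, Q)` is asymptotically velocity-terms dominated on `U`: the VTD equations
`𝒟²P_I = -½ e^{-2(P+P_I)} (𝒟Q_I)²` and `𝒟²Q_I = 2 𝒟(P+P_I) 𝒟Q_I`, obtained by dropping the spatial
derivatives, hold asymptotically as `t → 0⁺`, the second one relative to the order `t^{2 k_I}` of
`𝒟Q_I`. -/
def IsAVTD {n : ℕ} (p : Fin n → Fin 2 → ℝ → ℝ) (U : Set ℝ) (P Q : Fin n → ℝ → ℝ → ℝ) : Prop :=
  ∀ I,
    TendstoLocallyUniformlyOn
      (fun t θ => eulerD (eulerD (P I)) t θ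
        + (1 / 2) * Real.exp (-2 * sumPlus P I t θ) * (eulerD (Q I) t θ) ^ 2)
      (fun _ => 0) (𝓝[>] (0 : ℝ)) U ∧
    TendstoLocallyUniformlyOn
      (fun t θ => t ^ (-(2 * kExp p I θ)) * (eulerD (eulerD (Q I)) t θ
        - 2 * (eulerD (sumPlus P I) t θ * eulerD (Q I) t θ)))
      (fun _ => 0) (𝓝[>] (0 : ℝ)) U

/-- Admissible data near `θ₀`: the `4 n` functions `p_{IA}`, `q_{IA}` are real analytic near `θ₀`,
and `0 < k_I < 1` there. -/
def AdmissibleData {n : ℕ} (θ₀ : ℝ) (p q : Fin n → Fin 2 → ℝ → ℝ) : Prop :=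
  (∀ I A, AnalyticAt ℝ (p I A) θ₀) ∧ (∀ I A, AnalyticAt ℝ (q I A) θ₀) ∧
  ∀ᶠ θ in 𝓝 θ₀, ∀ I, 0 < kExp p I θ ∧ kExp p I θ < 1

/-! ### Continuous families of holomorphic functions -/

section Families

/-! The field equations are turned into a Fuchsian system, which is solved by a contraction among
functions that are holomorphic in space. Write S = P + P_I. The equation for Q_I is a conservation
law, 𝒟(e^{-2S} 𝒟Q_I) = t² ∂(e^{-2S} ∂Q_I). On the prescribed leading terms S is k_I ln t + s_I, and
e^{-2S} 𝒟Q_I tends to W_I = 2 k_I q_{I1} e^{-2 s_I}. The unknowns are therefore u = P_I - p_{I0} ln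
t - p_{I1}, a = 𝒟u, c = ∂u, w = e^{-2S} 𝒟Q_I - W_I, y = Q_I - q_{I0} and d = ∂y. They satisfy a
first order system in which the data are coefficients. The nonlinear terms contain e^{2S} ~ t^{2k}
and t² e^{-2S} ~ t^{2-2k}, so 0 < k < 1 makes every driving term vanish like a positive power of t.
Division by suitable powers t^γ gives ∂ₜ(t^γ X) = t^{γ+μ-1} (∂_z G(t,z,X) + H(t,z,X)), with μ, γ > 0
and with G, H bounded and holomorphic in (z, X): `VTDData.Bounded.fuchsianSystem`.

The right-hand side loses a derivative in z. This is repaired on the cone where the gap d = ρ - |z -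
z₀| - η t^μ is positive. By Nagumo's lemma a bound d^{-1/2} for f becomes d^{-3/2} for ∂f. Since ∂ₜd
= -ημ t^{μ-1}, integration in time brings d^{-3/2} back to d^{-1/2} with the factor 2/(ημ). For
large η the integral operator is a contraction in the norm sup |X| √d. This gives existence
(`FuchsianSystem.exists_solution`) and uniqueness (`FuchsianSystem.unique`).

For existence, c = ∂u and d = ∂y hold because the differences are constant in time and vanish at t =
0⁺. The field equations follow (`IsSystemSolution.solvesAt`), and integration of 𝒟y = e^{2S}(W + w)
gives Q_I the required form. The AVTD property holds because the dropped terms are powers of t.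

For uniqueness, the form (*) says nothing about time derivatives, so the decay of a and w has to be
derived. The equations show that a and w have limits at t = 0⁺. A nonzero limit of w would change
the coefficient q_{I1} (`limit_w`), and a nonzero limit of a would make u logarithmic (`decay_a`).
All unknowns are then small enough for the uniqueness theorem. Finally, the data are limits of the
solution, hence determined by it. -/

theorem continuousAt_of_tendstoLocallyUniformlyOn {E : Type*} [PseudoMetricSpace E]
    {F : ℝ → ℂ → E} {U : Set ℂ} {t : ℝ} {z : ℂ}
    (hU : IsOpen U) (hz : z ∈ U) (h : TendstoLocallyUniformlyOn F (F t) (𝓝 t) U)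
    (hc : ContinuousOn (F t) U) : ContinuousAt (Function.uncurry F) (t, z) := by
  have h1 : Tendsto (fun p : ℝ × ℂ => F p.1 p.2) (𝓝 (t, z)) (𝓝 (F t z)) := by
    rw [nhds_prod_eq]
    rw [Metric.tendstoLocallyUniformlyOn_iff] at h
    rw [Metric.tendsto_nhds]
    intro ε hε
    obtain ⟨V, hV, h2⟩ := h (ε / 2) (half_pos hε) z hz
    rw [hU.nhdsWithin_eq hz] at hV
    have h3 := (hc.continuousAt (hU.mem_nhds hz)).eventually (Metric.ball_mem_nhds _ (half_pos hε))
    filter_upwards [h2.prod_mk (Filter.inter_mem hV h3)] with p hp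
    have h4 := hp.1 p.2 hp.2.1
    have h5 : dist (F t p.2) (F t z) < ε / 2 := hp.2.2
    calc dist (F p.1 p.2) (F t z) ≤ dist (F p.1 p.2) (F t p.2) + dist (F t p.2) (F t z) :=
          dist_triangle _ _ _
      _ < ε := by rw [dist_comm (F p.1 p.2)]; linarith
  exact h1

variable {E : Type*} [NormedAddCommGroup E] [NormedSpace ℂ E]

/-- A continuous family, parametrised by a real variable, of holomorphic functions. -/
structure HolFamily (Ω : Set (ℝ × ℂ)) (f : ℝ → ℂ → E) : Prop where
  cont : ContinuousOn (Function.uncurry f) Ω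
  diff : ∀ p ∈ Ω, DifferentiableAt ℂ (f p.1) p.2

theorem exists_box {Ω : Set (ℝ × ℂ)} (hΩ : IsOpen Ω) {t : ℝ} {z : ℂ} (h : (t, z) ∈ Ω) :
    ∃ r > 0, Metric.ball t r ×ˢ Metric.ball z r ⊆ Ω := by
  obtain ⟨r, hr, h'⟩ := Metric.isOpen_iff.1 hΩ _ h
  exact ⟨r, hr, by rwa [ball_prod_same]⟩

variable {Ω : Set (ℝ × ℂ)} {f g : ℝ → ℂ → E}

namespace HolFamily

theorem mono {Ω' : Set (ℝ × ℂ)} (hf : HolFamily Ω f) (h : Ω' ⊆ Ω) : HolFamily Ω' f :=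
  ⟨hf.cont.mono h, fun p hp => hf.diff p (h hp)⟩

theorem slice (hf : HolFamily Ω f) {t : ℝ} {U : Set ℂ} (h : ∀ z ∈ U, (t, z) ∈ Ω) :
    DifferentiableOn ℂ (f t) U :=
  fun z hz => (hf.diff (t, z) (h z hz)).differentiableWithinAt

omit [NormedSpace ℂ E] in
theorem tendstoLocallyUniformlyOn (hf : ContinuousOn (Function.uncurry f) Ω) {t : ℝ} {z : ℂ} {r : ℝ}
    (h : Metric.ball t r ×ˢ Metric.ball z r ⊆ Ω) (hr : 0 < r) :
    TendstoLocallyUniformlyOn f (f t) (𝓝 t) (Metric.ball z r) := by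
  rw [tendstoLocallyUniformlyOn_iff_forall_isCompact Metric.isOpen_ball]
  intro K hK hKc
  have : ContinuousOn (Function.uncurry f) (Metric.ball t r ×ˢ K) :=
    hf.mono ((prod_mono_right hK).trans h)
  rw [tendstoUniformlyOn_iff_tendstoUniformly_comp_coe]
  have hK' := isCompact_iff_compactSpace.1 hKc
  have h2 : Continuous fun x : ℝ × K => (x.1, (x.2 : ℂ)) := by fun_prop
  exact ContinuousOn.tendstoUniformly (f := fun s (y : K) => f s y) (Metric.ball_mem_nhds t hr)
    (ContinuousOn.comp (g := Function.uncurry f) this h2.continuousOn fun x hx => ⟨hx.1, x.2.2⟩)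

variable [CompleteSpace E]

/-- Continuity in t is locally uniform in z, and locally uniform convergence of holomorphic
functions passes to their derivatives. -/
theorem deriv_z (hΩ : IsOpen Ω) (hf : HolFamily Ω f) : HolFamily Ω (fun t => deriv (f t)) := by
  have key : ∀ p ∈ Ω, ContinuousAt (Function.uncurry fun t => deriv (f t)) p ∧
      DifferentiableAt ℂ (deriv (f p.1)) p.2 := by
    rintro ⟨t, z⟩ hp
    obtain ⟨r, hr, h⟩ := exists_box hΩ hp
    have hd : ∀ᶠ s in 𝓝 t, DifferentiableOn ℂ (f s) (Metric.ball z r) := by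
      filter_upwards [Metric.ball_mem_nhds t hr] with s hs
      exact hf.slice fun w hw => h ⟨hs, hw⟩
    have h1 := (tendstoLocallyUniformlyOn hf.cont h hr).deriv hd Metric.isOpen_ball
    have h2 : DifferentiableOn ℂ (deriv (f t)) (Metric.ball z r) :=
      hd.self_of_nhds.deriv Metric.isOpen_ball
    exact ⟨continuousAt_of_tendstoLocallyUniformlyOn Metric.isOpen_ball (Metric.mem_ball_self hr)
      h1 h2.continuousOn, h2.differentiableAt (Metric.ball_mem_nhds _ hr)⟩
  exact ⟨fun p hp => (key p hp).1.continuousWithinAt, fun p hp => (key p hp).2⟩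

/-- The time difference quotients of f are holomorphic in z and converge to g locally uniformly. By
Weierstrass the limit is holomorphic, and its z-derivative is the limit of the z-derivatives of the
quotients, so ∂ₜ and ∂_z commute. -/
theorem deriv_t (hΩ : IsOpen Ω) (hf : ∀ p ∈ Ω, DifferentiableAt ℂ (f p.1) p.2)
    (hg : ContinuousOn (Function.uncurry g) Ω)
    (h : ∀ p ∈ Ω, HasDerivAt (fun s => f s p.2) (g p.1 p.2) p.1) :
    HolFamily Ω g ∧
      ∀ p ∈ Ω, HasDerivAt (fun s => deriv (f s) p.2) (deriv (g p.1) p.2) p.1 := by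
  have key : ∀ p ∈ Ω, DifferentiableAt ℂ (g p.1) p.2 ∧
      HasDerivAt (fun s => deriv (f s) p.2) (deriv (g p.1) p.2) p.1 := by
    rintro ⟨t, z⟩ hp
    obtain ⟨r, hr, hb⟩ := exists_box hΩ hp
    have hd : ∀ s ∈ Metric.ball t r, DifferentiableOn ℂ (f s) (Metric.ball z r) :=
      fun s hs w hw => (hf (s, w) (hb ⟨hs, hw⟩)).differentiableWithinAt
    have hgu := tendstoLocallyUniformlyOn hg hb hr
    have hq : TendstoLocallyUniformlyOn (fun s w => (s - t)⁻¹ • (f s w - f t w)) (g t) (𝓝[≠] t)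
        (Metric.ball z r) := by
      rw [Metric.tendstoLocallyUniformlyOn_iff] at hgu ⊢
      intro ε hε w hw
      obtain ⟨V, hV, h1⟩ := hgu (ε / 2) (half_pos hε) w hw
      refine ⟨V ∩ Metric.ball z r, Filter.inter_mem hV self_mem_nhdsWithin, ?_⟩
      obtain ⟨δ, hδ, h2⟩ := Metric.eventually_nhds_iff_ball.1 h1
      have h3 : Metric.ball t (min δ r) ∈ 𝓝 t := Metric.ball_mem_nhds _ (lt_min hδ hr)
      filter_upwards [nhdsWithin_le_nhds h3, self_mem_nhdsWithin] with s hs hst y hy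
      have hst' : s - t ≠ 0 := sub_ne_zero.2 hst
      have hsub : ∀ x ∈ Metric.ball t (min δ r), x ∈ Metric.ball t δ ∧ x ∈ Metric.ball t r :=
        fun x hx => ⟨Metric.ball_subset_ball (min_le_left _ _) hx,
          Metric.ball_subset_ball (min_le_right _ _) hx⟩
      -- Mean value inequality for f(x, y) - x g(t, y) as a function of x; its derivative g(x, y) -
      -- g(t, y) is at most ε/2 near t.
      have h4 := Convex.norm_image_sub_le_of_norm_hasDerivWithin_le (𝕜 := ℝ)
        (f := fun x => f x y - x • g t y) (f' := fun x => g x y - g t y) (C := ε / 2)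
        (s := Metric.ball t (min δ r)) (x := t) (y := s)
        (fun x hx => by
          have := (h (x, y) (hb ⟨(hsub x hx).2, hy.2⟩)).sub
            ((hasDerivAt_id x).smul_const (g t y))
          simpa using! this.hasDerivWithinAt)
        (fun x hx => by
          have := h2 x (hsub x hx).1 y hy.1
          rw [dist_comm, dist_eq_norm] at this
          exact this.le)
        (convex_ball _ _) (Metric.mem_ball_self (lt_min hδ hr)) hs
      have h5 : (s - t)⁻¹ • (f s y - f t y) - g t y
          = (s - t)⁻¹ • ((f s y - s • g t y) - (f t y - t • g t y)) := by
        have : (s - t)⁻¹ • ((f s y - s • g t y) - (f t y - t • g t y))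
          = (s - t)⁻¹ • (f s y - f t y) - ((s - t)⁻¹ * (s - t)) • g t y := by module
        rw [this, inv_mul_cancel₀ hst', one_smul]
      rw [dist_comm, dist_eq_norm, h5, norm_smul, norm_inv]
      have h6 : 0 < ‖s - t‖ := norm_pos_iff.2 hst'
      calc ‖s - t‖⁻¹ * ‖(f s y - s • g t y) - (f t y - t • g t y)‖
          ≤ ‖s - t‖⁻¹ * (ε / 2 * ‖s - t‖) := by gcongr
        _ = ε / 2 := by field_simp
        _ < ε := by linarith
    have hqd : ∀ᶠ s in 𝓝[≠] t,
        DifferentiableOn ℂ (fun w => (s - t)⁻¹ • (f s w - f t w)) (Metric.ball z r) := by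
      filter_upwards [nhdsWithin_le_nhds (Metric.ball_mem_nhds t hr)] with s hs
      exact ((hd s hs).sub (hd t (Metric.mem_ball_self hr))).const_smul (s - t)⁻¹
    refine ⟨(hq.differentiableOn hqd Metric.isOpen_ball).differentiableAt
      (Metric.ball_mem_nhds _ hr), ?_⟩
    rw [hasDerivAt_iff_tendsto_slope]
    have h7 := (hq.deriv hqd Metric.isOpen_ball).tendsto_at (Metric.mem_ball_self hr)
    refine h7.congr' ?_
    filter_upwards [nhdsWithin_le_nhds (Metric.ball_mem_nhds t hr)] with s hs
    have hz := Metric.ball_mem_nhds z hr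
    have e1 := ((hd s hs).differentiableAt hz).hasDerivAt.sub
      ((hd t (Metric.mem_ball_self hr)).differentiableAt hz).hasDerivAt
    have e2 := (e1.const_smul (s - t)⁻¹).deriv
    simp only [Function.comp, slope, vsub_eq_sub]
    exact e2
  exact ⟨⟨hg, fun p hp => (key p hp).1⟩, fun p hp => (key p hp).2⟩

theorem hasFDerivAt (hΩ : IsOpen Ω) (hf : HolFamily Ω f)
    (hg : ContinuousOn (Function.uncurry g) Ω)
    (h : ∀ p ∈ Ω, HasDerivAt (fun s => f s p.2) (g p.1 p.2) p.1) {p : ℝ × ℂ} (hp : p ∈ Ω) :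
    HasFDerivAt (Function.uncurry f)
      ((ContinuousLinearMap.toSpanSingleton ℝ (g p.1 p.2)).coprod
        ((ContinuousLinearMap.toSpanSingleton ℂ (deriv (f p.1) p.2)).restrictScalars ℝ)) p := by
  have hΩn : ∀ᶠ v in 𝓝 p, v ∈ Ω := hΩ.mem_nhds hp
  have hc := (hf.deriv_z hΩ).cont.continuousAt (hΩ.mem_nhds hp)
  have := hasStrictFDerivAt_uncurry_coprod (𝕜 := ℝ) (u := p) (f := f)
    (f₁ := fun t z => ContinuousLinearMap.toSpanSingleton ℝ (g t z))
    (f₂ := fun t z => (ContinuousLinearMap.toSpanSingleton ℂ (deriv (f t) z)).restrictScalars ℝ)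
    (by filter_upwards [hΩn] with v hv using (h v hv).hasFDerivAt)
    (by
      filter_upwards [hΩn] with v hv
      exact (hf.diff v hv).hasDerivAt.hasFDerivAt.restrictScalars ℝ)
    ((ContinuousLinearMap.toSpanSingletonCLE (𝕜 := ℝ) (E := E)).continuous.continuousAt.comp
      (hg.continuousAt (hΩ.mem_nhds hp)))
    (((ContinuousLinearMap.restrictScalarsL ℂ ℂ E ℝ ℝ).continuous.comp
      (ContinuousLinearMap.toSpanSingletonCLE (𝕜 := ℂ) (E := E)).continuous).continuousAt.comp hc)
  exact this.hasFDerivAt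

theorem contDiffOn_succ (hΩ : IsOpen Ω) (hf : HolFamily Ω f)
    (h : ∀ p ∈ Ω, HasDerivAt (fun s => f s p.2) (g p.1 p.2) p.1) {n : ℕ}
    (hg : ContDiffOn ℝ n (Function.uncurry g) Ω)
    (hd : ContDiffOn ℝ n (Function.uncurry fun t => deriv (f t)) Ω) :
    ContDiffOn ℝ (n + 1) (Function.uncurry f) Ω := by
  have hF := fun p hp => hf.hasFDerivAt hΩ hg.continuousOn h (p := p) hp
  rw [contDiffOn_succ_iff_fderiv_of_isOpen hΩ]
  refine ⟨fun p hp => (hF p hp).differentiableAt.differentiableWithinAt, by simp, ?_⟩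
  refine ContDiffOn.congr (f := fun p : ℝ × ℂ =>
    (ContinuousLinearMap.toSpanSingletonCLE (𝕜 := ℝ) (E := E) (g p.1 p.2)).comp
      (ContinuousLinearMap.fst ℝ ℝ ℂ) +
    ((ContinuousLinearMap.restrictScalarsL ℂ ℂ E ℝ ℝ)
      (ContinuousLinearMap.toSpanSingletonCLE (𝕜 := ℂ) (E := E) (deriv (f p.1) p.2))).comp
      (ContinuousLinearMap.snd ℝ ℝ ℂ)) ?_ fun p hp => ?_
  · refine ContDiffOn.add (ContDiffOn.clm_comp ?_ contDiffOn_const)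
      (ContDiffOn.clm_comp ?_ contDiffOn_const)
    · exact (ContinuousLinearMap.toSpanSingletonCLE (𝕜 := ℝ) (E := E)).contDiff.comp_contDiffOn hg
    · refine (ContinuousLinearMap.restrictScalarsL ℂ ℂ E ℝ ℝ).contDiff.comp_contDiffOn ?_
      exact ((ContinuousLinearMap.toSpanSingletonCLE (𝕜 := ℂ) (E := E)).contDiff.restrict_scalars
        ℝ).comp_contDiffOn hd
  · rw [(hF p hp).fderiv]
    ext <;> simp

theorem contDiffOn_one (hΩ : IsOpen Ω) (hf : HolFamily Ω f)
    (h : ∀ p ∈ Ω, HasDerivAt (fun s => f s p.2) (g p.1 p.2) p.1)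
    (hg : ContinuousOn (Function.uncurry g) Ω) :
    ContDiffOn ℝ 1 (Function.uncurry f) Ω := by
  have := hf.contDiffOn_succ hΩ h (n := 0) (by simpa using hg)
    (by simpa using (hf.deriv_z hΩ).cont)
  simpa using this

/-- Only the time derivatives have to be supplied. The spatial and mixed derivatives exist and are
continuous because holomorphy in z propagates through `deriv_z` and `deriv_t`. -/
theorem contDiffOn_two {k : ℝ → ℂ → E} (hΩ : IsOpen Ω) (hf : HolFamily Ω f)
    (h : ∀ p ∈ Ω, HasDerivAt (fun s => f s p.2) (g p.1 p.2) p.1)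
    (h' : ∀ p ∈ Ω, HasDerivAt (fun s => g s p.2) (k p.1 p.2) p.1)
    (hg : ContinuousOn (Function.uncurry g) Ω) (hk : ContinuousOn (Function.uncurry k) Ω) :
    ContDiffOn ℝ 2 (Function.uncurry f) Ω := by
  obtain ⟨hg', hd⟩ := deriv_t hΩ hf.diff hg h
  have h1 := (hf.deriv_z hΩ).contDiffOn_one hΩ hd (hg'.deriv_z hΩ).cont
  have h2 := hg'.contDiffOn_one hΩ h' hk
  exact hf.contDiffOn_succ hΩ h (n := 1) h2 h1

/-- The time derivatives of a twice continuously differentiable family of holomorphic functions. -/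
theorem of_contDiffOn_two (hΩ : IsOpen Ω) (hf : ContDiffOn ℝ 2 (Function.uncurry f) Ω)
    (hd : ∀ p ∈ Ω, DifferentiableAt ℂ (f p.1) p.2) :
    ∃ g k : ℝ → ℂ → E, HolFamily Ω f ∧ HolFamily Ω g ∧ HolFamily Ω k ∧
      (∀ p ∈ Ω, HasDerivAt (fun s => f s p.2) (g p.1 p.2) p.1) ∧
      ∀ p ∈ Ω, HasDerivAt (fun s => g s p.2) (k p.1 p.2) p.1 := by
  have slice : ∀ {u : ℝ × ℂ → E} {p : ℝ × ℂ}, DifferentiableAt ℝ u p →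
      HasDerivAt (fun s => u (s, p.2)) (fderiv ℝ u p (1, 0)) p.1 := by
    intro u p hu
    have h1 : HasDerivAt (fun s : ℝ => (s, p.2)) ((1 : ℝ), (0 : ℂ)) p.1 :=
      (hasDerivAt_id p.1).prodMk (hasDerivAt_const _ _)
    exact hu.hasFDerivAt.comp_hasDerivAt p.1 h1
  have step : ∀ {u : ℝ × ℂ → E} {n : ℕ}, ContDiffOn ℝ (n + 1) u Ω →
      ContDiffOn ℝ n (fun p => fderiv ℝ u p (1, 0)) Ω := fun hu =>
    ((contDiffOn_succ_iff_fderiv_of_isOpen hΩ).1 hu).2.2.clm_apply contDiffOn_const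
  have hf1 : ContDiffOn ℝ 1 (fun p => fderiv ℝ (Function.uncurry f) p (1, 0)) Ω :=
    step (n := 1) hf
  have hf2 := step (n := 0) (by simpa using hf1)
  set g : ℝ → ℂ → E := fun t z => fderiv ℝ (Function.uncurry f) (t, z) (1, 0)
  set k : ℝ → ℂ → E := fun t z =>
    fderiv ℝ (fun p => fderiv ℝ (Function.uncurry f) p (1, 0)) (t, z) (1, 0)
  have hfg : ∀ p ∈ Ω, HasDerivAt (fun s => f s p.2) (g p.1 p.2) p.1 := fun p hp =>
    slice ((hf.contDiffAt (hΩ.mem_nhds hp)).differentiableAt (by simp))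
  have hgk : ∀ p ∈ Ω, HasDerivAt (fun s => g s p.2) (k p.1 p.2) p.1 := fun p hp =>
    slice ((hf1.contDiffAt (hΩ.mem_nhds hp)).differentiableAt (by simp))
  have hgh := (deriv_t (g := g) hΩ hd hf1.continuousOn hfg).1
  exact ⟨g, k, ⟨hf.continuousOn, hd⟩, hgh,
    (deriv_t (g := k) hΩ hgh.diff hf2.continuousOn hgk).1, hfg, hgk⟩

end HolFamily
end Families

/-! ### Integrating derivative bounds from t = 0⁺ -/

section Comparison

variable {E : Type*} [NormedAddCommGroup E] [NormedSpace ℝ E]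

theorem norm_le_add_of_norm_deriv_le {f f' : ℝ → E} {B B' : ℝ → ℝ} {s t : ℝ} (hst : s ≤ t)
    (hf : ∀ x ∈ Icc s t, HasDerivAt f (f' x) x) (hB : ∀ x ∈ Icc s t, HasDerivAt B (B' x) x)
    (bound : ∀ x ∈ Icc s t, ‖f' x‖ ≤ B' x) : ‖f t - f s‖ ≤ B t - B s := by
  have h := image_norm_le_of_norm_deriv_right_le_deriv_boundary' (f := fun x => f x - f s)
    (f' := f') (a := s) (b := t) (B := fun x => B x - B s) (B' := B')
    (fun x hx => ((hf x hx).sub_const _).continuousAt.continuousWithinAt)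
    (fun x hx => ((hf x (Ico_subset_Icc_self hx)).sub_const _).hasDerivWithinAt)
    (by simp) (fun x hx => ((hB x hx).sub_const _).continuousAt.continuousWithinAt)
    (fun x hx => ((hB x (Ico_subset_Icc_self hx)).sub_const _).hasDerivWithinAt)
    (fun x hx => bound x (Ico_subset_Icc_self hx))
  exact h (right_mem_Icc.2 hst)

/-- A function that vanishes at `0⁺` is bounded by a nonnegative function whose derivative bounds
the norm of its derivative. -/
theorem norm_le_of_norm_deriv_le {f f' : ℝ → E} {B B' : ℝ → ℝ} {t : ℝ} (ht : 0 < t)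
    (hf : ∀ x ∈ Ioc 0 t, HasDerivAt f (f' x) x) (hB : ∀ x ∈ Ioc 0 t, HasDerivAt B (B' x) x)
    (bound : ∀ x ∈ Ioc 0 t, ‖f' x‖ ≤ B' x) (hB0 : ∀ x ∈ Ioc 0 t, 0 ≤ B x)
    (h0 : Tendsto f (𝓝[>] 0) (𝓝 0)) : ‖f t‖ ≤ B t := by
  have h1 : ∀ᶠ s in 𝓝[>] (0 : ℝ), ‖f t - f s‖ ≤ B t := by
    filter_upwards [Ioo_mem_nhdsGT ht] with s hs
    have hsub : ∀ x ∈ Icc s t, x ∈ Ioc 0 t := fun x hx => ⟨hs.1.trans_le hx.1, hx.2⟩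
    have := norm_le_add_of_norm_deriv_le hs.2.le (fun x hx => hf x (hsub x hx))
      (fun x hx => hB x (hsub x hx)) (fun x hx => bound x (hsub x hx))
    have := hB0 s ⟨hs.1, hs.2.le⟩
    linarith
  have h2 : Tendsto (fun s => ‖f t - f s‖) (𝓝[>] 0) (𝓝 ‖f t - 0‖) :=
    (tendsto_const_nhds.sub h0).norm
  simpa using le_of_tendsto h2 h1

theorem hasDerivAt_rpow_div {b C t : ℝ} (hb : b ≠ 0) (ht : 0 < t) :
    HasDerivAt (fun x => C / b * x ^ b) (C * t ^ (b - 1)) t := by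
  refine ((Real.hasDerivAt_rpow_const (p := b) (Or.inl ht.ne')).const_mul (C / b)).congr_deriv ?_
  rw [← mul_assoc, div_mul_cancel₀ _ hb]

theorem norm_le_of_norm_deriv_le_rpow {f f' : ℝ → E} {b C t : ℝ} (hb : 0 < b) (hC : 0 ≤ C)
    (ht : 0 < t) (hf : ∀ x ∈ Ioc 0 t, HasDerivAt f (f' x) x)
    (bound : ∀ x ∈ Ioc 0 t, ‖f' x‖ ≤ C * x ^ (b - 1)) (h0 : Tendsto f (𝓝[>] 0) (𝓝 0)) :
    ‖f t‖ ≤ C / b * t ^ b :=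
  norm_le_of_norm_deriv_le ht hf (fun _ hx => hasDerivAt_rpow_div hb.ne' hx.1) bound
    (fun x hx => by have := hx.1; positivity) h0

theorem tendsto_rpow_zero {b : ℝ} (hb : 0 < b) : Tendsto (fun t : ℝ => t ^ b) (𝓝[>] 0) (𝓝 0) := by
  have := (Real.continuousAt_rpow_const 0 b (Or.inr hb.le)).tendsto
  rw [Real.zero_rpow hb.ne'] at this
  exact this.mono_left nhdsWithin_le_nhds

theorem eventually_mul_rpow_lt {b C δ : ℝ} (hb : 0 < b) (hδ : 0 < δ) :
    ∀ᶠ t in 𝓝[>] (0 : ℝ), C * t ^ b < δ := by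
  have := (tendsto_rpow_zero hb).const_mul C
  rw [mul_zero] at this
  exact this.eventually (gt_mem_nhds hδ)

/-- A function with integrable derivative near `0⁺` has a limit there. -/
theorem exists_limit_of_norm_deriv_le_rpow [CompleteSpace E] {f f' : ℝ → E} {b C T : ℝ}
    (hb : 0 < b) (hC : 0 ≤ C) (hT : 0 < T) (hf : ∀ x ∈ Ioo 0 T, HasDerivAt f (f' x) x)
    (bound : ∀ x ∈ Ioo 0 T, ‖f' x‖ ≤ C * x ^ (b - 1)) :
    ∃ l, Tendsto f (𝓝[>] 0) (𝓝 l) ∧ ∀ t ∈ Ioo 0 T, ‖f t - l‖ ≤ C / b * t ^ b := by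
  have key : ∀ s t, 0 < s → s ≤ t → t < T → ‖f t - f s‖ ≤ C / b * t ^ b := by
    intro s t hs hst ht
    have hsub : ∀ x ∈ Icc s t, x ∈ Ioo 0 T := fun x hx => ⟨hs.trans_le hx.1, hx.2.trans_lt ht⟩
    have := norm_le_add_of_norm_deriv_le hst (fun x hx => hf x (hsub x hx))
      (fun x hx => hasDerivAt_rpow_div hb.ne' (hsub x hx).1) (fun x hx => bound x (hsub x hx))
    have : 0 ≤ C / b * s ^ b := by positivity
    linarith
  have hc : Cauchy (map f (𝓝[>] 0)) := by
    rw [Metric.cauchy_iff]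
    refine ⟨inferInstance, fun ε hε => ?_⟩
    obtain ⟨u, hu, hu'⟩ := (mem_nhdsGT_iff_exists_Ioo_subset.1
      (Filter.inter_mem (eventually_mul_rpow_lt (C := C / b) hb hε) (Ioo_mem_nhdsGT hT)))
    refine ⟨f '' Ioo 0 u, image_mem_map (Ioo_mem_nhdsGT hu), ?_⟩
    rintro _ ⟨x, hx, rfl⟩ _ ⟨y, hy, rfl⟩
    rcases le_total x y with h | h
    · rw [dist_comm, dist_eq_norm]
      exact (key x y hx.1 h (hu' hy).2.2).trans_lt (hu' hy).1
    · rw [dist_eq_norm]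
      exact (key y x hy.1 h (hu' hx).2.2).trans_lt (hu' hx).1
  obtain ⟨l, hl⟩ := cauchy_map_iff_exists_tendsto.1 hc
  refine ⟨l, hl, fun t ht => ?_⟩
  refine le_of_tendsto (tendsto_const_nhds.sub hl).norm ?_
  filter_upwards [Ioo_mem_nhdsGT ht.1] with s hs
  exact key s t hs.1 hs.2.le ht.2

end Comparison

/-! ### The regular primitive for the Euler operator -/

section Primitive

open MeasureTheory

variable {E : Type*} [NormedAddCommGroup E] [NormedSpace ℂ E]

/-- The solution `P` of `∂ₜ (t ^ b P) = t ^ (b - 1) N` that is regular at `t = 0`. -/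
noncomputable def eulerPrimitive (b : ℝ) (N : ℝ → ℂ → E) (t : ℝ) (z : ℂ) : E :=
  ∫ σ in (0 : ℝ)..1, σ ^ (b - 1) • N (σ * t) z

/-- Families bounded down to `t = 0`, locally uniformly on `Ω`. -/
def BoundedAtZero (Ω : Set (ℝ × ℂ)) (N : ℝ → ℂ → E) : Prop :=
  ∀ p ∈ Ω, ∃ V ∈ 𝓝 p, ∃ C : ℝ, ∀ q ∈ V, ∀ σ ∈ Ioc (0 : ℝ) 1, ‖N (σ * q.1) q.2‖ ≤ C

variable {Ω : Set (ℝ × ℂ)} {N : ℝ → ℂ → E} {b : ℝ}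

theorem intervalIntegrable_rpow_mul_const (hb : 0 < b) (C : ℝ) :
    IntervalIntegrable (fun σ : ℝ => σ ^ (b - 1) * C) volume 0 1 :=
  (intervalIntegral.intervalIntegrable_rpow' (by linarith)).mul_const C

theorem aestronglyMeasurable_rpow_smul (hstar : ∀ p ∈ Ω, ∀ σ ∈ Ioc (0 : ℝ) 1, (σ * p.1, p.2) ∈ Ω)
    (hN : ContinuousOn (Function.uncurry N) Ω) {p : ℝ × ℂ} (hp : p ∈ Ω) :
    AEStronglyMeasurable (fun σ : ℝ => σ ^ (b - 1) • N (σ * p.1) p.2)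
      (volume.restrict (uIoc (0 : ℝ) 1)) := by
  rw [uIoc_of_le zero_le_one]
  have h1 : ContinuousOn (fun s : ℝ => s ^ (b - 1)) (Ioc 0 1) :=
    fun σ hσ => (Real.continuousAt_rpow_const _ _ (Or.inl hσ.1.ne')).continuousWithinAt
  exact (h1.smul (hN.comp (f := fun σ : ℝ => (σ * p.1, p.2)) (by fun_prop)
    fun σ hσ => hstar p hp σ hσ)).aestronglyMeasurable measurableSet_Ioc

theorem norm_rpow_smul_le {C : ℝ} {t : ℝ} {z : ℂ} {σ : ℝ} (hσ : σ ∈ Ioc (0 : ℝ) 1)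
    (h : ‖N (σ * t) z‖ ≤ C) : ‖σ ^ (b - 1) • N (σ * t) z‖ ≤ σ ^ (b - 1) * C := by
  rw [norm_smul, Real.norm_of_nonneg (Real.rpow_nonneg hσ.1.le _)]
  exact mul_le_mul_of_nonneg_left h (Real.rpow_nonneg hσ.1.le _)

theorem norm_eulerPrimitive_le (hb : 0 < b) {C : ℝ} {t : ℝ} {z : ℂ}
    (h : ∀ σ ∈ Ioc (0 : ℝ) 1, ‖N (σ * t) z‖ ≤ C) : ‖eulerPrimitive b N t z‖ ≤ C / b := by
  have h1 := intervalIntegral.norm_integral_le_of_norm_le (zero_le_one' ℝ)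
    (ae_of_all volume fun σ hσ => norm_rpow_smul_le (b := b) hσ (h σ hσ))
    (intervalIntegrable_rpow_mul_const hb C)
  refine h1.trans (le_of_eq ?_)
  rw [intervalIntegral.integral_mul_const, integral_rpow (Or.inl (by linarith)), sub_add_cancel,
    Real.one_rpow, Real.zero_rpow hb.ne']
  ring

/-- The integral lives on the fixed interval [0, 1], so dominated convergence applies with the
majorant C σ^{b-1}, integrable because b > 0. -/
theorem continuousOn_eulerPrimitive (hΩ : IsOpen Ω)
    (hstar : ∀ p ∈ Ω, ∀ σ ∈ Ioc (0 : ℝ) 1, (σ * p.1, p.2) ∈ Ω) (hb : 0 < b)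
    (hN : ContinuousOn (Function.uncurry N) Ω) (hbd : BoundedAtZero Ω N) :
    ContinuousOn (Function.uncurry (eulerPrimitive b N)) Ω := by
  intro p hp
  obtain ⟨V, hV, C, hC⟩ := hbd p hp
  refine ContinuousAt.continuousWithinAt ?_
  refine intervalIntegral.continuousAt_of_dominated_interval (μ := volume)
    (F := fun (q : ℝ × ℂ) (σ : ℝ) => σ ^ (b - 1) • N (σ * q.1) q.2)
    (bound := fun σ => σ ^ (b - 1) * C) ?_ ?_ (intervalIntegrable_rpow_mul_const hb C) ?_
  · filter_upwards [hΩ.mem_nhds hp] with q hq using aestronglyMeasurable_rpow_smul hstar hN hq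
  · filter_upwards [hV] with q hq
    refine ae_of_all _ fun σ hσ => ?_
    rw [uIoc_of_le zero_le_one] at hσ
    exact norm_rpow_smul_le hσ (hC q hq σ hσ)
  · refine ae_of_all _ fun σ hσ => ?_
    rw [uIoc_of_le zero_le_one] at hσ
    refine ContinuousAt.smul continuousAt_const ?_
    have := hN.continuousAt (hΩ.mem_nhds (hstar p hp σ hσ))
    exact ContinuousAt.comp (f := fun q : ℝ × ℂ => (σ * q.1, q.2)) this (by fun_prop)

variable [CompleteSpace E]

theorem differentiableAt_eulerPrimitive (hΩ : IsOpen Ω)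
    (hstar : ∀ p ∈ Ω, ∀ σ ∈ Ioc (0 : ℝ) 1, (σ * p.1, p.2) ∈ Ω) (hb : 0 < b)
    (hN : HolFamily Ω N) (hbd : BoundedAtZero Ω N) {p : ℝ × ℂ} (hp : p ∈ Ω) :
    DifferentiableAt ℂ (eulerPrimitive b N p.1) p.2 := by
  obtain ⟨t, z⟩ := p
  obtain ⟨V, hV, C, hC⟩ := hbd _ hp
  obtain ⟨r, hr, hbox⟩ := exists_box hΩ hp
  obtain ⟨r', hr', hbox'⟩ := Metric.mem_nhds_iff.1 hV
  rw [← ball_prod_same] at hbox'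
  have ht := Metric.mem_ball_self (x := t) hr
  have ht' := Metric.mem_ball_self (x := t) hr'
  -- Half the common radius: a disc of radius δ about any w within δ of z stays where N is bounded
  -- by C. Cauchy's estimate then bounds ∂N by C/δ for all σ.
  set δ := min r r' / 2 with hδ
  have hδ0 : 0 < δ := half_pos (lt_min hr hr')
  have hδr : 2 * δ ≤ r ∧ 2 * δ ≤ r' := by
    constructor <;> simp only [hδ, mul_div_cancel₀ _ (two_ne_zero (α := ℝ)), min_le_left,
      min_le_right]
  have hmem : ∀ w ∈ Metric.ball z (2 * δ), (t, w) ∈ Ω ∧ (t, w) ∈ V := fun w hw =>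
    ⟨hbox ⟨ht, Metric.ball_subset_ball hδr.1 hw⟩, hbox' ⟨ht', Metric.ball_subset_ball hδr.2 hw⟩⟩
  have hsub : Metric.ball z δ ⊆ Metric.ball z (2 * δ) := Metric.ball_subset_ball (by linarith)
  have hint : IntervalIntegrable (fun σ : ℝ => σ ^ (b - 1) • N (σ * t) z) volume 0 1 := by
    refine (intervalIntegrable_rpow_mul_const hb C).mono_fun
      (aestronglyMeasurable_rpow_smul hstar hN.cont hp) ?_
    refine ae_restrict_of_forall_mem measurableSet_uIoc fun σ hσ => ?_
    rw [uIoc_of_le zero_le_one] at hσ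
    refine (norm_rpow_smul_le hσ (hC (t, z) (mem_of_mem_nhds hV) σ hσ)).trans (le_abs_self _)
  have h := intervalIntegral.hasDerivAt_integral_of_dominated_loc_of_deriv_le (𝕜 := ℂ)
    (μ := volume) (a := 0) (b := 1)
    (F := fun (w : ℂ) (σ : ℝ) => σ ^ (b - 1) • N (σ * t) w)
    (F' := fun (w : ℂ) (σ : ℝ) => σ ^ (b - 1) • deriv (N (σ * t)) w)
    (bound := fun σ => σ ^ (b - 1) * (C / δ)) (x₀ := z) (Metric.ball_mem_nhds z hδ0) ?_ hint
    (aestronglyMeasurable_rpow_smul (N := fun t => deriv (N t)) hstar (hN.deriv_z hΩ).cont hp)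
    ?_ (intervalIntegrable_rpow_mul_const hb _) ?_
  · exact h.2.differentiableAt
  · filter_upwards [Metric.ball_mem_nhds z hδ0] with w hw
    exact aestronglyMeasurable_rpow_smul hstar hN.cont (hmem w (hsub hw)).1
  · refine ae_of_all _ fun σ hσ w hw => ?_
    rw [uIoc_of_le zero_le_one] at hσ
    refine norm_rpow_smul_le (N := fun t => deriv (N t)) hσ ?_
    have hcb : Metric.closedBall w δ ⊆ Metric.ball z (2 * δ) := fun y hy => by
      have := dist_triangle y w z
      rw [Metric.mem_closedBall] at hy
      rw [Metric.mem_ball] at hw ⊢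
      linarith
    refine Complex.norm_deriv_le_of_forall_mem_sphere_norm_le hδ0 ?_ fun y hy =>
      hC (t, y) (hmem y (hcb (Metric.sphere_subset_closedBall hy))).2 σ hσ
    refine DifferentiableOn.diffContOnCl ?_
    rw [closure_ball _ hδ0.ne']
    exact hN.slice fun y hy => hstar (t, y) (hmem y (hcb hy)).1 σ hσ
  · refine ae_of_all _ fun σ hσ w hw => ?_
    rw [uIoc_of_le zero_le_one] at hσ
    exact (hN.diff _ (hstar (t, w) (hmem w (hsub hw)).1 σ hσ)).hasDerivAt.const_smul (σ ^ (b - 1))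

theorem holFamily_eulerPrimitive (hΩ : IsOpen Ω)
    (hstar : ∀ p ∈ Ω, ∀ σ ∈ Ioc (0 : ℝ) 1, (σ * p.1, p.2) ∈ Ω) (hb : 0 < b)
    (hN : HolFamily Ω N) (hbd : BoundedAtZero Ω N) : HolFamily Ω (eulerPrimitive b N) :=
  ⟨continuousOn_eulerPrimitive hΩ hstar hb hN.cont hbd,
    fun _ hp => differentiableAt_eulerPrimitive hΩ hstar hb hN hbd hp⟩

/-- The substitution s = σt shows that t^b times the primitive is ∫₀ᵗ s^{b-1} N(s, z) ds, to which
the fundamental theorem of calculus applies. -/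
theorem hasDerivAt_eulerPrimitive (hΩ : IsOpen Ω) (hpos : ∀ p ∈ Ω, 0 < p.1)
    (hstar : ∀ p ∈ Ω, ∀ σ ∈ Ioc (0 : ℝ) 1, (σ * p.1, p.2) ∈ Ω) (hb : 0 < b)
    (hN : HolFamily Ω N) (hbd : BoundedAtZero Ω N) {p : ℝ × ℂ} (hp : p ∈ Ω) :
    HasDerivAt (fun t : ℝ => t ^ b • eulerPrimitive b N t p.2) (p.1 ^ (b - 1) • N p.1 p.2) p.1 := by
  obtain ⟨t, z⟩ := p
  have ht : 0 < t := hpos _ hp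
  have hmem : ∀ s ∈ Ioc 0 t, (s, z) ∈ Ω := fun s hs => by
    have := hstar (t, z) hp (s / t) ⟨div_pos hs.1 ht, (div_le_one ht).2 hs.2⟩
    simpa [div_mul_cancel₀ _ ht.ne'] using this
  obtain ⟨V, hV, C, hC⟩ := hbd _ hp
  have hcont : ContinuousOn (fun s : ℝ => s ^ (b - 1) • N s z) (Ioc 0 t) := by
    have h1 : ContinuousOn (fun s : ℝ => s ^ (b - 1)) (Ioc 0 t) :=
      fun σ hσ => (Real.continuousAt_rpow_const _ _ (Or.inl hσ.1.ne')).continuousWithinAt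
    exact h1.smul (hN.cont.comp (f := fun s : ℝ => (s, z)) (by fun_prop) hmem)
  have hint : IntervalIntegrable (fun s : ℝ => s ^ (b - 1) • N s z) volume 0 t := by
    have h0 : IntervalIntegrable (fun s : ℝ => s ^ (b - 1) * C) volume 0 t :=
      (intervalIntegral.intervalIntegrable_rpow' (by linarith)).mul_const C
    refine h0.mono_fun ?_ ?_
    · rw [uIoc_of_le ht.le]
      exact hcont.aestronglyMeasurable measurableSet_Ioc
    · refine ae_restrict_of_forall_mem measurableSet_uIoc fun s hs => ?_
      rw [uIoc_of_le ht.le] at hs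
      have h1 := hC (t, z) (mem_of_mem_nhds hV) (s / t)
        ⟨div_pos hs.1 ht, (div_le_one ht).2 hs.2⟩
      simp only [div_mul_cancel₀ _ ht.ne'] at h1
      simp only [norm_smul, norm_mul]
      exact mul_le_mul_of_nonneg_left (h1.trans (le_abs_self _)) (norm_nonneg _)
  have hNc : ContinuousAt (fun s : ℝ => N s z) t :=
    ContinuousAt.comp (f := fun s : ℝ => (s, z)) (hN.cont.continuousAt (hΩ.mem_nhds hp))
      (by fun_prop)
  have hca : ∀ᶠ s in 𝓝 t, ContinuousAt (fun s : ℝ => s ^ (b - 1) • N s z) s := by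
    have h1 : ∀ᶠ s in 𝓝 t, (s, z) ∈ Ω :=
      (Continuous.prodMk continuous_id continuous_const).continuousAt.eventually (hΩ.mem_nhds hp)
    filter_upwards [h1] with s hs
    exact (Real.continuousAt_rpow_const _ _ (Or.inl (hpos _ hs).ne')).smul
      (ContinuousAt.comp (f := fun s : ℝ => (s, z)) (hN.cont.continuousAt (hΩ.mem_nhds hs))
        (by fun_prop))
  -- The integrand is continuous at every point near t. The interior of its set of continuity points
  -- is thus an open neighbourhood of t, which gives the measurability near t that the theorem asks
  -- for.
  have hder := intervalIntegral.integral_hasDerivAt_right hint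
    (ContinuousAt.stronglyMeasurableAtFilter (s := interior {s : ℝ |
      ContinuousAt (fun s : ℝ => s ^ (b - 1) • N s z) s}) isOpen_interior
      (fun s hs => interior_subset hs) t (mem_interior_iff_mem_nhds.2 hca)) hca.self_of_nhds
  refine hder.congr_of_eventuallyEq ?_
  filter_upwards [lt_mem_nhds ht] with s hs
  have h2 := intervalIntegral.smul_integral_comp_mul_right (a := 0) (b := 1)
    (fun s : ℝ => s ^ (b - 1) • N s z) s
  rw [zero_mul, one_mul] at h2
  rw [← h2, eulerPrimitive, ← intervalIntegral.integral_smul, ← intervalIntegral.integral_smul]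
  refine intervalIntegral.integral_congr_ae (ae_of_all _ fun σ hσ => ?_)
  rw [uIoc_of_le zero_le_one] at hσ
  simp only [smul_smul]
  rw [Real.mul_rpow hσ.1.le hs.le]
  congr 1
  have : s ^ b = s * s ^ (b - 1) := by
    rw [Real.rpow_sub_one hs.ne']; field_simp
  rw [this]; ring

end Primitive

/-! ### Cauchy estimates on discs -/

section Cauchy

variable {E : Type*} [NormedAddCommGroup E] [NormedSpace ℂ E]

/-- Cauchy's estimate on the circle of radius r/2. The factor 2 is the price for assuming nothing on
the boundary of the disc. -/
theorem norm_deriv_le_of_ball {f : ℂ → E} {z : ℂ} {r C : ℝ} (hr : 0 < r)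
    (hf : DifferentiableOn ℂ f (Metric.ball z r)) (hC : ∀ w ∈ Metric.ball z r, ‖f w‖ ≤ C) :
    ‖deriv f z‖ ≤ 2 * C / r := by
  refine le_of_forall_pos_le_add fun ε hε => ?_
  have hC0 : 0 ≤ C := (norm_nonneg _).trans (hC z (Metric.mem_ball_self hr))
  have hsub : Metric.closedBall z (r / 2) ⊆ Metric.ball z r :=
    Metric.closedBall_subset_ball (by linarith)
  have h := Complex.norm_deriv_le_of_forall_mem_sphere_norm_le (f := f) (c := z) (R := r / 2)
    (C := C) (by linarith)
    (DifferentiableOn.diffContOnCl (by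
      rw [closure_ball _ (by linarith)]; exact hf.mono hsub))
    (fun w hw => hC w (hsub (Metric.sphere_subset_closedBall hw)))
  have : C / (r / 2) = 2 * C / r := by field_simp
  linarith

theorem norm_deriv_le_of_ball_of_mem {f : ℂ → E} {c z : ℂ} {r R C : ℝ} (hr : r < R)
    (hf : DifferentiableOn ℂ f (Metric.ball c R)) (hC : ∀ w ∈ Metric.ball c R, ‖f w‖ ≤ C)
    (hz : z ∈ Metric.ball c r) : ‖deriv f z‖ ≤ 2 * C / (R - r) := by
  have hsub : Metric.ball z (R - r) ⊆ Metric.ball c R := by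
    refine Metric.ball_subset_ball' ?_
    have := Metric.mem_ball.1 hz
    linarith
  exact norm_deriv_le_of_ball (sub_pos.2 hr) (hf.mono hsub) fun w hw => hC w (hsub hw)

theorem im_deriv_eq_zero {f : ℂ → ℂ} {x : ℝ} (hf : DifferentiableAt ℂ f x)
    (h : ∀ᶠ y : ℝ in 𝓝 x, (f y).im = 0) : (deriv f x).im = 0 := by
  have h1 : HasDerivAt (fun y : ℝ => (f y).im) (deriv f x).im x :=
    Complex.imCLM.hasFDerivAt.comp_hasDerivAt x hf.hasDerivAt.comp_ofReal
  exact h1.unique ((hasDerivAt_const x (0 : ℝ)).congr_of_eventuallyEq h)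

end Cauchy

/-! ### The shrinking cone and its weighted estimates -/

section Cone

/-- The distance, in the spatial direction and at the scale of the shrinking domain, of a point
to the boundary of the cone. -/
noncomputable def coneGap (z₀ : ℂ) (ρ η μ : ℝ) (t : ℝ) (z : ℂ) : ℝ :=
  ρ - ‖z - z₀‖ - η * t ^ μ

/-- A conical neighbourhood of `(0, z₀)` in `(0, ∞) × ℂ`. -/
def cone (z₀ : ℂ) (ρ η μ : ℝ) : Set (ℝ × ℂ) :=
  {p | 0 < p.1 ∧ 0 < coneGap z₀ ρ η μ p.1 p.2}

variable {z₀ : ℂ} {ρ η μ : ℝ}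

theorem continuous_coneGap (hμ : 0 < μ) :
    Continuous fun p : ℝ × ℂ => coneGap z₀ ρ η μ p.1 p.2 := by
  unfold coneGap
  have : Continuous fun p : ℝ × ℂ => p.1 ^ μ :=
    (Real.continuous_rpow_const hμ.le).comp continuous_fst
  fun_prop

theorem isOpen_cone (hμ : 0 < μ) : IsOpen (cone z₀ ρ η μ) :=
  (isOpen_lt continuous_const continuous_fst).inter
    (isOpen_lt continuous_const (continuous_coneGap hμ))

theorem coneGap_anti (hη : 0 < η) (hμ : 0 < μ) {s t : ℝ} (hs : 0 < s) (hst : s ≤ t) (z : ℂ) :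
    coneGap z₀ ρ η μ t z ≤ coneGap z₀ ρ η μ s z := by
  have := Real.rpow_le_rpow hs.le hst hμ.le
  unfold coneGap
  nlinarith

theorem coneGap_le (hη : 0 < η) {t : ℝ} (ht : 0 < t) (z : ℂ) : coneGap z₀ ρ η μ t z ≤ ρ := by
  have : 0 ≤ η * t ^ μ := by positivity
  have := norm_nonneg (z - z₀)
  unfold coneGap
  linarith

theorem cone_mem_of_le (hη : 0 < η) (hμ : 0 < μ) {s t : ℝ} {z : ℂ} (h : (t, z) ∈ cone z₀ ρ η μ)
    (hs : 0 < s) (hst : s ≤ t) : (s, z) ∈ cone z₀ ρ η μ :=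
  ⟨hs, lt_of_lt_of_le h.2 (coneGap_anti hη hμ hs hst z)⟩

theorem cone_star (hη : 0 < η) (hμ : 0 < μ) :
    ∀ p ∈ cone z₀ ρ η μ, ∀ σ ∈ Ioc (0 : ℝ) 1, (σ * p.1, p.2) ∈ cone z₀ ρ η μ := by
  rintro ⟨t, z⟩ hp σ hσ
  exact cone_mem_of_le hη hμ hp (mul_pos hσ.1 hp.1) (mul_le_of_le_one_left hp.1.le hσ.2)

theorem cone_mem_ball (hη : 0 < η) {p : ℝ × ℂ} (h : p ∈ cone z₀ ρ η μ) :
    p.2 ∈ Metric.ball z₀ ρ := by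
  have h1 := h.1
  have h2 := h.2
  have : 0 ≤ η * p.1 ^ μ := by positivity
  rw [mem_ball_iff_norm]
  unfold coneGap at h2
  linarith

theorem cone_lt {T : ℝ} (hη : 0 < η) (hμ : 0 < μ) (hT : 0 < T) (hηT : ρ ≤ η * T ^ μ) {p : ℝ × ℂ}
    (h : p ∈ cone z₀ ρ η μ) : p.1 ∈ Ioo 0 T := by
  refine ⟨h.1, ?_⟩
  have h2 := h.2
  have := norm_nonneg (p.2 - z₀)
  unfold coneGap at h2
  have h3 : η * p.1 ^ μ < η * T ^ μ := by linarith
  exact (Real.rpow_lt_rpow_iff h.1.le hT.le hμ).1 (lt_of_mul_lt_mul_left h3 hη.le)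

theorem ball_mem_cone {t : ℝ} {z w : ℂ} {r : ℝ} (ht : 0 < t)
    (hr : r ≤ coneGap z₀ ρ η μ t z) (hw : w ∈ Metric.ball z r) :
    (t, w) ∈ cone z₀ ρ η μ ∧ coneGap z₀ ρ η μ t z - r < coneGap z₀ ρ η μ t w := by
  rw [mem_ball_iff_norm] at hw
  have h1 : ‖w - z₀‖ ≤ ‖w - z‖ + ‖z - z₀‖ := by
    have := norm_add_le (w - z) (z - z₀)
    rwa [sub_add_sub_cancel] at this
  have h2 : coneGap z₀ ρ η μ t z - r < coneGap z₀ ρ η μ t w := by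
    unfold coneGap; linarith
  exact ⟨⟨ht, by show 0 < coneGap z₀ ρ η μ t w; linarith⟩, h2⟩

/-- Nagumo's lemma: a bound by an inverse power of the gap loses one power on differentiation. -/
theorem nagumo {E : Type*} [NormedAddCommGroup E] [NormedSpace ℂ E] {f : ℂ → E} {t K : ℝ}
    (hK : 0 ≤ K) (hf : ∀ w, (t, w) ∈ cone z₀ ρ η μ → DifferentiableAt ℂ f w)
    (hb : ∀ w, (t, w) ∈ cone z₀ ρ η μ → ‖f w‖ ≤ K / √(coneGap z₀ ρ η μ t w)) {z : ℂ}
    (hz : (t, z) ∈ cone z₀ ρ η μ) :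
    ‖deriv f z‖ ≤ 6 * K / (coneGap z₀ ρ η μ t z * √(coneGap z₀ ρ η μ t z)) := by
  set d := coneGap z₀ ρ η μ t z with hd
  have hd0 : 0 < d := hz.2
  have hs : √(d / 4) = √d / 2 := by
    rw [Real.sqrt_div hd0.le]
    norm_num
  -- On the disc of radius 3d/4 the gap stays above d/4, so f is bounded there by 2K/√d. Cauchy's
  -- estimate gives 16K/(3d√d), rounded up to 6K/(d√d).
  have hr : 3 * d / 4 ≤ coneGap z₀ ρ η μ t z := by rw [← hd]; linarith
  have h := norm_deriv_le_of_ball (f := f) (z := z) (r := 3 * d / 4) (C := K / (√d / 2))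
    (by positivity)
    (fun w hw => (hf w (ball_mem_cone hz.1 hr hw).1).differentiableWithinAt) fun w hw => by
      obtain ⟨h1, h2⟩ := ball_mem_cone hz.1 hr hw
      refine (hb w h1).trans ?_
      rw [← hs]
      have : d / 4 ≤ coneGap z₀ ρ η μ t w := by rw [← hd] at h2; linarith
      gcongr
  refine h.trans ?_
  have h0 : 0 < √d := Real.sqrt_pos.2 hd0
  have h1 : 2 * (K / (√d / 2)) / (3 * d / 4) = 16 / 3 * K / (d * √d) := by field_simp; ring
  rw [h1]
  gcongr
  norm_num

theorem hasDerivAt_coneGap (z : ℂ) {t : ℝ} (ht : 0 < t) :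
    HasDerivAt (fun s => coneGap z₀ ρ η μ s z) (-(η * (μ * t ^ (μ - 1)))) t := by
  unfold coneGap
  exact ((Real.hasDerivAt_rpow_const (p := μ) (Or.inl ht.ne')).const_mul η).const_sub _

/-- The gap d has ∂ₜd = -ημ t^{μ-1}, so t^{μ-1} d^{-3/2} has the primitive 2/(ημ) d^{-1/2}.
Integration in time thus restores the power of d lost in Nagumo's lemma, with a factor that is small
on a steep cone. -/
theorem hasDerivAt_inv_sqrt_coneGap (hη : 0 < η) (hμ : 0 < μ) (K : ℝ) {z : ℂ} {t : ℝ}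
    (h : (t, z) ∈ cone z₀ ρ η μ) :
    HasDerivAt (fun s => 2 * K / (η * μ) / √(coneGap z₀ ρ η μ s z))
      (K * t ^ (μ - 1) / (coneGap z₀ ρ η μ t z * √(coneGap z₀ ρ η μ t z))) t := by
  have hd : 0 < coneGap z₀ ρ η μ t z := h.2
  have h1 := ((hasDerivAt_coneGap (z₀ := z₀) (ρ := ρ) (η := η) (μ := μ) z h.1).sqrt
    hd.ne').inv (Real.sqrt_pos.2 hd).ne'
  refine (h1.const_mul (2 * K / (η * μ))).congr_deriv ?_
  have h2 : √(coneGap z₀ ρ η μ t z) ≠ 0 := (Real.sqrt_pos.2 hd).ne'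
  rw [Real.sq_sqrt hd.le]
  field_simp

/-- One power lower the primitive is bounded up to the boundary of the cone. The constant √ρ makes
it nonnegative, since the gap never exceeds ρ. -/
theorem hasDerivAt_sqrt_coneGap (hη : 0 < η) (hμ : 0 < μ) (K : ℝ) {z : ℂ} {t : ℝ}
    (h : (t, z) ∈ cone z₀ ρ η μ) :
    HasDerivAt (fun s => 2 * K / (η * μ) * (√ρ - √(coneGap z₀ ρ η μ s z)))
      (K * t ^ (μ - 1) / √(coneGap z₀ ρ η μ t z)) t := by
  have hd : 0 < coneGap z₀ ρ η μ t z := h.2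
  have h1 := ((hasDerivAt_coneGap (z₀ := z₀) (ρ := ρ) (η := η) (μ := μ) z h.1).sqrt
    hd.ne').const_sub (√ρ)
  refine (h1.const_mul (2 * K / (η * μ))).congr_deriv ?_
  have h2 : √(coneGap z₀ ρ η μ t z) ≠ 0 := (Real.sqrt_pos.2 hd).ne'
  field_simp

section Integrate

variable {f : ℝ → ℂ} {n : ℝ → ℂ} {γ K : ℝ} {t : ℝ} {z : ℂ}

theorem rpow_smul_bound (hγ : 0 ≤ γ) {s A : ℝ} (hs : s ∈ Ioc 0 t) (hn : ‖n s‖ ≤ A) :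
    ‖s ^ (γ + μ - 1) • n s‖ ≤ t ^ γ * (s ^ (μ - 1) * A) := by
  have hA : 0 ≤ A := (norm_nonneg _).trans hn
  rw [norm_smul, Real.norm_of_nonneg (Real.rpow_nonneg hs.1.le _), add_sub_assoc,
    Real.rpow_add hs.1, mul_assoc]
  have := hs.1
  have := hs.1.trans_le hs.2
  have := Real.rpow_le_rpow hs.1.le hs.2 hγ
  gcongr

theorem norm_le_of_rpow_smul (ht : 0 < t) {A : ℝ} (h : ‖t ^ γ • f t‖ ≤ t ^ γ * A) : ‖f t‖ ≤ A := by
  have h0 : 0 < t ^ γ := Real.rpow_pos_of_pos ht _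
  rw [norm_smul, Real.norm_of_nonneg h0.le] at h
  exact le_of_mul_le_mul_left h h0

/-- The factor s^γ ≤ t^γ is pulled out of the integral and cancels against t^γ in front of f, so
that the bound is independent of γ. -/
theorem norm_le_inv_sqrt (hη : 0 < η) (hμ : 0 < μ) (hγ : 0 ≤ γ) (hK : 0 ≤ K)
    (h : (t, z) ∈ cone z₀ ρ η μ)
    (hf : ∀ s ∈ Ioc 0 t, HasDerivAt (fun s => s ^ γ • f s) (s ^ (γ + μ - 1) • n s) s)
    (h0 : Tendsto (fun s => s ^ γ • f s) (𝓝[>] 0) (𝓝 0))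
    (hn : ∀ s ∈ Ioc 0 t, ‖n s‖ ≤ K / (coneGap z₀ ρ η μ s z * √(coneGap z₀ ρ η μ s z))) :
    ‖f t‖ ≤ 2 * K / (η * μ) / √(coneGap z₀ ρ η μ t z) := by
  have hm := fun s (hs : s ∈ Ioc 0 t) => cone_mem_of_le hη hμ h hs.1 hs.2
  refine norm_le_of_rpow_smul h.1 (norm_le_of_norm_deriv_le h.1 hf
    (fun s hs => (hasDerivAt_inv_sqrt_coneGap hη hμ K (hm s hs)).const_mul (t ^ γ))
    (fun s hs => (rpow_smul_bound hγ hs (hn s hs)).trans (le_of_eq (by ring)))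
    (fun s hs => ?_) h0)
  have := h.1
  positivity

theorem norm_le_const (hη : 0 < η) (hμ : 0 < μ) (hγ : 0 ≤ γ) (hK : 0 ≤ K) (hρ : ρ ≤ 1)
    (h : (t, z) ∈ cone z₀ ρ η μ)
    (hf : ∀ s ∈ Ioc 0 t, HasDerivAt (fun s => s ^ γ • f s) (s ^ (γ + μ - 1) • n s) s)
    (h0 : Tendsto (fun s => s ^ γ • f s) (𝓝[>] 0) (𝓝 0))
    (hn : ∀ s ∈ Ioc 0 t, ‖n s‖ ≤ K / √(coneGap z₀ ρ η μ s z)) :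
    ‖f t‖ ≤ 2 * K / (η * μ) := by
  have hm := fun s (hs : s ∈ Ioc 0 t) => cone_mem_of_le hη hμ h hs.1 hs.2
  refine norm_le_of_rpow_smul (γ := γ) h.1 ((norm_le_of_norm_deriv_le h.1 hf
    (fun s hs => (hasDerivAt_sqrt_coneGap hη hμ K (hm s hs)).const_mul (t ^ γ))
    (fun s hs => (rpow_smul_bound hγ hs (hn s hs)).trans (le_of_eq (by ring)))
    (fun s hs => ?_) h0).trans ?_)
  · have := h.1
    have : 0 ≤ √ρ - √(coneGap z₀ ρ η μ s z) :=
      sub_nonneg.2 (Real.sqrt_le_sqrt (coneGap_le hη hs.1 z))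
    positivity
  · have := h.1
    have h1 : √ρ - √(coneGap z₀ ρ η μ t z) ≤ 1 := by
      have h2 : √ρ ≤ 1 := Real.sqrt_le_one.2 hρ
      have := Real.sqrt_nonneg (coneGap z₀ ρ η μ t z)
      linarith
    exact mul_le_mul_of_nonneg_left (mul_le_of_le_one_right (by positivity) h1) (by positivity)

end Integrate

end Cone

/-! ### The Fuchsian system: contraction and uniqueness -/

section Fuchsian

variable {ι : Type*} [Fintype ι]

/-- A nonlinearity `F(t, z, X)` that is continuous, and holomorphic in `(z, X)` with a bound uniform
in `t`. -/
structure TameNonlinearity (z₀ : ℂ) (ρ T M : ℝ) (F : ℝ → ℂ → (ι → ℂ) → (ι → ℂ)) : Prop where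
  cont : ContinuousOn (fun p : ℝ × ℂ × (ι → ℂ) => F p.1 p.2.1 p.2.2)
    (Ioo 0 T ×ˢ Metric.ball z₀ (2 * ρ) ×ˢ Metric.ball 0 (2 * ρ))
  diff : ∀ t ∈ Ioo 0 T, DifferentiableOn ℂ (fun p : ℂ × (ι → ℂ) => F t p.1 p.2)
    (Metric.ball z₀ (2 * ρ) ×ˢ Metric.ball 0 (2 * ρ))
  bound : ∀ t ∈ Ioo 0 T, ∀ z ∈ Metric.ball z₀ (2 * ρ), ∀ X ∈ Metric.ball (0 : ι → ℂ) (2 * ρ),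
    ‖F t z X‖ ≤ M

/-- The hypotheses on the Fuchsian system `∂ₜ (t ^ γ X) = t ^ (γ + μ - 1) (∂_z G(t, z, X) + H)`. -/
structure FuchsianSystem (z₀ : ℂ) (ρ T M μ : ℝ) (γ : ι → ℝ)
    (G H : ℝ → ℂ → (ι → ℂ) → (ι → ℂ)) : Prop where
  ρ_pos : 0 < ρ
  ρ_le : ρ ≤ 1
  T_pos : 0 < T
  M_nonneg : 0 ≤ M
  μ_pos : 0 < μ
  γ_pos : ∀ i, 0 < γ i
  tameG : TameNonlinearity z₀ ρ T M G
  tameH : TameNonlinearity z₀ ρ T M H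

/-- The right-hand side `∂_z [G(t, z, X(t, z))] + H(t, z, X(t, z))`. -/
noncomputable def fuchsRHS (G H : ℝ → ℂ → (ι → ℂ) → (ι → ℂ)) (X : ℝ → ℂ → ι → ℂ) (t : ℝ) (z : ℂ) :
    ι → ℂ :=
  deriv (fun w => G t w (X t w)) z + H t z (X t z)

/-- `∂ₜ (t ^ γ X') = t ^ (γ + μ - 1) (∂_z G(t, z, X) + H)` on `Ω`, with `t ^ γ X' → 0`. -/
structure IsFuchsImage (μ : ℝ) (γ : ι → ℝ) (G H : ℝ → ℂ → (ι → ℂ) → (ι → ℂ)) (Ω : Set (ℝ × ℂ))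
    (X X' : ℝ → ℂ → ι → ℂ) : Prop where
  deriv : ∀ p ∈ Ω, ∀ i, HasDerivAt (fun s => s ^ γ i • X' s p.2 i)
    (p.1 ^ (γ i + μ - 1) • fuchsRHS G H X p.1 p.2 i) p.1
  tendsto : ∀ p ∈ Ω, ∀ i, Tendsto (fun s => s ^ γ i • X' s p.2 i) (𝓝[>] 0) (𝓝 0)

/-- Families of holomorphic functions on `Ω` with values in the closed ball of radius `ρ`. -/
structure IsAdmissible (Ω : Set (ℝ × ℂ)) (ρ : ℝ) (X : ℝ → ℂ → ι → ℂ) : Prop where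
  diff : ∀ p ∈ Ω, DifferentiableAt ℂ (X p.1) p.2
  bound : ∀ p ∈ Ω, ‖X p.1 p.2‖ ≤ ρ

variable {z₀ : ℂ} {ρ T M μ η : ℝ} {γ : ι → ℝ} {F G H : ℝ → ℂ → (ι → ℂ) → (ι → ℂ)}
  {X Y X' Y' : ℝ → ℂ → ι → ℂ}

/-- Schwarz lemma on the ball of radius ρ about (z, x), where F deviates from its central value by
at most 2M. If (z', x') lies outside that ball, the distance is at least ρ and the bound 2M is
itself enough. -/
theorem TameNonlinearity.lipschitz (hF : TameNonlinearity z₀ ρ T M F) (hρ : 0 < ρ) {t : ℝ}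
    (ht : t ∈ Ioo 0 T) {z z' : ℂ} {x x' : ι → ℂ} (hz : z ∈ Metric.ball z₀ ρ)
    (hz' : z' ∈ Metric.ball z₀ ρ) (hx : ‖x‖ ≤ ρ) (hx' : ‖x'‖ ≤ ρ) :
    ‖F t z' x' - F t z x‖ ≤ 2 * M / ρ * max ‖z' - z‖ ‖x' - x‖ := by
  have hx2 : ∀ y : ι → ℂ, ‖y‖ ≤ ρ → y ∈ Metric.ball (0 : ι → ℂ) (2 * ρ) := fun y hy => by
    rw [mem_ball_zero_iff]; linarith
  have hz2 : ∀ w ∈ Metric.ball z₀ ρ, w ∈ Metric.ball z₀ (2 * ρ) := fun w hw =>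
    Metric.ball_subset_ball (by linarith) hw
  have hM : 0 ≤ M := (norm_nonneg _).trans (hF.bound t ht z (hz2 z hz) x (hx2 x hx))
  have h2M : ∀ w ∈ Metric.ball z₀ (2 * ρ), ∀ y ∈ Metric.ball (0 : ι → ℂ) (2 * ρ),
      ‖F t w y - F t z x‖ ≤ 2 * M := fun w hw y hy =>
    (norm_sub_le _ _).trans (by
      have := hF.bound t ht w hw y hy
      have := hF.bound t ht z (hz2 z hz) x (hx2 x hx)
      linarith)
  have hsub : Metric.ball (z, x) ρ ⊆ Metric.ball z₀ (2 * ρ) ×ˢ Metric.ball (0 : ι → ℂ) (2 * ρ) := by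
    rintro ⟨w, y⟩ hw
    rw [← ball_prod_same] at hw
    constructor
    · have h1 := Metric.mem_ball.1 hw.1
      have h2 := Metric.mem_ball.1 hz
      have := dist_triangle w z z₀
      simp only [Metric.mem_ball] at *
      linarith
    · have h1 := mem_ball_iff_norm.1 hw.2
      have := norm_add_le (y - x) x
      simp only [sub_add_cancel] at this
      simp only [mem_ball_zero_iff] at *
      linarith
  have hdist : dist (z', x') (z, x) = max ‖z' - z‖ ‖x' - x‖ := by
    rw [Prod.dist_eq, dist_eq_norm, dist_eq_norm]
  by_cases h : (z', x') ∈ Metric.ball (z, x) ρ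
  · have := Complex.dist_le_div_mul_dist_of_mapsTo_ball (R₂ := 2 * M)
      ((hF.diff t ht).mono hsub) (fun q hq => by
        rw [mem_closedBall_iff_norm]
        exact h2M q.1 (hsub hq).1 q.2 (hsub hq).2) h
    rwa [dist_eq_norm, hdist] at this
  · rw [Metric.mem_ball, hdist, not_lt] at h
    refine (h2M z' (hz2 z' hz') x' (hx2 x' hx')).trans ?_
    rw [div_mul_eq_mul_div, le_div_iff₀ hρ]
    exact mul_le_mul_of_nonneg_left h (by positivity)

namespace FuchsianSystem

theorem coneGap_bounds (S : FuchsianSystem z₀ ρ T M μ γ G H) (hη : 0 < η)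
    {p : ℝ × ℂ} (hp : p ∈ cone z₀ ρ η μ) :
    0 < coneGap z₀ ρ η μ p.1 p.2 ∧ coneGap z₀ ρ η μ p.1 p.2 ≤ 1 ∧
      0 < √(coneGap z₀ ρ η μ p.1 p.2) ∧ √(coneGap z₀ ρ η μ p.1 p.2) ≤ 1 := by
  have h : coneGap z₀ ρ η μ p.1 p.2 ≤ 1 := (coneGap_le hη hp.1 p.2).trans S.ρ_le
  exact ⟨hp.2, h, Real.sqrt_pos.2 hp.2, Real.sqrt_le_one.2 h⟩

theorem le_div_sqrt (S : FuchsianSystem z₀ ρ T M μ γ G H) (hη : 0 < η)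
    {K : ℝ} (hK : 0 ≤ K) {p : ℝ × ℂ} (hp : p ∈ cone z₀ ρ η μ) :
    K ≤ K / √(coneGap z₀ ρ η μ p.1 p.2) := by
  obtain ⟨-, -, h1, h2⟩ := S.coneGap_bounds hη hp
  exact le_div_self hK h1 h2

theorem div_sqrt_le (S : FuchsianSystem z₀ ρ T M μ γ G H) (hη : 0 < η)
    {K : ℝ} (hK : 0 ≤ K) {p : ℝ × ℂ} (hp : p ∈ cone z₀ ρ η μ) :
    K / √(coneGap z₀ ρ η μ p.1 p.2) ≤
      K / (coneGap z₀ ρ η μ p.1 p.2 * √(coneGap z₀ ρ η μ p.1 p.2)) := by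
  obtain ⟨h0, h0', h1, h2⟩ := S.coneGap_bounds hη hp
  exact div_le_div_of_nonneg_left hK (by positivity) (mul_le_of_le_one_left h1.le h0')

variable (S : FuchsianSystem z₀ ρ T M μ γ G H) (hη : 0 < η) (hηT : ρ ≤ η * T ^ μ)

section
include S hη hηT

theorem mem_prod (hX : ∀ p ∈ cone z₀ ρ η μ, ‖X p.1 p.2‖ ≤ ρ) {p : ℝ × ℂ}
    (hp : p ∈ cone z₀ ρ η μ) :
    p.1 ∈ Ioo 0 T ∧ p.2 ∈ Metric.ball z₀ (2 * ρ) ∧ X p.1 p.2 ∈ Metric.ball (0 : ι → ℂ) (2 * ρ) := by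
  refine ⟨cone_lt hη S.μ_pos S.T_pos hηT hp,
    Metric.ball_subset_ball (by linarith [S.ρ_pos]) (cone_mem_ball hη hp), ?_⟩
  rw [mem_ball_zero_iff]
  linarith [hX p hp, S.ρ_pos]

theorem differentiableAt_comp (hF : TameNonlinearity z₀ ρ T M F)
    (hX : IsAdmissible (cone z₀ ρ η μ) ρ X) {p : ℝ × ℂ} (hp : p ∈ cone z₀ ρ η μ) :
    DifferentiableAt ℂ (fun w => F p.1 w (X p.1 w)) p.2 := by
  obtain ⟨h1, h2, h3⟩ := S.mem_prod hη hηT hX.bound hp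
  have h4 : DifferentiableAt ℂ (fun q : ℂ × (ι → ℂ) => F p.1 q.1 q.2) (p.2, X p.1 p.2) :=
    (hF.diff p.1 h1).differentiableAt
      ((Metric.isOpen_ball.prod Metric.isOpen_ball).mem_nhds ⟨h2, h3⟩)
  exact DifferentiableAt.comp (f := fun w => (w, X p.1 w)) p.2 h4
    (differentiableAt_id.prodMk (hX.diff p hp))

theorem norm_comp_le (hF : TameNonlinearity z₀ ρ T M F)
    (hX : IsAdmissible (cone z₀ ρ η μ) ρ X) {p : ℝ × ℂ} (hp : p ∈ cone z₀ ρ η μ) :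
    ‖F p.1 p.2 (X p.1 p.2)‖ ≤ M := by
  obtain ⟨h1, h2, h3⟩ := S.mem_prod hη hηT hX.bound hp
  exact hF.bound _ h1 _ h2 _ h3

theorem norm_comp_sub_le (hF : TameNonlinearity z₀ ρ T M F)
    (hX : IsAdmissible (cone z₀ ρ η μ) ρ X) (hY : IsAdmissible (cone z₀ ρ η μ) ρ Y)
    {p : ℝ × ℂ} (hp : p ∈ cone z₀ ρ η μ) :
    ‖F p.1 p.2 (X p.1 p.2) - F p.1 p.2 (Y p.1 p.2)‖ ≤ 2 * M / ρ * ‖X p.1 p.2 - Y p.1 p.2‖ := by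
  have := hF.lipschitz S.ρ_pos (cone_lt hη S.μ_pos S.T_pos hηT hp) (cone_mem_ball hη hp)
    (cone_mem_ball hη hp) (hY.bound p hp) (hX.bound p hp)
  simpa using this

theorem holFamily_comp (hF : TameNonlinearity z₀ ρ T M F)
    (hX : IsAdmissible (cone z₀ ρ η μ) ρ X)
    (hc : ContinuousOn (Function.uncurry X) (cone z₀ ρ η μ)) :
    HolFamily (cone z₀ ρ η μ) (fun t z => F t z (X t z)) := by
  refine ⟨?_, fun p hp => S.differentiableAt_comp hη hηT hF hX hp⟩
  refine hF.cont.comp (f := fun p : ℝ × ℂ => (p.1, p.2, X p.1 p.2)) ?_ fun p hp =>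
    S.mem_prod hη hηT hX.bound hp
  exact continuousOn_fst.prodMk (continuousOn_snd.prodMk hc)

theorem holFamily_rhs (hX : IsAdmissible (cone z₀ ρ η μ) ρ X)
    (hc : ContinuousOn (Function.uncurry X) (cone z₀ ρ η μ)) :
    HolFamily (cone z₀ ρ η μ) (fuchsRHS G H X) := by
  have h1 := (S.holFamily_comp hη hηT S.tameG hX hc).deriv_z (isOpen_cone S.μ_pos)
  have h2 := S.holFamily_comp hη hηT S.tameH hX hc
  exact ⟨h1.cont.add h2.cont, fun p hp => (h1.diff p hp).add (h2.diff p hp)⟩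

/-- Uses no more than ‖X‖ ≤ ρ: 6M comes from Nagumo's lemma for G and M from H. It bounds the
right-hand side down to t = 0, but it is too singular at the boundary of the cone to keep the image
in the ball of radius ρ. -/
theorem norm_rhs_le (hX : IsAdmissible (cone z₀ ρ η μ) ρ X) {p : ℝ × ℂ}
    (hp : p ∈ cone z₀ ρ η μ) :
    ‖fuchsRHS G H X p.1 p.2‖ ≤
      7 * M / (coneGap z₀ ρ η μ p.1 p.2 * √(coneGap z₀ ρ η μ p.1 p.2)) := by
  have h1 := nagumo (z₀ := z₀) (ρ := ρ) (η := η) (μ := μ) (t := p.1) S.M_nonneg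
    (f := fun w => G p.1 w (X p.1 w))
    (fun w hw => S.differentiableAt_comp hη hηT S.tameG hX hw)
    (fun w hw => (S.norm_comp_le hη hηT S.tameG hX hw).trans
      (S.le_div_sqrt hη S.M_nonneg hw)) (z := p.2) hp
  have h2 := (S.norm_comp_le hη hηT S.tameH hX hp).trans
    ((S.le_div_sqrt hη S.M_nonneg hp).trans (S.div_sqrt_le hη S.M_nonneg hp))
  refine (norm_add_le _ _).trans ((add_le_add h1 h2).trans (le_of_eq ?_))
  rw [← add_div]
  ring

/-- The Lipschitz constant 2M/ρ is multiplied by 6 for the differentiated term and by 1 for the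
other one. -/
theorem norm_rhs_sub_le (hX : IsAdmissible (cone z₀ ρ η μ) ρ X)
    (hY : IsAdmissible (cone z₀ ρ η μ) ρ Y) {K : ℝ} (hK : 0 ≤ K)
    (hXY : ∀ p ∈ cone z₀ ρ η μ, ‖X p.1 p.2 - Y p.1 p.2‖ ≤ K / √(coneGap z₀ ρ η μ p.1 p.2))
    {p : ℝ × ℂ} (hp : p ∈ cone z₀ ρ η μ) :
    ‖fuchsRHS G H X p.1 p.2 - fuchsRHS G H Y p.1 p.2‖ ≤
      14 * M / ρ * K / (coneGap z₀ ρ η μ p.1 p.2 * √(coneGap z₀ ρ η μ p.1 p.2)) := by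
  have hL : 0 ≤ 2 * M / ρ := div_nonneg (by linarith [S.M_nonneg]) S.ρ_pos.le
  have hb : ∀ {F}, TameNonlinearity z₀ ρ T M F → ∀ q ∈ cone z₀ ρ η μ,
      ‖F q.1 q.2 (X q.1 q.2) - F q.1 q.2 (Y q.1 q.2)‖ ≤
        2 * M / ρ * K / √(coneGap z₀ ρ η μ q.1 q.2) := fun hF q hq => by
    refine (S.norm_comp_sub_le hη hηT hF hX hY hq).trans ?_
    rw [mul_div_assoc (2 * M / ρ)]
    exact mul_le_mul_of_nonneg_left (hXY q hq) hL
  have hd := fun {Z : ℝ → ℂ → ι → ℂ} (hZ : IsAdmissible (cone z₀ ρ η μ) ρ Z) {w : ℂ}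
    (hw : (p.1, w) ∈ cone z₀ ρ η μ) => S.differentiableAt_comp hη hηT S.tameG hZ hw
  have h1 := nagumo (z₀ := z₀) (ρ := ρ) (η := η) (μ := μ) (t := p.1)
    (K := 2 * M / ρ * K) (mul_nonneg hL hK)
    (f := fun w => G p.1 w (X p.1 w) - G p.1 w (Y p.1 w))
    (fun w hw => (hd hX hw).sub (hd hY hw))
    (fun w hw => hb S.tameG (p.1, w) hw) (z := p.2) hp
  rw [deriv_fun_sub (hd hX hp) (hd hY hp)] at h1
  have h2 := (hb S.tameH p hp).trans (S.div_sqrt_le hη (mul_nonneg hL hK) hp)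
  have : fuchsRHS G H X p.1 p.2 - fuchsRHS G H Y p.1 p.2 =
      (deriv (fun w => G p.1 w (X p.1 w)) p.2 - deriv (fun w => G p.1 w (Y p.1 w)) p.2) +
      (H p.1 p.2 (X p.1 p.2) - H p.1 p.2 (Y p.1 p.2)) := by
    unfold fuchsRHS; abel
  rw [this]
  refine (norm_add_le _ _).trans ((add_le_add h1 h2).trans (le_of_eq ?_))
  rw [← add_div]
  ring

/-- Integration in time multiplies the bound 14MK/ρ for the difference of the right-hand sides by
2/(ημ). The condition on η says exactly that the result is at most K/2. -/
theorem contraction (hX : IsAdmissible (cone z₀ ρ η μ) ρ X)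
    (hY : IsAdmissible (cone z₀ ρ η μ) ρ Y)
    (hX' : IsFuchsImage μ γ G H (cone z₀ ρ η μ) X X')
    (hY' : IsFuchsImage μ γ G H (cone z₀ ρ η μ) Y Y')
    (hη1 : 56 * M / ρ ≤ η * μ) {K : ℝ} (hK : 0 ≤ K)
    (hXY : ∀ p ∈ cone z₀ ρ η μ, ‖X p.1 p.2 - Y p.1 p.2‖ ≤ K / √(coneGap z₀ ρ η μ p.1 p.2)) :
    ∀ p ∈ cone z₀ ρ η μ, ‖X' p.1 p.2 - Y' p.1 p.2‖ ≤ K / 2 / √(coneGap z₀ ρ η μ p.1 p.2) := by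
  rintro ⟨t, z⟩ hp
  have hημ : 0 < η * μ := mul_pos hη S.μ_pos
  have hL : 0 ≤ 14 * M / ρ * K :=
    mul_nonneg (div_nonneg (by linarith [S.M_nonneg]) S.ρ_pos.le) hK
  have hm := fun s (hs : s ∈ Ioc 0 t) => cone_mem_of_le hη S.μ_pos hp hs.1 hs.2
  refine (pi_norm_le_iff_of_nonneg (by positivity)).2 fun i => ?_
  have h1 : ∀ s ∈ Ioc 0 t, HasDerivAt (fun s => s ^ γ i • (X' s z i - Y' s z i))
      (s ^ (γ i + μ - 1) • (fuchsRHS G H X s z i - fuchsRHS G H Y s z i)) s := fun s hs => by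
    simp only [smul_sub]
    exact (hX'.deriv (s, z) (hm s hs) i).sub (hY'.deriv (s, z) (hm s hs) i)
  have h2 : Tendsto (fun s => s ^ γ i • (X' s z i - Y' s z i)) (𝓝[>] 0) (𝓝 0) := by
    simp only [smul_sub]
    simpa using (hX'.tendsto (t, z) hp i).sub (hY'.tendsto (t, z) hp i)
  have h3 : ∀ s ∈ Ioc 0 t, ‖fuchsRHS G H X s z i - fuchsRHS G H Y s z i‖ ≤
      14 * M / ρ * K / (coneGap z₀ ρ η μ s z * √(coneGap z₀ ρ η μ s z)) := fun s hs => by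
    have h5 := S.norm_rhs_sub_le hη hηT hX hY hK hXY (p := (s, z)) (hm s hs)
    have h6 := norm_le_pi_norm (fuchsRHS G H X s z - fuchsRHS G H Y s z) i
    rw [Pi.sub_apply] at h6
    exact h6.trans h5
  have h4 := norm_le_inv_sqrt (f := fun s => X' s z i - Y' s z i)
    (n := fun s => fuchsRHS G H X s z i - fuchsRHS G H Y s z i) hη S.μ_pos (S.γ_pos i).le hL hp
    h1 h2 h3
  refine h4.trans (div_le_div_of_nonneg_right ?_ (Real.sqrt_nonneg _))
  rw [div_le_iff₀ hημ]
  have h5 := mul_le_mul_of_nonneg_right hη1 hK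
  have h6 : 2 * (14 * M / ρ * K) = 56 * M / ρ * K / 2 := by ring
  rw [h6]
  linarith

/-- Two fixed points differ by at most 2ρ, and the contraction may be applied to them any number of
times. -/
theorem unique (hη1 : 56 * M / ρ ≤ η * μ) (hX : IsAdmissible (cone z₀ ρ η μ) ρ X)
    (hY : IsAdmissible (cone z₀ ρ η μ) ρ Y)
    (hX' : IsFuchsImage μ γ G H (cone z₀ ρ η μ) X X)
    (hY' : IsFuchsImage μ γ G H (cone z₀ ρ η μ) Y Y) :
    ∀ p ∈ cone z₀ ρ η μ, X p.1 p.2 = Y p.1 p.2 := by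
  have key : ∀ n : ℕ, ∀ p ∈ cone z₀ ρ η μ,
      ‖X p.1 p.2 - Y p.1 p.2‖ ≤ 2 * ρ / 2 ^ n / √(coneGap z₀ ρ η μ p.1 p.2) := by
    have hρ := S.ρ_pos
    intro n
    induction n with
    | zero =>
      intro p hp
      refine le_trans ?_ (S.le_div_sqrt hη (by positivity) hp)
      refine (norm_sub_le _ _).trans ?_
      have := hX.bound p hp
      have := hY.bound p hp
      simp only [pow_zero, div_one]
      linarith
    | succ n ih =>
      have := S.contraction hη hηT hX hY hX' hY' hη1 (by positivity) ih
      intro p hp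
      rw [pow_succ, ← div_div]
      exact this p hp
  intro p hp
  have h : Tendsto (fun n : ℕ => 2 * ρ / 2 ^ n / √(coneGap z₀ ρ η μ p.1 p.2)) atTop (𝓝 0) := by
    have h1 : Tendsto (fun n : ℕ => (1 / 2 : ℝ) ^ n) atTop (𝓝 0) :=
      tendsto_pow_atTop_nhds_zero_of_lt_one (by norm_num) (by norm_num)
    have h2 := h1.const_mul (2 * ρ / √(coneGap z₀ ρ η μ p.1 p.2))
    rw [mul_zero] at h2
    refine h2.congr fun n => ?_
    rw [div_pow, one_pow]
    ring
  exact sub_eq_zero.1 (norm_le_zero_iff.1 (ge_of_tendsto' h fun n => key n p hp))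

end

end FuchsianSystem

end Fuchsian

/-! ### The Fuchsian system: Picard iteration -/

section FuchsianExistence

variable {ι : Type*} [Fintype ι]

/-- The integral operator whose fixed points solve the Fuchsian system. -/
noncomputable def fuchsMap (μ : ℝ) (γ : ι → ℝ) (G H : ℝ → ℂ → (ι → ℂ) → (ι → ℂ))
    (X : ℝ → ℂ → ι → ℂ) (t : ℝ) (z : ℂ) (i : ι) : ℂ :=
  t ^ μ • eulerPrimitive (γ i + μ) (fun s w => fuchsRHS G H X s w i) t z

variable {z₀ : ℂ} {ρ T M μ η : ℝ} {γ : ι → ℝ} {F G H : ℝ → ℂ → (ι → ℂ) → (ι → ℂ)}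
  {X Y X' Y' : ℝ → ℂ → ι → ℂ}

theorem HolFamily.apply {Ω : Set (ℝ × ℂ)} (h : HolFamily Ω X) (i : ι) :
    HolFamily Ω (fun t z => X t z i) :=
  ⟨(continuous_apply i).comp_continuousOn h.cont, fun p hp => differentiableAt_pi.1 (h.diff p hp) i⟩

theorem holFamily_pi {Ω : Set (ℝ × ℂ)} (h : ∀ i, HolFamily Ω (fun t z => X t z i)) :
    HolFamily Ω X :=
  ⟨continuousOn_pi.2 fun i => (h i).cont,
    fun p hp => differentiableAt_pi.2 fun i => (h i).diff p hp⟩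

namespace FuchsianSystem

variable (S : FuchsianSystem z₀ ρ T M μ γ G H) (hη : 0 < η) (hηT : ρ ≤ η * T ^ μ)
  (hX : IsAdmissible (cone z₀ ρ η μ) ρ X)
  (hc : ContinuousOn (Function.uncurry X) (cone z₀ ρ η μ))

include S hη hηT hX

theorem norm_rhs_apply_le (i : ι) {t : ℝ} {z : ℂ} (hp : (t, z) ∈ cone z₀ ρ η μ) :
    ‖fuchsRHS G H X t z i‖ ≤ 7 * M / (coneGap z₀ ρ η μ t z * √(coneGap z₀ ρ η μ t z)) :=
  (norm_le_pi_norm _ i).trans (S.norm_rhs_le hη hηT hX (p := (t, z)) hp)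

theorem norm_rhs_apply_le_of_le (i : ι) {t δ : ℝ} {z : ℂ} (hδ : 0 < δ) (ht : 0 < t)
    (hp : δ ≤ coneGap z₀ ρ η μ t z) : ‖fuchsRHS G H X t z i‖ ≤ 7 * M / (δ * √δ) := by
  refine (S.norm_rhs_apply_le hη hηT hX i ⟨ht, hδ.trans_le hp⟩).trans ?_
  have := S.M_nonneg
  have := hδ.le.trans hp
  gcongr

/-- The gap grows as t decreases, so a lower bound for it near p serves on the whole segments down
to t = 0. -/
theorem boundedAtZero_rhs (i : ι) :
    BoundedAtZero (cone z₀ ρ η μ) (fun t z => fuchsRHS G H X t z i) := by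
  intro p hp
  have hδ : 0 < coneGap z₀ ρ η μ p.1 p.2 / 2 := half_pos hp.2
  refine ⟨{q | 0 < q.1 ∧ coneGap z₀ ρ η μ p.1 p.2 / 2 < coneGap z₀ ρ η μ q.1 q.2}, ?_,
    7 * M / (coneGap z₀ ρ η μ p.1 p.2 / 2 * √(coneGap z₀ ρ η μ p.1 p.2 / 2)), ?_⟩
  · refine IsOpen.mem_nhds ((isOpen_lt continuous_const continuous_fst).inter
      (isOpen_lt continuous_const (continuous_coneGap S.μ_pos))) ⟨hp.1, ?_⟩
    exact half_lt_self hp.2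
  · intro q hq σ hσ
    exact S.norm_rhs_apply_le_of_le hη hηT hX i hδ (mul_pos hσ.1 hq.1) (hq.2.le.trans
      (coneGap_anti hη S.μ_pos (mul_pos hσ.1 hq.1) (mul_le_of_le_one_left hq.1.le hσ.2) _))

theorem norm_fuchsMap_le (i : ι) {t δ : ℝ} {z : ℂ} (hδ : 0 < δ) (ht : 0 < t)
    (hp : δ ≤ coneGap z₀ ρ η μ t z) :
    ‖t ^ γ i • fuchsMap μ γ G H X t z i‖ ≤ 7 * M / (δ * √δ) / (γ i + μ) * t ^ (γ i + μ) := by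
  have h := norm_eulerPrimitive_le (b := γ i + μ) (by linarith [S.γ_pos i, S.μ_pos])
    (N := fun s w => fuchsRHS G H X s w i) (t := t) (z := z) fun σ hσ =>
      S.norm_rhs_apply_le_of_le hη hηT hX i hδ (mul_pos hσ.1 ht) (hp.trans
      (coneGap_anti hη S.μ_pos (mul_pos hσ.1 ht) (mul_le_of_le_one_left ht.le hσ.2) _))
  rw [fuchsMap, smul_smul, ← Real.rpow_add ht, norm_smul,
    Real.norm_of_nonneg (Real.rpow_nonneg ht.le _), mul_comm]
  exact mul_le_mul_of_nonneg_right h (Real.rpow_nonneg ht.le _)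

include hc

theorem holFamily_rhs_apply (i : ι) :
    HolFamily (cone z₀ ρ η μ) (fun t z => fuchsRHS G H X t z i) :=
  (S.holFamily_rhs hη hηT hX hc).apply i

theorem holFamily_fuchsMap : HolFamily (cone z₀ ρ η μ) (fuchsMap μ γ G H X) := by
  refine holFamily_pi fun i => ?_
  have h := holFamily_eulerPrimitive (isOpen_cone S.μ_pos) (cone_star hη S.μ_pos)
    (b := γ i + μ) (by linarith [S.γ_pos i, S.μ_pos]) (S.holFamily_rhs_apply hη hηT hX hc i)
    (S.boundedAtZero_rhs hη hηT hX i)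
  refine ⟨ContinuousOn.smul (f := fun p : ℝ × ℂ => p.1 ^ μ) ?_ h.cont,
    fun p hp => (h.diff p hp).const_smul (p.1 ^ μ)⟩
  exact ((Real.continuous_rpow_const S.μ_pos.le).comp continuous_fst).continuousOn

theorem isFuchsImage_fuchsMap :
    IsFuchsImage μ γ G H (cone z₀ ρ η μ) X (fuchsMap μ γ G H X) := by
  refine ⟨fun p hp i => ?_, fun p hp i => ?_⟩
  · have h := hasDerivAt_eulerPrimitive (isOpen_cone S.μ_pos) (fun p hp => hp.1)
      (cone_star hη S.μ_pos) (b := γ i + μ) (by linarith [S.γ_pos i, S.μ_pos])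
      (S.holFamily_rhs_apply hη hηT hX hc i) (S.boundedAtZero_rhs hη hηT hX i) hp
    refine h.congr_of_eventuallyEq ?_
    filter_upwards [lt_mem_nhds hp.1] with s hs
    rw [fuchsMap, smul_smul, ← Real.rpow_add hs]
  · have hb : 0 < γ i + μ := by linarith [S.γ_pos i, S.μ_pos]
    have h := (tendsto_rpow_zero hb).const_mul (7 * M /
      (coneGap z₀ ρ η μ p.1 p.2 * √(coneGap z₀ ρ η μ p.1 p.2)) / (γ i + μ))
    rw [mul_zero] at h
    refine squeeze_zero_norm' ?_ h
    filter_upwards [Ioo_mem_nhdsGT hp.1] with s hs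
    exact S.norm_fuchsMap_le hη hηT hX i hp.2 hs.1 (coneGap_anti hη S.μ_pos hs.1 hs.2.le _)

/-- The equation for the image may be differentiated in z because ∂ₜ and ∂_z commute. The initial
condition survives by Cauchy's estimate on a disc whose radius is half the gap. -/
theorem deriv_fuchsMap (i : ι) {p : ℝ × ℂ} (hp : p ∈ cone z₀ ρ η μ) :
    HasDerivAt (fun s => s ^ γ i • deriv (fuchsMap μ γ G H X s) p.2 i)
      (p.1 ^ (γ i + μ - 1) • deriv (fuchsRHS G H X p.1) p.2 i) p.1 ∧
    Tendsto (fun s => s ^ γ i • deriv (fuchsMap μ γ G H X s) p.2 i) (𝓝[>] 0) (𝓝 0) := by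
  have hΩ := isOpen_cone (z₀ := z₀) (ρ := ρ) (η := η) S.μ_pos
  have hΦ := S.holFamily_fuchsMap hη hηT hX hc
  have hN := S.holFamily_rhs hη hηT hX hc
  have hpi : ∀ {Z : ℝ → ℂ → ι → ℂ}, HolFamily (cone z₀ ρ η μ) Z → ∀ q ∈ cone z₀ ρ η μ, ∀ a : ℝ,
      deriv (fun w => a • Z q.1 w i) q.2 = a • deriv (Z q.1) q.2 i := fun hZ q hq a => by
    have h1 := (hasDerivAt_pi.1 (hZ.diff q hq).hasDerivAt i).const_smul a
    exact h1.deriv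
  have hcont : ContinuousOn (Function.uncurry fun t z => t ^ (γ i + μ - 1) • fuchsRHS G H X t z i)
      (cone z₀ ρ η μ) := by
    have h1 : ContinuousOn (fun p : ℝ × ℂ => p.1 ^ (γ i + μ - 1)) (cone z₀ ρ η μ) := fun q hq =>
      ((Real.continuousAt_rpow_const q.1 _ (Or.inl hq.1.ne')).comp
        continuousAt_fst).continuousWithinAt
    exact h1.smul (hN.apply i).cont
  have h := (HolFamily.deriv_t hΩ (f := fun t z => t ^ γ i • fuchsMap μ γ G H X t z i)
    (g := fun t z => t ^ (γ i + μ - 1) • fuchsRHS G H X t z i)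
    (fun q hq => ((hΦ.apply i).diff q hq).const_smul (q.1 ^ γ i)) hcont
    fun q hq => (S.isFuchsImage_fuchsMap hη hηT hX hc).deriv q hq i).2 p hp
  refine ⟨?_, ?_⟩
  · rw [hpi hN p hp] at h
    refine h.congr_of_eventuallyEq ?_
    filter_upwards [Ioo_mem_nhds hp.1 (lt_add_one p.1), (hΩ.preimage
      (Continuous.prodMk continuous_id continuous_const)).mem_nhds hp] with s hs hs'
    exact (hpi hΦ (s, p.2) hs' _).symm
  · set δ := coneGap z₀ ρ η μ p.1 p.2 / 2 with hδ
    have hδ0 : 0 < δ := half_pos hp.2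
    have hb : 0 < γ i + μ := by linarith [S.γ_pos i, S.μ_pos]
    have h2 := (tendsto_rpow_zero hb).const_mul (2 * (7 * M / (δ * √δ) / (γ i + μ)) / δ)
    rw [mul_zero] at h2
    refine squeeze_zero_norm' ?_ h2
    filter_upwards [Ioo_mem_nhdsGT hp.1] with s hs
    have hgap := coneGap_anti (z₀ := z₀) (ρ := ρ) hη S.μ_pos hs.1 hs.2.le p.2
    have hδs : δ ≤ coneGap z₀ ρ η μ s p.2 := by linarith
    rw [← hpi hΦ (s, p.2) (cone_mem_of_le hη S.μ_pos hp hs.1 hs.2.le)]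
    refine (norm_deriv_le_of_ball (C := 7 * M / (δ * √δ) / (γ i + μ) * s ^ (γ i + μ)) hδ0
      (fun w hw => ?_) fun w hw => ?_).trans (le_of_eq (by ring))
    · exact (((hΦ.apply i).diff (s, w) (ball_mem_cone hs.1 hδs hw).1).const_smul
        (s ^ γ i)).differentiableWithinAt
    · refine S.norm_fuchsMap_le hη hηT hX i hδ0 hs.1 ?_
      have := (ball_mem_cone hs.1 hδs hw).2
      linarith

omit hc in
-- Control of ∂_z X along with X is what makes the iteration stay in the ball. The right-hand side
-- is then O(d^{-1/2}), whose time integral is bounded, whereas the general bound O(d^{-3/2})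
-- integrates to d^{-1/2} only.
theorem norm_rhs_le_of_deriv
    (hd : ∀ p ∈ cone z₀ ρ η μ, ‖deriv (X p.1) p.2‖ ≤ 1 / √(coneGap z₀ ρ η μ p.1 p.2))
    {p : ℝ × ℂ} (hp : p ∈ cone z₀ ρ η μ) :
    ‖fuchsRHS G H X p.1 p.2‖ ≤ 3 * M / ρ / √(coneGap z₀ ρ η μ p.1 p.2) := by
  have hΩ := isOpen_cone (z₀ := z₀) (ρ := ρ) (η := η) S.μ_pos
  have hL : 0 ≤ 2 * M / ρ := div_nonneg (by linarith [S.M_nonneg]) S.ρ_pos.le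
  -- The joint Lipschitz bound of G is passed to the limit in difference quotients, in place of the
  -- chain rule.
  have h1 : ‖deriv (fun w => G p.1 w (X p.1 w)) p.2‖ ≤ 2 * M / ρ * max 1 ‖deriv (X p.1) p.2‖ := by
    have e1 := (S.differentiableAt_comp hη hηT S.tameG hX hp).hasDerivAt.tendsto_slope.norm
    have e2 := (hX.diff p hp).hasDerivAt.tendsto_slope.norm
    have e3 := (((tendsto_const_nhds (x := (1 : ℝ))).max e2).const_mul (2 * M / ρ))
    refine le_of_tendsto_of_tendsto e1 e3 ?_
    have h2 : ∀ᶠ w in 𝓝 p.2, (p.1, w) ∈ cone z₀ ρ η μ :=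
      (hΩ.preimage (Continuous.prodMk continuous_const continuous_id)).mem_nhds hp
    filter_upwards [nhdsWithin_le_nhds h2, self_mem_nhdsWithin] with w hw hne
    have hne' : 0 < ‖w - p.2‖ := norm_pos_iff.2 (sub_ne_zero.2 hne)
    have h3 := S.tameG.lipschitz S.ρ_pos (cone_lt hη S.μ_pos S.T_pos hηT hp) (cone_mem_ball hη hp)
      (cone_mem_ball hη hw) (hX.bound p hp) (hX.bound _ hw)
    simp only [slope, vsub_eq_sub, norm_smul, norm_inv]
    have h4 : max 1 (‖w - p.2‖⁻¹ * ‖X p.1 w - X p.1 p.2‖)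
        = ‖w - p.2‖⁻¹ * max ‖w - p.2‖ ‖X p.1 w - X p.1 p.2‖ := by
      rw [mul_max_of_nonneg _ _ (inv_nonneg.2 hne'.le), inv_mul_cancel₀ hne'.ne']
    rw [h4, mul_left_comm]
    exact mul_le_mul_of_nonneg_left h3 (inv_nonneg.2 hne'.le)
  have h2 : max 1 ‖deriv (X p.1) p.2‖ ≤ 1 / √(coneGap z₀ ρ η μ p.1 p.2) :=
    max_le (S.le_div_sqrt hη zero_le_one hp) (hd p hp)
  have h3 := (S.norm_comp_le hη hηT S.tameH hX hp).trans (S.le_div_sqrt hη S.M_nonneg hp)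
  have h4 : M ≤ M / ρ := le_div_self S.M_nonneg S.ρ_pos S.ρ_le
  have hs := (S.coneGap_bounds hη hp).2.2.1
  refine (norm_add_le _ _).trans ((add_le_add (h1.trans (mul_le_mul_of_nonneg_left h2 hL))
    h3).trans ?_)
  rw [mul_one_div, ← add_div]
  gcongr
  calc 2 * M / ρ + M ≤ 2 * M / ρ + M / ρ := by linarith
    _ = 3 * M / ρ := by ring

/-- The values require 2·3M/ρ ≤ ημρ. The derivatives require 2·6·3M/ρ ≤ ημ, after Nagumo's lemma for
the right-hand side. As ρ ≤ 1, the hypothesis with 56M/ρ² covers both, and the contraction as well.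
-/
theorem fuchsMap_invariant (hη1 : 56 * M / ρ ^ 2 ≤ η * μ)
    (hd : ∀ p ∈ cone z₀ ρ η μ, ‖deriv (X p.1) p.2‖ ≤ 1 / √(coneGap z₀ ρ η μ p.1 p.2)) :
    IsAdmissible (cone z₀ ρ η μ) ρ (fuchsMap μ γ G H X) ∧
      ∀ p ∈ cone z₀ ρ η μ,
        ‖deriv (fuchsMap μ γ G H X p.1) p.2‖ ≤ 1 / √(coneGap z₀ ρ η μ p.1 p.2) := by
  have hημ : 0 < η * μ := mul_pos hη S.μ_pos
  have hρ := S.ρ_pos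
  have hM := S.M_nonneg
  have hK : 0 ≤ 3 * M / ρ := by positivity
  have hb := fun {p : ℝ × ℂ} => S.norm_rhs_le_of_deriv hη hηT hX hd (p := p)
  have hΦ := S.holFamily_fuchsMap hη hηT hX hc
  have him := S.isFuchsImage_fuchsMap hη hηT hX hc
  have hN := S.holFamily_rhs hη hηT hX hc
  have hη2 : 56 * M ≤ η * μ * ρ ^ 2 := by rwa [div_le_iff₀ (by positivity)] at hη1
  have hρ2 : ρ ^ 2 ≤ ρ := by nlinarith [S.ρ_le]
  have hη3 : 56 * M ≤ η * μ * ρ := hη2.trans (mul_le_mul_of_nonneg_left hρ2 hημ.le)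
  refine ⟨⟨hΦ.diff, ?_⟩, ?_⟩
  · rintro ⟨t, z⟩ hp
    refine (pi_norm_le_iff_of_nonneg hρ.le).2 fun i => ?_
    have hm := fun s (hs : s ∈ Ioc 0 t) => cone_mem_of_le hη S.μ_pos hp hs.1 hs.2
    have h1 : ∀ s ∈ Ioc 0 t,
        ‖fuchsRHS G H X s z i‖ ≤ 3 * M / ρ / √(coneGap z₀ ρ η μ s z) := fun s hs =>
      (norm_le_pi_norm _ i).trans (hb (p := (s, z)) (hm s hs))
    have h2 := norm_le_const (f := fun s => fuchsMap μ γ G H X s z i)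
      (n := fun s => fuchsRHS G H X s z i) hη S.μ_pos (S.γ_pos i).le hK S.ρ_le hp
      (fun s hs => him.deriv (s, z) (hm s hs) i) (him.tendsto (t, z) hp i) h1
    refine h2.trans ?_
    rw [div_le_iff₀ hημ, mul_div_assoc', div_le_iff₀ hρ]
    nlinarith
  · rintro ⟨t, z⟩ hp
    have hs0 := (S.coneGap_bounds hη hp).2.2.1
    refine (pi_norm_le_iff_of_nonneg (by positivity)).2 fun i => ?_
    have hm := fun s (hs : s ∈ Ioc 0 t) => cone_mem_of_le hη S.μ_pos hp hs.1 hs.2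
    have h1 : ∀ s ∈ Ioc 0 t, ‖deriv (fuchsRHS G H X s) z i‖ ≤
        6 * (3 * M / ρ) / (coneGap z₀ ρ η μ s z * √(coneGap z₀ ρ η μ s z)) := fun s hs =>
      (norm_le_pi_norm _ i).trans (nagumo hK (fun w hw => hN.diff (s, w) hw)
        (fun w hw => hb (p := (s, w)) hw) (hm s hs))
    have h2 := norm_le_inv_sqrt (f := fun s => deriv (fuchsMap μ γ G H X s) z i)
      (n := fun s => deriv (fuchsRHS G H X s) z i) hη S.μ_pos (S.γ_pos i).le
      (by positivity) hp (fun s hs => (S.deriv_fuchsMap hη hηT hX hc i (hm s hs)).1)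
      (S.deriv_fuchsMap hη hηT hX hc i hp).2 h1
    refine h2.trans (div_le_div_of_nonneg_right ?_ hs0.le)
    rw [div_le_one hημ]
    have : 2 * (6 * (3 * M / ρ)) = 36 * M / ρ := by ring
    rw [this, div_le_iff₀ hρ]
    linarith

omit hc in
-- All iterates are real at real points, hence so is their limit; this produces real solutions of
-- the field equations.
theorem fuchsMap_real
    (hreal : ∀ F ∈ ({G, H} : Set (ℝ → ℂ → (ι → ℂ) → (ι → ℂ))), ∀ t x : ℝ, ∀ y : ι → ℂ,
      (∀ i, (y i).im = 0) → ∀ i, (F t x y i).im = 0)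
    (hXr : ∀ t x : ℝ, (t, (x : ℂ)) ∈ cone z₀ ρ η μ → ∀ i, (X t x i).im = 0) :
    ∀ t x : ℝ, (t, (x : ℂ)) ∈ cone z₀ ρ η μ → ∀ i, (fuchsMap μ γ G H X t x i).im = 0 := by
  have hΩ := isOpen_cone (z₀ := z₀) (ρ := ρ) (η := η) S.μ_pos
  have hN : ∀ t x : ℝ, (t, (x : ℂ)) ∈ cone z₀ ρ η μ → ∀ i, (fuchsRHS G H X t x i).im = 0 := by
    intro t x hp i
    have hd := S.differentiableAt_comp hη hηT S.tameG hX hp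
    have h1 : (deriv (fun w => G t w (X t w)) x i).im = 0 := by
      rw [deriv_pi (differentiableAt_pi.1 hd)]
      refine im_deriv_eq_zero (differentiableAt_pi.1 hd i) ?_
      have h2 : ∀ᶠ y : ℝ in 𝓝 x, (t, (y : ℂ)) ∈ cone z₀ ρ η μ :=
        (hΩ.preimage (Continuous.prodMk continuous_const Complex.continuous_ofReal)).mem_nhds hp
      filter_upwards [h2] with y hy
      exact hreal G (by simp) t y _ (hXr t y hy) i
    have h2 := hreal H (by simp) t x _ (hXr t x hp) i
    simp only [fuchsRHS, Pi.add_apply, Complex.add_im, h1, h2, add_zero]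
  intro t x hp i
  have h1 : eulerPrimitive (γ i + μ) (fun s w => fuchsRHS G H X s w i) t x =
      ((∫ σ in (0 : ℝ)..1, σ ^ (γ i + μ - 1) * (fuchsRHS G H X (σ * t) x i).re : ℝ) : ℂ) := by
    rw [eulerPrimitive, ← intervalIntegral.integral_ofReal]
    refine intervalIntegral.integral_congr_ae (MeasureTheory.ae_of_all _ fun σ hσ => ?_)
    rw [uIoc_of_le zero_le_one] at hσ
    have h2 := hN (σ * t) x (cone_star hη S.μ_pos _ hp σ hσ) i
    apply Complex.ext <;> simp [h2]
  rw [fuchsMap, h1]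
  simp

omit hc hX

/-- Picard iteration converges on the cone. -/
theorem exists_solution (hη1 : 56 * M / ρ ^ 2 ≤ η * μ)
    (hreal : ∀ F ∈ ({G, H} : Set (ℝ → ℂ → (ι → ℂ) → (ι → ℂ))), ∀ t x : ℝ, ∀ y : ι → ℂ,
      (∀ i, (y i).im = 0) → ∀ i, (F t x y i).im = 0) :
    ∃ X : ℝ → ℂ → ι → ℂ, HolFamily (cone z₀ ρ η μ) X ∧ IsAdmissible (cone z₀ ρ η μ) ρ X ∧
      IsFuchsImage μ γ G H (cone z₀ ρ η μ) X X ∧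
      ∀ t x : ℝ, (t, (x : ℂ)) ∈ cone z₀ ρ η μ → ∀ i, (X t x i).im = 0 := by
  have hΩ := isOpen_cone (z₀ := z₀) (ρ := ρ) (η := η) S.μ_pos
  have hρ := S.ρ_pos
  have hη2 : 56 * M / ρ ≤ η * μ := by
    refine le_trans ?_ hη1
    have : ρ ^ 2 ≤ ρ := by nlinarith [S.ρ_le]
    have := S.M_nonneg
    gcongr
  let x : ℕ → ℝ → ℂ → ι → ℂ := fun n => (fuchsMap μ γ G H)^[n] (fun _ _ => 0)
  have hx0 : x 0 = fun _ _ => 0 := rfl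
  have hxs : ∀ n, x (n + 1) = fuchsMap μ γ G H (x n) := fun n =>
    Function.iterate_succ_apply' _ _ _
  have hinv : ∀ n, HolFamily (cone z₀ ρ η μ) (x n) ∧ IsAdmissible (cone z₀ ρ η μ) ρ (x n) ∧
      (∀ p ∈ cone z₀ ρ η μ, ‖deriv (x n p.1) p.2‖ ≤ 1 / √(coneGap z₀ ρ η μ p.1 p.2)) ∧
      ∀ t y : ℝ, (t, (y : ℂ)) ∈ cone z₀ ρ η μ → ∀ i, (x n t y i).im = 0 := by
    intro n
    induction n with
    | zero =>
      rw [hx0]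
      refine ⟨⟨continuousOn_const, fun _ _ => differentiableAt_const _⟩,
        ⟨fun _ _ => differentiableAt_const _, fun _ _ => by simpa using hρ.le⟩, fun p hp => ?_,
        by simp⟩
      simp
    | succ n ih =>
      obtain ⟨h1, h2, h3, h4⟩ := ih
      rw [hxs]
      have h5 := S.fuchsMap_invariant hη hηT h2 h1.cont hη1 h3
      exact ⟨S.holFamily_fuchsMap hη hηT h2 h1.cont, h5.1, h5.2,
        S.fuchsMap_real hη hηT h2 hreal h4⟩
  have him : ∀ n, IsFuchsImage μ γ G H (cone z₀ ρ η μ) (x n) (x (n + 1)) := fun n => by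
    rw [hxs]; exact S.isFuchsImage_fuchsMap hη hηT (hinv n).2.1 (hinv n).1.cont
  have hstep : ∀ n, ∀ p ∈ cone z₀ ρ η μ,
      ‖x n p.1 p.2 - x (n + 1) p.1 p.2‖ ≤ 1 / 2 ^ n / √(coneGap z₀ ρ η μ p.1 p.2) := by
    intro n
    induction n with
    | zero =>
      intro p hp
      have h1 := (hinv 1).2.1.bound p hp
      have h2 := S.le_div_sqrt hη zero_le_one hp
      rw [hx0, zero_sub, norm_neg, pow_zero, div_one]
      linarith [S.ρ_le]
    | succ n ih =>
      have := S.contraction hη hηT (hinv n).2.1 (hinv (n + 1)).2.1 (him n) (him (n + 1)) hη2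
        (by positivity) ih
      intro p hp
      rw [pow_succ, ← div_div]
      exact this p hp
  have hstep' : ∀ p ∈ cone z₀ ρ η μ, ∀ n, dist (x n p.1 p.2) (x (n + 1) p.1 p.2) ≤
      2 / √(coneGap z₀ ρ η μ p.1 p.2) / 2 / 2 ^ n := fun p hp n => by
    rw [dist_eq_norm]
    exact (hstep n p hp).trans (le_of_eq (by ring))
  -- Off the cone the limit is given the value 0, to have a function defined everywhere.
  have hlim : ∀ p : ℝ × ℂ, ∃ l, p ∈ cone z₀ ρ η μ → Tendsto (fun n => x n p.1 p.2) atTop (𝓝 l) := by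
    intro p
    by_cases hp : p ∈ cone z₀ ρ η μ
    · obtain ⟨l, hl⟩ := cauchySeq_tendsto_of_complete (cauchySeq_of_le_geometric_two (hstep' p hp))
      exact ⟨l, fun _ => hl⟩
    · exact ⟨0, fun h => absurd h hp⟩
  choose X₀ hX₀ using hlim
  let X : ℝ → ℂ → ι → ℂ := fun t z => X₀ (t, z)
  have hXlim : ∀ p ∈ cone z₀ ρ η μ, Tendsto (fun n => x n p.1 p.2) atTop (𝓝 (X p.1 p.2)) :=
    fun p hp => hX₀ p hp
  have hrate : ∀ n, ∀ p ∈ cone z₀ ρ η μ,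
      ‖x n p.1 p.2 - X p.1 p.2‖ ≤ 2 / 2 ^ n / √(coneGap z₀ ρ η μ p.1 p.2) := fun n p hp => by
    have := dist_le_of_le_geometric_two_of_tendsto (hstep' p hp) (hXlim p hp) n
    rw [dist_eq_norm] at this
    exact this.trans (le_of_eq (by ring))
  -- Near each point of the cone the gap is at least δ > 0, so geometric convergence in the weighted
  -- norm is locally uniform there. This carries continuity and holomorphy over to the limit.
  have hunif : TendstoLocallyUniformlyOn (fun n => Function.uncurry (x n)) (Function.uncurry X)
      atTop (cone z₀ ρ η μ) := by
    rw [Metric.tendstoLocallyUniformlyOn_iff]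
    intro ε hε p hp
    set δ := coneGap z₀ ρ η μ p.1 p.2 / 2 with hδ
    have hδ0 : 0 < δ := half_pos hp.2
    refine ⟨cone z₀ ρ η μ ∩ {q | δ < coneGap z₀ ρ η μ q.1 q.2}, ?_, ?_⟩
    · refine inter_mem_nhdsWithin _ ((isOpen_lt continuous_const
        (continuous_coneGap S.μ_pos)).mem_nhds ?_)
      exact half_lt_self hp.2
    · have h1 : Tendsto (fun n : ℕ => 2 / √δ * (1 / 2 : ℝ) ^ n) atTop (𝓝 (2 / √δ * 0)) :=
        (tendsto_pow_atTop_nhds_zero_of_lt_one (by norm_num) (by norm_num)).const_mul _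
      rw [mul_zero] at h1
      filter_upwards [h1.eventually (gt_mem_nhds hε)] with n hn q hq
      rw [dist_comm, dist_eq_norm]
      refine ((hrate n q hq.1).trans ?_).trans_lt hn
      have h2 : √δ ≤ √(coneGap z₀ ρ η μ q.1 q.2) := Real.sqrt_le_sqrt hq.2.le
      have h3 : 0 < √δ := Real.sqrt_pos.2 hδ0
      calc 2 / 2 ^ n / √(coneGap z₀ ρ η μ q.1 q.2) ≤ 2 / 2 ^ n / √δ := by gcongr
        _ = 2 / √δ * (1 / 2) ^ n := by rw [one_div, inv_pow]; ring
  have hXc : ContinuousOn (Function.uncurry X) (cone z₀ ρ η μ) :=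
    hunif.continuousOn (Frequently.of_forall fun n => (hinv n).1.cont)
  have hXd : ∀ p ∈ cone z₀ ρ η μ, DifferentiableAt ℂ (X p.1) p.2 := by
    rintro ⟨t, z⟩ hp
    have hU : IsOpen {w : ℂ | (t, w) ∈ cone z₀ ρ η μ} :=
      hΩ.preimage (Continuous.prodMk continuous_const continuous_id)
    have h1 : TendstoLocallyUniformlyOn (fun n => x n t) (X t) atTop
        {w : ℂ | (t, w) ∈ cone z₀ ρ η μ} :=
      hunif.comp (fun w : ℂ => (t, w)) (fun w hw => hw) (by fun_prop)
    exact (h1.differentiableOn (Eventually.of_forall fun n => (hinv n).1.slice fun w hw => hw)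
      hU).differentiableAt (hU.mem_nhds hp)
  have hXb : ∀ p ∈ cone z₀ ρ η μ, ‖X p.1 p.2‖ ≤ ρ := fun p hp =>
    le_of_tendsto' (hXlim p hp).norm fun n => (hinv n).2.1.bound p hp
  have hXr : ∀ t y : ℝ, (t, (y : ℂ)) ∈ cone z₀ ρ η μ → ∀ i, (X t y i).im = 0 := by
    intro t y hp i
    have h1 : Tendsto (fun n => (x n t y i).im) atTop (𝓝 (X t y i).im) :=
      (Complex.continuous_im.tendsto _).comp ((tendsto_pi_nhds.1 (hXlim _ hp)) i)
    simp only [fun n => (hinv n).2.2.2 t y hp i] at h1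
    exact (tendsto_nhds_unique h1 tendsto_const_nhds)
  have hXa : IsAdmissible (cone z₀ ρ η μ) ρ X := ⟨hXd, hXb⟩
  refine ⟨X, ⟨hXc, hXd⟩, hXa, ?_, hXr⟩
  have himX := S.isFuchsImage_fuchsMap hη hηT hXa hXc
  -- The contraction applies to x n and X at weighted distance 2/2ⁿ. Thus x (n + 1), the image of x
  -- n, tends to the image of X as well as to X.
  have hfix : ∀ p ∈ cone z₀ ρ η μ, fuchsMap μ γ G H X p.1 p.2 = X p.1 p.2 := by
    intro p hp
    have h1 : Tendsto (fun n => x (n + 1) p.1 p.2) atTop (𝓝 (fuchsMap μ γ G H X p.1 p.2)) := by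
      rw [tendsto_iff_norm_sub_tendsto_zero]
      have h2 : Tendsto (fun n : ℕ => 1 / √(coneGap z₀ ρ η μ p.1 p.2) * (1 / 2 : ℝ) ^ n) atTop
          (𝓝 (1 / √(coneGap z₀ ρ η μ p.1 p.2) * 0)) :=
        (tendsto_pow_atTop_nhds_zero_of_lt_one (by norm_num) (by norm_num)).const_mul _
      rw [mul_zero] at h2
      refine squeeze_zero (fun n => norm_nonneg _) (fun n => ?_) h2
      refine (S.contraction hη hηT (hinv n).2.1 hXa (him n) himX hη2 (by positivity) (hrate n)
        p hp).trans (le_of_eq ?_)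
      rw [one_div (2 : ℝ), inv_pow]
      ring
    exact tendsto_nhds_unique h1 ((tendsto_add_atTop_iff_nat 1).2 (hXlim p hp))
  refine ⟨fun p hp i => ?_, fun p hp i => ?_⟩
  · refine (himX.deriv p hp i).congr_of_eventuallyEq ?_
    have h2 : ∀ᶠ s in 𝓝 p.1, (s, p.2) ∈ cone z₀ ρ η μ :=
      (hΩ.preimage (Continuous.prodMk continuous_id continuous_const)).mem_nhds hp
    filter_upwards [h2] with s hs
    rw [hfix (s, p.2) hs]
  · refine (himX.tendsto p hp i).congr' ?_
    filter_upwards [Ioo_mem_nhdsGT hp.1] with s hs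
    rw [hfix (s, p.2) (cone_mem_of_le hη S.μ_pos hp hs.1 hs.2.le)]

end FuchsianSystem

end FuchsianExistence

/-! ### Nonlinearities holomorphic in (z, X): closure properties -/

section Regular

variable {ι : Type*} [Fintype ι] {T : ℝ} {B : Set ℂ} {B' : Set (ι → ℂ)}

/-- Continuous in `(t, z, X)` and holomorphic in `(z, X)`. -/
def IsHolRegular (T : ℝ) (B : Set ℂ) (B' : Set (ι → ℂ)) (f : ℝ → ℂ → (ι → ℂ) → ℂ) : Prop :=
  ContinuousOn (fun p : ℝ × ℂ × (ι → ℂ) => f p.1 p.2.1 p.2.2) (Ioo 0 T ×ˢ B ×ˢ B') ∧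
    ∀ t ∈ Ioo 0 T, DifferentiableOn ℂ (fun p : ℂ × (ι → ℂ) => f t p.1 p.2) (B ×ˢ B')

namespace IsHolRegular

variable {f g : ℝ → ℂ → (ι → ℂ) → ℂ}

theorem add (hf : IsHolRegular T B B' f) (hg : IsHolRegular T B B' g) :
    IsHolRegular T B B' (fun t z X => f t z X + g t z X) :=
  ⟨hf.1.add hg.1, fun t ht => (hf.2 t ht).add (hg.2 t ht)⟩

theorem mul (hf : IsHolRegular T B B' f) (hg : IsHolRegular T B B' g) :
    IsHolRegular T B B' (fun t z X => f t z X * g t z X) :=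
  ⟨hf.1.mul hg.1, fun t ht => (hf.2 t ht).mul (hg.2 t ht)⟩

theorem pow (hf : IsHolRegular T B B' f) (m : ℕ) :
    IsHolRegular T B B' (fun t z X => f t z X ^ m) :=
  ⟨hf.1.pow m, fun t ht => (hf.2 t ht).pow m⟩

theorem cexp (hf : IsHolRegular T B B' f) :
    IsHolRegular T B B' (fun t z X => Complex.exp (f t z X)) :=
  ⟨hf.1.cexp, fun t ht => (hf.2 t ht).cexp⟩

theorem sum {κ : Type*} (s : Finset κ) {f : κ → ℝ → ℂ → (ι → ℂ) → ℂ}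
    (hf : ∀ j, IsHolRegular T B B' (f j)) : IsHolRegular T B B' (fun t z X => ∑ j ∈ s, f j t z X) :=
  ⟨continuousOn_finsetSum _ fun j _ => (hf j).1,
    fun t ht => DifferentiableOn.fun_sum fun j _ => (hf j).2 t ht⟩

omit [Fintype ι] in
theorem const (c : ℂ) : IsHolRegular T B B' (fun _ _ _ => c) :=
  ⟨continuousOn_const, fun _ _ => differentiableOn_const _⟩

omit [Fintype ι] in
theorem time {a : ℝ → ℝ} (ha : ∀ t, 0 < t → ContinuousAt a t) :
    IsHolRegular T B B' (fun t _ _ => (a t : ℂ)) := by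
  refine ⟨fun p hp => ?_, fun t ht => differentiableOn_const _⟩
  exact (Complex.continuous_ofReal.continuousAt.comp
    ((ha p.1 hp.1.1).comp continuousAt_fst)).continuousWithinAt

omit [Fintype ι] in
theorem rpow (α : ℝ) : IsHolRegular T B B' (fun t _ _ => ((t ^ α : ℝ) : ℂ)) :=
  time fun t ht => Real.continuousAt_rpow_const t α (Or.inl ht.ne')

omit [Fintype ι] in
theorem log : IsHolRegular T B B' (fun t _ _ => (Real.log t : ℂ)) :=
  time fun _ ht => Real.continuousAt_log ht.ne'

theorem space {h : ℂ → ℂ} (hh : DifferentiableOn ℂ h B) : IsHolRegular T B B' (fun _ z _ => h z) :=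
  ⟨hh.continuousOn.comp (f := fun p : ℝ × ℂ × (ι → ℂ) => p.2.1) (by fun_prop) fun _ hp => hp.2.1,
    fun _ _ => hh.comp (f := fun p : ℂ × (ι → ℂ) => p.1) (by fun_prop) fun _ hp => hp.1⟩

theorem coord (i : ι) : IsHolRegular T B B' (fun _ _ X => X i) :=
  ⟨by fun_prop, fun _ _ => by fun_prop⟩

end IsHolRegular

end Regular

/-! ### The first order system and its rescaling -/

section System

/-- The components of the first order reduction: the remainder `u` of `P`, `a = 𝒟 u`, `c = ∂ u`,
the remainder `w` of `e ^ (-2 (P + P_I)) 𝒟 Q`, `y = Q - q₀` and `d = ∂ y`. -/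
inductive Slot
  | u | a | c | w | y | d

instance : Fintype Slot where
  elems := ⟨↑[Slot.u, .a, .c, .w, .y, .d], by simp⟩
  complete x := by cases x <;> simp

/-- The functions of the space variable that enter the first order system. -/
structure VTDData (n : ℕ) where
  /-- the exponents `k` -/
  k : Fin n → ℂ → ℂ
  /-- the order zero part of `P + P_I` -/
  s : Fin n → ℂ → ℂ
  /-- the second derivative of `p_{I0}` -/
  b₀ : Fin n → ℂ → ℂ
  /-- the second derivative of `p_{I1}` -/
  b₁ : Fin n → ℂ → ℂ
  /-- the derivative of `q_{I0}` -/
  ξ : Fin n → ℂ → ℂ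
  /-- the limit of `e ^ (-2 (P + P_I)) 𝒟 Q` -/
  W : Fin n → ℂ → ℂ

variable {n : ℕ}

/-- The full exponent `P + P_I`, given the remainders `u`. -/
noncomputable def VTDData.S (𝔡 : VTDData n) (I : Fin n) (t : ℝ) (z : ℂ) (u : Fin n → ℂ) : ℂ :=
  𝔡.k I z * Real.log t + 𝔡.s I z + ((∑ J, u J) + u I)

/-- The right-hand side of the first order system `t ∂ₜ x = vtdRHS x`. -/
noncomputable def vtdRHS (𝔡 : VTDData n) (x : ℝ → ℂ → Slot × Fin n → ℂ) (t : ℝ) (z : ℂ) :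
    Slot × Fin n → ℂ
  | (.u, I) => x t z (.a, I)
  | (.c, I) => deriv (fun v => x t v (.a, I)) z
  | (.a, I) => t ^ 2 * deriv (fun v => x t v (.c, I)) z
      + (t ^ 2 * (𝔡.b₀ I z * Real.log t + 𝔡.b₁ I z)
      + (-1 / 2 * (Complex.exp (2 * 𝔡.S I t z fun J => x t z (.u, J))
          * (𝔡.W I z + x t z (.w, I)) ^ 2)
      + 1 / 2 * (t ^ 2 * Complex.exp (-2 * 𝔡.S I t z fun J => x t z (.u, J))
          * (𝔡.ξ I z + x t z (.d, I)) ^ 2)))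
  | (.w, I) => deriv (fun v => t ^ 2 * Complex.exp (-2 * 𝔡.S I t v fun J => x t v (.u, J))
      * (𝔡.ξ I v + x t v (.d, I))) z
  | (.y, I) => Complex.exp (2 * 𝔡.S I t z fun J => x t z (.u, J)) * (𝔡.W I z + x t z (.w, I))
  | (.d, I) => deriv (fun v => Complex.exp (2 * 𝔡.S I t v fun J => x t v (.u, J))
      * (𝔡.W I v + x t v (.w, I))) z

/-- The powers of `t` by which the components are rescaled. -/
def slotWeight (e : Fin n → ℝ) (μ : ℝ) : Slot × Fin n → ℝ
  | (.u, I) => e I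
  | (.c, I) => e I
  | (.a, I) => e I + μ
  | (.w, _) => μ
  | (.y, _) => μ
  | (.d, _) => μ

/-- The components before rescaling. -/
noncomputable def unscale (e : Fin n → ℝ) (μ : ℝ) (X : ℝ → ℂ → Slot × Fin n → ℂ) (t : ℝ) (z : ℂ)
    (i : Slot × Fin n) : ℂ :=
  t ^ slotWeight e μ i • X t z i

/-- `P + P_I` in terms of the rescaled components. -/
noncomputable def scaledS (𝔡 : VTDData n) (e : Fin n → ℝ) (I : Fin n) (t : ℝ) (z : ℂ)
    (X : Slot × Fin n → ℂ) : ℂ :=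
  𝔡.S I t z fun J => ((t ^ e J : ℝ) : ℂ) * X (.u, J)

/-- The part of the rescaled right-hand side under the spatial derivative. -/
noncomputable def fluxPart (𝔡 : VTDData n) (e : Fin n → ℝ) (μ : ℝ) (t : ℝ) (z : ℂ)
    (X : Slot × Fin n → ℂ) : Slot × Fin n → ℂ
  | (.u, _) => 0
  | (.c, I) => X (.a, I)
  | (.a, I) => ((t ^ (2 - 2 * μ) : ℝ) : ℂ) * X (.c, I)
  | (.w, I) => ((t ^ (-(2 * μ)) : ℝ) : ℂ) * (((t ^ 2 : ℝ) : ℂ)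
      * Complex.exp (-2 * scaledS 𝔡 e I t z X) * (𝔡.ξ I z + ((t ^ μ : ℝ) : ℂ) * X (.d, I)))
  | (.y, _) => 0
  | (.d, I) => ((t ^ (-(2 * μ)) : ℝ) : ℂ) * (Complex.exp (2 * scaledS 𝔡 e I t z X)
      * (𝔡.W I z + ((t ^ μ : ℝ) : ℂ) * X (.w, I)))

/-- The part of the rescaled right-hand side without spatial derivatives. -/
noncomputable def sourcePart (𝔡 : VTDData n) (e : Fin n → ℝ) (μ : ℝ) (t : ℝ) (z : ℂ)
    (X : Slot × Fin n → ℂ) : Slot × Fin n → ℂ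
  | (.u, I) => X (.a, I)
  | (.c, _) => 0
  | (.a, I) => ((t ^ (-(e I + 2 * μ)) : ℝ) : ℂ) * (((t ^ 2 : ℝ) : ℂ)
        * (𝔡.b₀ I z * Real.log t + 𝔡.b₁ I z)
      + (-1 / 2 * (Complex.exp (2 * scaledS 𝔡 e I t z X)
          * (𝔡.W I z + ((t ^ μ : ℝ) : ℂ) * X (.w, I)) ^ 2)
      + 1 / 2 * (((t ^ 2 : ℝ) : ℂ) * Complex.exp (-2 * scaledS 𝔡 e I t z X)
          * (𝔡.ξ I z + ((t ^ μ : ℝ) : ℂ) * X (.d, I)) ^ 2)))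
  | (.w, _) => 0
  | (.y, I) => ((t ^ (-(2 * μ)) : ℝ) : ℂ) * (Complex.exp (2 * scaledS 𝔡 e I t z X)
      * (𝔡.W I z + ((t ^ μ : ℝ) : ℂ) * X (.w, I)))
  | (.d, _) => 0

/-- Holomorphy of the data on the disc, and the bounds that make the rescaled system Fuchsian. -/
structure VTDData.Bounded (𝔡 : VTDData n) (z₀ : ℂ) (ρ B : ℝ) (e : Fin n → ℝ) (μ : ℝ) : Prop where
  ρ_pos : 0 < ρ
  ρ_le : ρ ≤ 1
  μ_pos : 0 < μ
  μ_le_e : ∀ I, μ ≤ e I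
  e_le : ∀ I, e I + 2 * μ ≤ 1
  B_nonneg : 0 ≤ B
  hk : ∀ I, DifferentiableOn ℂ (𝔡.k I) (Metric.ball z₀ (2 * ρ))
  hs : ∀ I, DifferentiableOn ℂ (𝔡.s I) (Metric.ball z₀ (2 * ρ))
  hb₀ : ∀ I, DifferentiableOn ℂ (𝔡.b₀ I) (Metric.ball z₀ (2 * ρ))
  hb₁ : ∀ I, DifferentiableOn ℂ (𝔡.b₁ I) (Metric.ball z₀ (2 * ρ))
  hξ : ∀ I, DifferentiableOn ℂ (𝔡.ξ I) (Metric.ball z₀ (2 * ρ))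
  hW : ∀ I, DifferentiableOn ℂ (𝔡.W I) (Metric.ball z₀ (2 * ρ))
  s_le : ∀ I, ∀ z ∈ Metric.ball z₀ (2 * ρ), ‖𝔡.s I z‖ ≤ B
  b₀_le : ∀ I, ∀ z ∈ Metric.ball z₀ (2 * ρ), ‖𝔡.b₀ I z‖ ≤ B
  b₁_le : ∀ I, ∀ z ∈ Metric.ball z₀ (2 * ρ), ‖𝔡.b₁ I z‖ ≤ B
  ξ_le : ∀ I, ∀ z ∈ Metric.ball z₀ (2 * ρ), ‖𝔡.ξ I z‖ ≤ B
  W_le : ∀ I, ∀ z ∈ Metric.ball z₀ (2 * ρ), ‖𝔡.W I z‖ ≤ B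
  le_k : ∀ I, ∀ z ∈ Metric.ball z₀ (2 * ρ), e I + 2 * μ ≤ 2 * (𝔡.k I z).re
  k_le : ∀ I, ∀ z ∈ Metric.ball z₀ (2 * ρ), e I + 2 * μ ≤ 2 - 2 * (𝔡.k I z).re

variable {𝔡 : VTDData n} {z₀ : ℂ} {ρ B μ : ℝ} {e : Fin n → ℝ}

theorem rpow_mul_rpow_neg_le {t α β C : ℝ} (ht : 0 < t) (ht1 : t ≤ 1) (hC : 0 ≤ C) (h : α ≤ β) :
    t ^ (-α) * (t ^ β * C) ≤ C := by
  rw [← mul_assoc, ← Real.rpow_add ht]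
  exact mul_le_of_le_one_left hC (Real.rpow_le_one ht.le ht1 (by linarith))

/-- The modulus of t^{2k} is t^{2 Re k}, and since ln t ≤ 0 a lower bound for Re k is an upper bound
for it. The rest of the exponent is s and n + 1 of the remainders u. -/
theorem VTDData.norm_exp_S_le {I : Fin n} {t α C : ℝ} {z : ℂ} {u : Fin n → ℂ} (ht : 0 < t)
    (ht1 : t ≤ 1) (hα : α ≤ 2 * (𝔡.k I z).re) (hs : ‖𝔡.s I z‖ ≤ B) (hu : ∀ J, ‖u J‖ ≤ C) :
    ‖Complex.exp (2 * 𝔡.S I t z u)‖ ≤ t ^ α * Real.exp (2 * (B + (n + 1) * C)) := by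
  have h1 : ‖(∑ J, u J) + u I‖ ≤ (n + 1) * C := by
    refine (norm_add_le _ _).trans ?_
    have := norm_sum_le_of_le Finset.univ fun J _ => hu J
    simp only [Finset.sum_const, Finset.card_univ, Fintype.card_fin, nsmul_eq_mul] at this
    linarith [hu I]
  have h2 := (Complex.re_le_norm _).trans h1
  have h3 := (Complex.re_le_norm _).trans hs
  have h4 : Real.log t ≤ 0 := Real.log_nonpos ht.le ht1
  rw [Complex.norm_exp, Real.rpow_def_of_pos ht, ← Real.exp_add]
  refine Real.exp_le_exp.2 ?_
  have h5 : (2 * 𝔡.S I t z u).re = 2 * (𝔡.k I z).re * Real.log t + 2 * (𝔡.s I z).re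
      + 2 * ((∑ J, u J) + u I).re := by
    simp only [VTDData.S, Complex.mul_re, Complex.add_re, Complex.re_ofNat, Complex.im_ofNat,
      Complex.ofReal_re, Complex.ofReal_im]
    ring
  rw [h5]
  nlinarith

theorem VTDData.norm_exp_neg_S_le {I : Fin n} {t α C : ℝ} {z : ℂ} {u : Fin n → ℂ} (ht : 0 < t)
    (ht1 : t ≤ 1) (hα : α ≤ 2 - 2 * (𝔡.k I z).re) (hs : ‖𝔡.s I z‖ ≤ B) (hu : ∀ J, ‖u J‖ ≤ C) :
    ‖((t ^ 2 : ℝ) : ℂ) * Complex.exp (-2 * 𝔡.S I t z u)‖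
      ≤ t ^ α * Real.exp (2 * (B + (n + 1) * C)) := by
  have h1 : ‖(∑ J, u J) + u I‖ ≤ (n + 1) * C := by
    refine (norm_add_le _ _).trans ?_
    have := norm_sum_le_of_le Finset.univ fun J _ => hu J
    simp only [Finset.sum_const, Finset.card_univ, Fintype.card_fin, nsmul_eq_mul] at this
    linarith [hu I]
  have h2 := (neg_le_abs _).trans ((Complex.abs_re_le_norm _).trans h1)
  have h3 := (neg_le_abs _).trans ((Complex.abs_re_le_norm _).trans hs)
  have h4 : Real.log t ≤ 0 := Real.log_nonpos ht.le ht1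
  have h6 : t ^ 2 = Real.exp (Real.log t * 2) := by
    rw [← Real.rpow_def_of_pos ht]; exact (Real.rpow_two t).symm
  rw [norm_mul, Complex.norm_exp, Real.rpow_def_of_pos ht, ← Real.exp_add, Complex.norm_real,
    Real.norm_of_nonneg (sq_nonneg t), h6, ← Real.exp_add]
  refine Real.exp_le_exp.2 ?_
  have h5 : (-2 * 𝔡.S I t z u).re = -2 * (𝔡.k I z).re * Real.log t - 2 * (𝔡.s I z).re
      - 2 * ((∑ J, u J) + u I).re := by
    simp only [VTDData.S, Complex.mul_re, Complex.add_re, Complex.re_ofNat, Complex.im_ofNat,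
      Complex.ofReal_re, Complex.ofReal_im, Complex.neg_re, Complex.neg_im]
    ring
  rw [h5]
  nlinarith

namespace VTDData.Bounded

variable (h : 𝔡.Bounded z₀ ρ B e μ)
include h

theorem e_pos (I : Fin n) : 0 < e I :=
  h.μ_pos.trans_le (h.μ_le_e I)

theorem slotWeight_pos (i : Slot × Fin n) : 0 < slotWeight e μ i := by
  have := h.μ_pos
  obtain ⟨j, I⟩ := i
  have := h.e_pos I
  cases j <;> simp only [slotWeight] <;> linarith

theorem isHolRegular_scaledS (I : Fin n) :
    IsHolRegular 1 (Metric.ball z₀ (2 * ρ)) (Metric.ball 0 (2 * ρ)) (scaledS 𝔡 e I) := by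
  have h1 := fun J => (IsHolRegular.rpow (T := 1) (B := Metric.ball z₀ (2 * ρ))
    (B' := Metric.ball (0 : Slot × Fin n → ℂ) (2 * ρ)) (e J)).mul (.coord (Slot.u, J))
  have h2 := (IsHolRegular.space (ι := Slot × Fin n) (T := 1) (B' := Metric.ball 0 (2 * ρ))
    (h.hk I)).mul .log
  have h3 := (h2.add (.space (h.hs I))).add ((IsHolRegular.sum Finset.univ h1).add (h1 I))
  exact h3

theorem isHolRegular_exp_W (I : Fin n) :
    IsHolRegular 1 (Metric.ball z₀ (2 * ρ)) (Metric.ball 0 (2 * ρ)) fun t z X =>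
      Complex.exp (2 * scaledS 𝔡 e I t z X) := by
  have h1 := (IsHolRegular.const 2).mul (h.isHolRegular_scaledS I)
  exact h1.cexp

theorem isHolRegular_exp_ξ (I : Fin n) :
    IsHolRegular 1 (Metric.ball z₀ (2 * ρ)) (Metric.ball 0 (2 * ρ)) fun t z X =>
      ((t ^ 2 : ℝ) : ℂ) * Complex.exp (-2 * scaledS 𝔡 e I t z X) := by
  have h1 := (IsHolRegular.const (-2)).mul (h.isHolRegular_scaledS I)
  have h2 : IsHolRegular (ι := Slot × Fin n) 1 (Metric.ball z₀ (2 * ρ)) (Metric.ball 0 (2 * ρ))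
    (fun t _ _ => ((t ^ 2 : ℝ) : ℂ)) := .time fun t _ => by fun_prop
  exact h2.mul h1.cexp

theorem isHolRegular_W_add (I : Fin n) :
    IsHolRegular 1 (Metric.ball z₀ (2 * ρ)) (Metric.ball 0 (2 * ρ)) fun t z X =>
      𝔡.W I z + ((t ^ μ : ℝ) : ℂ) * X (Slot.w, I) := by
  have h1 := (IsHolRegular.rpow (T := 1) (B := Metric.ball z₀ (2 * ρ))
    (B' := Metric.ball (0 : Slot × Fin n → ℂ) (2 * ρ)) μ).mul (.coord (Slot.w, I))
  exact (IsHolRegular.space (h.hW I)).add h1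

theorem isHolRegular_ξ_add (I : Fin n) :
    IsHolRegular 1 (Metric.ball z₀ (2 * ρ)) (Metric.ball 0 (2 * ρ)) fun t z X =>
      𝔡.ξ I z + ((t ^ μ : ℝ) : ℂ) * X (Slot.d, I) := by
  have h1 := (IsHolRegular.rpow (T := 1) (B := Metric.ball z₀ (2 * ρ))
    (B' := Metric.ball (0 : Slot × Fin n → ℂ) (2 * ρ)) μ).mul (.coord (Slot.d, I))
  exact (IsHolRegular.space (h.hξ I)).add h1

theorem isHolRegular_flux (i : Slot × Fin n) :
    IsHolRegular 1 (Metric.ball z₀ (2 * ρ)) (Metric.ball 0 (2 * ρ))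
      (fun t z X => fluxPart 𝔡 e μ t z X i) := by
  obtain ⟨j, I⟩ := i
  have h1 := (h.isHolRegular_exp_W I).mul (h.isHolRegular_W_add I)
  have h2 := (h.isHolRegular_exp_ξ I).mul (h.isHolRegular_ξ_add I)
  have h3 := fun α => IsHolRegular.rpow (ι := Slot × Fin n) (T := 1)
    (B := Metric.ball z₀ (2 * ρ)) (B' := Metric.ball 0 (2 * ρ)) α
  have h4 := fun i => IsHolRegular.coord (ι := Slot × Fin n) (T := 1)
    (B := Metric.ball z₀ (2 * ρ)) (B' := Metric.ball 0 (2 * ρ)) i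
  cases j <;> simp only [fluxPart]
  · exact .const 0
  · exact (h3 _).mul (h4 _)
  · exact h4 _
  · exact (h3 _).mul h2
  · exact .const 0
  · exact (h3 _).mul h1

theorem isHolRegular_source (i : Slot × Fin n) :
    IsHolRegular 1 (Metric.ball z₀ (2 * ρ)) (Metric.ball 0 (2 * ρ))
      (fun t z X => sourcePart 𝔡 e μ t z X i) := by
  obtain ⟨j, I⟩ := i
  have h1 := (h.isHolRegular_exp_W I).mul ((h.isHolRegular_W_add I).pow 2)
  have h1' := (h.isHolRegular_exp_W I).mul (h.isHolRegular_W_add I)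
  have h2 := (h.isHolRegular_exp_ξ I).mul ((h.isHolRegular_ξ_add I).pow 2)
  have h3 := fun α => IsHolRegular.rpow (ι := Slot × Fin n) (T := 1)
    (B := Metric.ball z₀ (2 * ρ)) (B' := Metric.ball 0 (2 * ρ)) α
  have h4 := fun i => IsHolRegular.coord (ι := Slot × Fin n) (T := 1)
    (B := Metric.ball z₀ (2 * ρ)) (B' := Metric.ball 0 (2 * ρ)) i
  have h5 : IsHolRegular (ι := Slot × Fin n) 1 (Metric.ball z₀ (2 * ρ)) (Metric.ball 0 (2 * ρ))
    (fun t _ _ => ((t ^ 2 : ℝ) : ℂ)) := .time fun t _ => by fun_prop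
  have h6 := ((IsHolRegular.space (ι := Slot × Fin n) (T := 1) (B' := Metric.ball 0 (2 * ρ))
    (h.hb₀ I)).mul .log).add (.space (h.hb₁ I))
  have h7 := fun c => IsHolRegular.const (ι := Slot × Fin n) (T := 1)
    (B := Metric.ball z₀ (2 * ρ)) (B' := Metric.ball 0 (2 * ρ)) c
  cases j <;> simp only [sourcePart]
  · exact h4 _
  · exact (h3 _).mul ((h5.mul h6).add (((h7 _).mul h1).add ((h7 _).mul h2)))
  · exact .const 0
  · exact .const 0
  · exact (h3 _).mul h1'
  · exact .const 0

end VTDData.Bounded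

end System

/-! ### The rescaled system is Fuchsian; local existence and uniqueness -/

section System

variable {n : ℕ} {𝔡 : VTDData n} {z₀ : ℂ} {ρ B μ : ℝ} {e : Fin n → ℝ}

/-- A bound for the rescaled right-hand side. -/
noncomputable def systemBound (n : ℕ) (B : ℝ) : ℝ :=
  2 + 2 * B + Real.exp (2 * (B + (n + 1) * 2)) * (B + 2) ^ 2
    + Real.exp (2 * (B + (n + 1) * 2)) * (B + 2)

theorem tameNonlinearity_of {ι : Type*} [Fintype ι] {T M : ℝ} {F : ℝ → ℂ → (ι → ℂ) → (ι → ℂ)}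
    (h : ∀ i, IsHolRegular T (Metric.ball z₀ (2 * ρ)) (Metric.ball 0 (2 * ρ))
      (fun t z X => F t z X i)) (hM : 0 ≤ M)
    (hb : ∀ t ∈ Ioo 0 T, ∀ z ∈ Metric.ball z₀ (2 * ρ), ∀ X ∈ Metric.ball (0 : ι → ℂ) (2 * ρ),
      ∀ i, ‖F t z X i‖ ≤ M) : TameNonlinearity z₀ ρ T M F :=
  ⟨continuousOn_pi.2 fun i => (h i).1, fun t ht => differentiableOn_pi.2 fun i => (h i).2 t ht,
    fun t ht z hz X hX => (pi_norm_le_iff_of_nonneg hM).2 fun i => hb t ht z hz X hX i⟩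

theorem norm_ofReal_rpow {t : ℝ} (ht : 0 < t) (α : ℝ) : ‖((t ^ α : ℝ) : ℂ)‖ = t ^ α := by
  rw [Complex.norm_real, Real.norm_of_nonneg (Real.rpow_nonneg ht.le _)]

theorem norm_rpow_neg_mul_le {t α β C : ℝ} {v : ℂ} (ht : 0 < t) (ht1 : t ≤ 1) (hC : 0 ≤ C)
    (h : α ≤ β) (hv : ‖v‖ ≤ t ^ β * C) : ‖((t ^ (-α) : ℝ) : ℂ) * v‖ ≤ C := by
  rw [norm_mul, norm_ofReal_rpow ht]
  exact (mul_le_mul_of_nonneg_left hv (Real.rpow_nonneg ht.le _)).trans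
    (rpow_mul_rpow_neg_le ht ht1 hC h)

theorem sq_mul_abs_log_le {t : ℝ} (ht : 0 < t) (ht1 : t ≤ 1) : t ^ 2 * |Real.log t| ≤ t := by
  have h := (Real.abs_log_mul_self_lt t ht ht1).le
  rw [abs_mul, abs_of_pos ht] at h
  nlinarith

theorem norm_sq_mul_log_le {t : ℝ} {b₀ b₁ : ℂ} (ht : 0 < t) (ht1 : t ≤ 1) (h₀ : ‖b₀‖ ≤ B)
    (h₁ : ‖b₁‖ ≤ B) : ‖((t ^ 2 : ℝ) : ℂ) * (b₀ * Real.log t + b₁)‖ ≤ t ^ (1 : ℝ) * (2 * B) := by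
  have hB : 0 ≤ B := (norm_nonneg _).trans h₀
  have h2 : ‖b₀ * Real.log t + b₁‖ ≤ B * |Real.log t| + B := by
    refine (norm_add_le _ _).trans (add_le_add ?_ h₁)
    rw [norm_mul, Complex.norm_real, Real.norm_eq_abs]
    exact mul_le_mul_of_nonneg_right h₀ (abs_nonneg _)
  have h3 := sq_mul_abs_log_le ht ht1
  rw [norm_mul, Complex.norm_real, Real.norm_of_nonneg (sq_nonneg t), Real.rpow_one]
  calc t ^ 2 * ‖b₀ * Real.log t + b₁‖ ≤ t ^ 2 * (B * |Real.log t| + B) := by gcongr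
    _ = B * (t ^ 2 * |Real.log t|) + t * t * B := by ring
    _ ≤ B * t + t * 1 * B := by gcongr
    _ = t * (2 * B) := by ring

namespace VTDData.Bounded

variable (h : 𝔡.Bounded z₀ ρ B e μ)
include h

theorem norm_scaledS_terms {t : ℝ} {z : ℂ} {X : Slot × Fin n → ℂ} (ht : t ∈ Ioo (0 : ℝ) 1)
    (hz : z ∈ Metric.ball z₀ (2 * ρ)) (hX : X ∈ Metric.ball (0 : Slot × Fin n → ℂ) (2 * ρ))
    (I : Fin n) :
    (∀ i, ‖X i‖ ≤ 2) ∧ ‖𝔡.W I z + ((t ^ μ : ℝ) : ℂ) * X (.w, I)‖ ≤ B + 2 ∧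
    ‖𝔡.ξ I z + ((t ^ μ : ℝ) : ℂ) * X (.d, I)‖ ≤ B + 2 ∧
    ‖Complex.exp (2 * scaledS 𝔡 e I t z X)‖ ≤
      t ^ (e I + 2 * μ) * Real.exp (2 * (B + (n + 1) * 2)) ∧
    ‖((t ^ 2 : ℝ) : ℂ) * Complex.exp (-2 * scaledS 𝔡 e I t z X)‖ ≤
      t ^ (e I + 2 * μ) * Real.exp (2 * (B + (n + 1) * 2)) := by
  have hX2 : ∀ i, ‖X i‖ ≤ 2 := fun i => by
    have := norm_le_pi_norm X i
    rw [mem_ball_zero_iff] at hX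
    linarith [h.ρ_le]
  have hpow : ∀ α : ℝ, 0 < α → ∀ i, ‖((t ^ α : ℝ) : ℂ) * X i‖ ≤ 2 := fun α hα i => by
    rw [norm_mul, norm_ofReal_rpow ht.1]
    have := Real.rpow_le_one ht.1.le ht.2.le hα.le
    exact (mul_le_of_le_one_left (norm_nonneg _) this).trans (hX2 i)
  refine ⟨hX2, ?_, ?_, ?_, ?_⟩
  · exact (norm_add_le _ _).trans (add_le_add (h.W_le I z hz) (hpow μ h.μ_pos _))
  · exact (norm_add_le _ _).trans (add_le_add (h.ξ_le I z hz) (hpow μ h.μ_pos _))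
  · exact VTDData.norm_exp_S_le ht.1 ht.2.le (h.le_k I z hz) (h.s_le I z hz)
      fun J => hpow _ (h.e_pos J) _
  · exact VTDData.norm_exp_neg_S_le ht.1 ht.2.le (h.k_le I z hz) (h.s_le I z hz)
      fun J => hpow _ (h.e_pos J) _

theorem systemBound_nonneg : 0 ≤ systemBound n B := by
  have := h.B_nonneg
  unfold systemBound
  positivity

/-- The weights leave a factor t^{γ+μ} in each component. In u and c this is the extra μ in the
weight of a. In a the source must be O(t^{e+2μ}): `le_k` gives this for e^{2S}, `k_le` for t²
e^{-2S} and `e_le` for t² ln t. The fluxes and sources of w, y and d need only t^{2μ}. -/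
theorem fuchsianSystem :
    FuchsianSystem z₀ ρ 1 (systemBound n B) μ (slotWeight e μ) (fluxPart 𝔡 e μ)
      (sourcePart 𝔡 e μ) := by
  have hB := h.B_nonneg
  have hμ := h.μ_pos
  have hM := h.systemBound_nonneg
  refine ⟨h.ρ_pos, h.ρ_le, one_pos, hM, h.μ_pos, h.slotWeight_pos,
    tameNonlinearity_of h.isHolRegular_flux hM ?_,
    tameNonlinearity_of h.isHolRegular_source hM ?_⟩
  all_goals
    rintro t ht z hz X hX ⟨j, I⟩
    obtain ⟨hX2, hW, hξ, hp, hm⟩ := h.norm_scaledS_terms ht hz hX I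
    have heI := h.e_pos I
    have hle := h.e_le I
    have htβ := Real.rpow_nonneg ht.1.le (e I + 2 * μ)
    set C := Real.exp (2 * (B + (n + 1) * 2)) with hC
    have hC0 : 0 < C := Real.exp_pos _
    have hM2 : 2 ≤ systemBound n B := by
      have h1 : 0 ≤ C * (B + 2) ^ 2 + C * (B + 2) := by positivity
      simp only [systemBound, ← hC]; linarith
    have hMC : C * (B + 2) ≤ systemBound n B := by
      have h1 : 0 ≤ C * (B + 2) ^ 2 := by positivity
      simp only [systemBound, ← hC]; linarith
    have hWp : ‖Complex.exp (2 * scaledS 𝔡 e I t z X) *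
        (𝔡.W I z + ((t ^ μ : ℝ) : ℂ) * X (.w, I))‖ ≤ t ^ (e I + 2 * μ) * (C * (B + 2)) := by
      rw [norm_mul, ← mul_assoc]
      gcongr
    have hξm : ‖((t ^ 2 : ℝ) : ℂ) * Complex.exp (-2 * scaledS 𝔡 e I t z X) *
        (𝔡.ξ I z + ((t ^ μ : ℝ) : ℂ) * X (.d, I))‖ ≤ t ^ (e I + 2 * μ) * (C * (B + 2)) := by
      rw [norm_mul, ← mul_assoc]
      gcongr
    have hX2M := fun i => (hX2 i).trans hM2
  · cases j <;> simp only [fluxPart]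
    · simpa using hM
    · rw [norm_mul, norm_ofReal_rpow ht.1]
      exact (mul_le_of_le_one_left (norm_nonneg _)
        (Real.rpow_le_one ht.1.le ht.2.le (by linarith))).trans (hX2M _)
    · exact hX2M _
    · exact (norm_rpow_neg_mul_le ht.1 ht.2.le (by positivity) (by linarith) hξm).trans hMC
    · simpa using hM
    · exact (norm_rpow_neg_mul_le ht.1 ht.2.le (by positivity) (by linarith) hWp).trans hMC
  · cases j <;> simp only [sourcePart]
    · exact hX2M _
    · have h1 := norm_rpow_neg_mul_le ht.1 ht.2.le (by positivity) hle
        (norm_sq_mul_log_le ht.1 ht.2.le (h.b₀_le I z hz) (h.b₁_le I z hz))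
      have h2 : ‖(-1 / 2 : ℂ) * (Complex.exp (2 * scaledS 𝔡 e I t z X) *
          (𝔡.W I z + ((t ^ μ : ℝ) : ℂ) * X (.w, I)) ^ 2)‖
          ≤ t ^ (e I + 2 * μ) * (1 / 2 * (C * (B + 2) ^ 2)) := by
        rw [norm_mul, norm_mul, norm_pow]
        calc ‖(-1 / 2 : ℂ)‖ * (‖Complex.exp (2 * scaledS 𝔡 e I t z X)‖ *
              ‖𝔡.W I z + ((t ^ μ : ℝ) : ℂ) * X (.w, I)‖ ^ 2)
            ≤ 1 / 2 * (t ^ (e I + 2 * μ) * C * (B + 2) ^ 2) := by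
              gcongr
              norm_num
          _ = _ := by ring
      have h3 : ‖(1 / 2 : ℂ) * (((t ^ 2 : ℝ) : ℂ) * Complex.exp (-2 * scaledS 𝔡 e I t z X) *
          (𝔡.ξ I z + ((t ^ μ : ℝ) : ℂ) * X (.d, I)) ^ 2)‖
          ≤ t ^ (e I + 2 * μ) * (1 / 2 * (C * (B + 2) ^ 2)) := by
        rw [norm_mul, norm_mul, norm_pow]
        calc ‖(1 / 2 : ℂ)‖ * (‖((t ^ 2 : ℝ) : ℂ) * Complex.exp (-2 * scaledS 𝔡 e I t z X)‖ *
              ‖𝔡.ξ I z + ((t ^ μ : ℝ) : ℂ) * X (.d, I)‖ ^ 2)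
            ≤ 1 / 2 * (t ^ (e I + 2 * μ) * C * (B + 2) ^ 2) := by
              gcongr
              norm_num
          _ = _ := by ring
      have h2' := norm_rpow_neg_mul_le ht.1 ht.2.le (by positivity) le_rfl h2
      have h3' := norm_rpow_neg_mul_le ht.1 ht.2.le (by positivity) le_rfl h3
      rw [mul_add ((t ^ (-(e I + 2 * μ)) : ℝ) : ℂ), mul_add ((t ^ (-(e I + 2 * μ)) : ℝ) : ℂ)]
      refine (norm_add_le _ _).trans ((add_le_add h1 ((norm_add_le _ _).trans
        (add_le_add h2' h3'))).trans ?_)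
      have h4 : 0 ≤ C * (B + 2) := by positivity
      simp only [systemBound, ← hC]
      linarith
    · simpa using hM
    · simpa using hM
    · exact (norm_rpow_neg_mul_le ht.1 ht.2.le (by positivity) (by linarith) hWp).trans hMC
    · simpa using hM

end VTDData.Bounded

theorem rpow_mul_eq {t α β δ : ℝ} (ht : 0 < t) (h : α + β = δ) (v : ℂ) :
    ((t ^ α : ℝ) : ℂ) * (((t ^ β : ℝ) : ℂ) * v) = ((t ^ δ : ℝ) : ℂ) * v := by
  rw [← mul_assoc, ← Complex.ofReal_mul, ← Real.rpow_add ht, h]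

/-- The factor t^{γ+μ} cancels the negative powers put into flux and source. These depend on t alone
and commute with ∂_z. -/
theorem unscale_rhs {X : ℝ → ℂ → Slot × Fin n → ℂ} {t : ℝ} {z : ℂ} (ht : 0 < t)
    (hd : DifferentiableAt ℂ (fun v => fluxPart 𝔡 e μ t v (X t v)) z) (i : Slot × Fin n) :
    t ^ (slotWeight e μ i + μ) • fuchsRHS (fluxPart 𝔡 e μ) (sourcePart 𝔡 e μ) X t z i =
      vtdRHS 𝔡 (unscale e μ X) t z i := by
  have h1 : fuchsRHS (fluxPart 𝔡 e μ) (sourcePart 𝔡 e μ) X t z i =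
      deriv (fun v => fluxPart 𝔡 e μ t v (X t v) i) z + sourcePart 𝔡 e μ t z (X t z) i := by
    rw [fuchsRHS, Pi.add_apply, deriv_pi (differentiableAt_pi.1 hd)]
  rw [h1]
  obtain ⟨j, I⟩ := i
  have hc := fun (α : ℝ) (f : ℂ → ℂ) => (deriv_const_mul_field (x := z) (v := f) ((t ^ α : ℝ) : ℂ))
  cases j <;> simp only [fluxPart, sourcePart, vtdRHS, unscale, slotWeight, scaledS,
    Complex.real_smul, deriv_const, zero_add, add_zero]
  · rw [hc, hc, mul_add, rpow_mul_eq (δ := 2 + e I) ht (by ring),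
      rpow_mul_eq (δ := 0) ht (by ring), Real.rpow_zero, Real.rpow_add ht, Real.rpow_two]
    push_cast
    ring
  · rw [hc]
  · rw [hc, rpow_mul_eq (δ := 0) ht (by ring), Real.rpow_zero]
    push_cast
    ring
  · rw [rpow_mul_eq (δ := 0) ht (by ring), Real.rpow_zero]
    push_cast
    ring
  · rw [hc, rpow_mul_eq (δ := 0) ht (by ring), Real.rpow_zero]
    push_cast
    ring

theorem vtdRHS_congr {x x' : ℝ → ℂ → Slot × Fin n → ℂ} {t : ℝ} (h : x t = x' t) (z : ℂ) :
    vtdRHS 𝔡 x t z = vtdRHS 𝔡 x' t z := by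
  funext ⟨j, I⟩
  cases j <;> simp only [vtdRHS, h]

/-- `t ∂ₜ x = vtdRHS x` on `Ω`. -/
def SolvesSystem (𝔡 : VTDData n) (Ω : Set (ℝ × ℂ)) (x : ℝ → ℂ → Slot × Fin n → ℂ) : Prop :=
  ∀ p ∈ Ω, ∀ i, HasDerivAt (fun s => x s p.2 i) (p.1⁻¹ • vtdRHS 𝔡 x p.1 p.2 i) p.1

/-- Real values at real points. -/
structure VTDData.IsReal (𝔡 : VTDData n) : Prop where
  k : ∀ I (x : ℝ), (𝔡.k I x).im = 0
  s : ∀ I (x : ℝ), (𝔡.s I x).im = 0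
  b₀ : ∀ I (x : ℝ), (𝔡.b₀ I x).im = 0
  b₁ : ∀ I (x : ℝ), (𝔡.b₁ I x).im = 0
  ξ : ∀ I (x : ℝ), (𝔡.ξ I x).im = 0
  W : ∀ I (x : ℝ), (𝔡.W I x).im = 0

theorem im_mul_eq_zero {a b : ℂ} (ha : a.im = 0) (hb : b.im = 0) : (a * b).im = 0 := by
  rw [Complex.mul_im, ha, hb, mul_zero, zero_mul, add_zero]

theorem im_add_eq_zero {a b : ℂ} (ha : a.im = 0) (hb : b.im = 0) : (a + b).im = 0 := by
  rw [Complex.add_im, ha, hb, add_zero]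

theorem im_exp_eq_zero {a : ℂ} (ha : a.im = 0) : (Complex.exp a).im = 0 := by
  rw [Complex.exp_im, ha, Real.sin_zero, mul_zero]

theorem VTDData.IsReal.im_S (hr : 𝔡.IsReal) (I : Fin n) (t x : ℝ) {u : Fin n → ℂ}
    (hu : ∀ J, (u J).im = 0) : (𝔡.S I t x u).im = 0 := by
  refine im_add_eq_zero (im_add_eq_zero (im_mul_eq_zero (hr.k I x) (Complex.ofReal_im _))
    (hr.s I x)) (im_add_eq_zero ?_ (hu I))
  rw [Complex.im_sum]
  exact Finset.sum_eq_zero fun J _ => hu J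

theorem VTDData.IsReal.parts (hr : 𝔡.IsReal) (t x : ℝ) {X : Slot × Fin n → ℂ}
    (hX : ∀ i, (X i).im = 0) (i : Slot × Fin n) :
    (fluxPart 𝔡 e μ t x X i).im = 0 ∧ (sourcePart 𝔡 e μ t x X i).im = 0 := by
  obtain ⟨j, I⟩ := i
  have hp : ∀ (α : ℝ) {v : ℂ}, v.im = 0 → (((t ^ α : ℝ) : ℂ) * v).im = 0 := fun α v hv =>
    im_mul_eq_zero (Complex.ofReal_im _) hv
  have hS := hr.im_S I t x fun J => hp (e J) (hX (.u, J))
  have hp' : (Complex.exp (2 * scaledS 𝔡 e I t x X)).im = 0 :=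
    im_exp_eq_zero (im_mul_eq_zero (Complex.im_ofNat 2) hS)
  have hm' : (((t ^ 2 : ℝ) : ℂ) * Complex.exp (-2 * scaledS 𝔡 e I t x X)).im = 0 :=
    im_mul_eq_zero (Complex.ofReal_im _) (im_exp_eq_zero (im_mul_eq_zero (by simp) hS))
  have hW := im_add_eq_zero (hr.W I x) (hp μ (hX (.w, I)))
  have hξ := im_add_eq_zero (hr.ξ I x) (hp μ (hX (.d, I)))
  cases j <;> simp only [fluxPart, sourcePart]
  · exact ⟨rfl, hX _⟩
  · refine ⟨hp _ (hX _), hp _ (im_add_eq_zero (im_mul_eq_zero (Complex.ofReal_im _)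
      (im_add_eq_zero (im_mul_eq_zero (hr.b₀ I x) (Complex.ofReal_im _)) (hr.b₁ I x)))
      (im_add_eq_zero (im_mul_eq_zero (by norm_num) (im_mul_eq_zero hp' ?_))
      (im_mul_eq_zero (by norm_num) (im_mul_eq_zero hm' ?_))))⟩ <;> rw [sq]
    · exact im_mul_eq_zero hW hW
    · exact im_mul_eq_zero hξ hξ
  · exact ⟨hX _, rfl⟩
  · exact ⟨hp _ (im_mul_eq_zero hm' hξ), rfl⟩
  · exact ⟨rfl, hp _ (im_mul_eq_zero hp' hW)⟩
  · exact ⟨hp _ (im_mul_eq_zero hp' hW), rfl⟩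

theorem SolvesSystem.of_fuchs (h : 𝔡.Bounded z₀ ρ B e μ) {η : ℝ} (hη : 0 < η)
    (hηT : ρ ≤ η * (1 : ℝ) ^ μ) {X : ℝ → ℂ → Slot × Fin n → ℂ}
    (hX : IsAdmissible (cone z₀ ρ η μ) ρ X) {p : ℝ × ℂ} (hp : p ∈ cone z₀ ρ η μ)
    (i : Slot × Fin n) :
    p.1 ^ (slotWeight e μ i + μ - 1) • fuchsRHS (fluxPart 𝔡 e μ) (sourcePart 𝔡 e μ) X p.1 p.2 i =
      p.1⁻¹ • vtdRHS 𝔡 (unscale e μ X) p.1 p.2 i := by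
  rw [← unscale_rhs hp.1 (h.fuchsianSystem.differentiableAt_comp hη hηT
    h.fuchsianSystem.tameG hX hp), smul_smul, Real.rpow_sub_one hp.1.ne']
  congr 1
  ring

/-- Local existence for the first order system. -/
theorem exists_system_solution (h : 𝔡.Bounded z₀ ρ B e μ) (hr : 𝔡.IsReal) :
    ∃ T > 0, ∃ r > 0, T ≤ 1 ∧ r ≤ ρ ∧ ∃ x : ℝ → ℂ → Slot × Fin n → ℂ,
      HolFamily (Ioo 0 T ×ˢ Metric.ball z₀ r) x ∧
      SolvesSystem 𝔡 (Ioo 0 T ×ˢ Metric.ball z₀ r) x ∧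
      (∀ p ∈ Ioo 0 T ×ˢ Metric.ball z₀ r, ∀ i, ‖x p.1 p.2 i‖ ≤ p.1 ^ slotWeight e μ i) ∧
      ∀ t y : ℝ, (t, (y : ℂ)) ∈ Ioo 0 T ×ˢ Metric.ball z₀ r → ∀ i, (x t y i).im = 0 := by
  have S := h.fuchsianSystem
  have hρ := h.ρ_pos
  have hμ := h.μ_pos
  have hM := h.systemBound_nonneg
  set M := systemBound n B
  have h0 : 0 ≤ 56 * M / ρ ^ 2 / μ := by positivity
  -- The first term is the steepness needed for the iteration; the summand 1 confines the cone to t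
  -- < 1, as ρ ≤ 1.
  set η : ℝ := 56 * M / ρ ^ 2 / μ + 1 with hη_def
  have hη : 0 < η := by positivity
  have hηT : ρ ≤ η * (1 : ℝ) ^ μ := by
    rw [Real.one_rpow, mul_one]
    linarith [h.ρ_le]
  have hη1 : 56 * M / ρ ^ 2 ≤ η * μ := by
    rw [← div_le_iff₀ hμ]
    linarith
  obtain ⟨X, hX, hXa, hXi, hXr⟩ := S.exists_solution hη hηT hη1 (by
    rintro F (rfl | rfl) t x y hy i
    · exact (hr.parts t x hy i).1
    · exact (hr.parts t x hy i).2)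
  -- As long as η t^μ < ρ/2, the slice of the cone contains the disc of radius ρ/2.
  obtain ⟨T, hT, hT'⟩ := mem_nhdsGT_iff_exists_Ioo_subset.1
    (eventually_mul_rpow_lt (C := η) hμ (half_pos hρ))
  have hsub : Ioo 0 (min T 1) ×ˢ Metric.ball z₀ (ρ / 2) ⊆ cone z₀ ρ η μ := by
    rintro ⟨t, z⟩ ⟨ht, hz⟩
    have h1 : η * t ^ μ < ρ / 2 := hT' ⟨ht.1, ht.2.trans_le (min_le_left _ _)⟩
    rw [mem_ball_iff_norm] at hz
    refine ⟨ht.1, ?_⟩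
    show 0 < ρ - ‖z - z₀‖ - η * t ^ μ
    linarith
  refine ⟨min T 1, lt_min hT one_pos, ρ / 2, half_pos hρ, min_le_right _ _, by linarith,
    unscale e μ X, ?_, ?_, ?_, ?_⟩
  · refine holFamily_pi fun i => ?_
    have h1 := (hX.mono hsub).apply i
    refine ⟨ContinuousOn.smul (f := fun p : ℝ × ℂ => p.1 ^ slotWeight e μ i) ?_ h1.cont,
      fun p hp => (h1.diff p hp).const_smul (p.1 ^ slotWeight e μ i)⟩
    exact ((Real.continuous_rpow_const (h.slotWeight_pos i).le).comp continuous_fst).continuousOn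
  · intro p hp i
    have h1 := hXi.deriv p (hsub hp) i
    rw [SolvesSystem.of_fuchs h hη hηT hXa (hsub hp)] at h1
    exact h1
  · intro p hp i
    have h1 := hXa.bound p (hsub hp)
    have h2 := Real.rpow_nonneg hp.1.1.le (slotWeight e μ i)
    rw [unscale, norm_smul, Real.norm_of_nonneg h2]
    exact mul_le_of_le_one_right h2 ((norm_le_pi_norm _ i).trans (h1.trans h.ρ_le))
  · intro t y hp i
    simp only [unscale, Complex.smul_im, hXr t y (hsub hp) i, smul_zero]

/-- Local uniqueness for the first order system. -/
theorem system_unique (h : 𝔡.Bounded z₀ ρ B e μ) {T : ℝ} (hT : 0 < T)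
    {x x' : ℝ → ℂ → Slot × Fin n → ℂ}
    (hd : ∀ y ∈ ({x, x'} : Set (ℝ → ℂ → Slot × Fin n → ℂ)),
      (∀ p ∈ Ioo 0 T ×ˢ Metric.ball z₀ ρ, DifferentiableAt ℂ (y p.1) p.2) ∧
      SolvesSystem 𝔡 (Ioo 0 T ×ˢ Metric.ball z₀ ρ) y ∧
      ∀ p ∈ Ioo 0 T ×ˢ Metric.ball z₀ ρ, ∀ i, ‖y p.1 p.2 i‖ ≤ ρ * p.1 ^ slotWeight e μ i) :
    ∃ T' > 0, ∃ r > 0, ∀ t ∈ Ioo 0 T', ∀ z ∈ Metric.ball z₀ r, x t z = x' t z := by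
  have S := h.fuchsianSystem
  have hρ := h.ρ_pos
  have hμ := h.μ_pos
  have hM := h.systemBound_nonneg
  set M := systemBound n B
  have hTμ : 0 < T ^ μ := Real.rpow_pos_of_pos hT _
  have h0 : 0 ≤ 56 * M / ρ / μ := by positivity
  have h0' : 0 ≤ ρ / T ^ μ := by positivity
  -- The summand ρ/T^μ closes the cone before the time T up to which both solutions are given.
  set η : ℝ := 56 * M / ρ / μ + 1 + ρ / T ^ μ with hη_def
  have hη : 0 < η := by positivity
  have hηT1 : ρ ≤ η * (1 : ℝ) ^ μ := by
    rw [Real.one_rpow, mul_one]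
    linarith [h.ρ_le]
  have hηT : ρ ≤ η * T ^ μ := by
    rw [← div_le_iff₀ hTμ]
    linarith
  have hη1 : 56 * M / ρ ≤ η * μ := by
    rw [← div_le_iff₀ hμ]
    linarith
  have hsub : cone z₀ ρ η μ ⊆ Ioo 0 T ×ˢ Metric.ball z₀ ρ := fun p hp =>
    ⟨cone_lt hη hμ hT hηT hp, cone_mem_ball hη hp⟩
  let X : (ℝ → ℂ → Slot × Fin n → ℂ) → ℝ → ℂ → Slot × Fin n → ℂ := fun y t z i =>
    t ^ (-slotWeight e μ i) • y t z i
  have hXu : ∀ y t, 0 < t → unscale e μ (X y) t = y t := by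
    intro y t ht
    funext z i
    simp only [unscale, X, smul_smul]
    rw [← Real.rpow_add ht, add_neg_cancel, Real.rpow_zero, one_smul]
  have key : ∀ y ∈ ({x, x'} : Set (ℝ → ℂ → Slot × Fin n → ℂ)),
      IsAdmissible (cone z₀ ρ η μ) ρ (X y) ∧ IsFuchsImage μ (slotWeight e μ) (fluxPart 𝔡 e μ)
        (sourcePart 𝔡 e μ) (cone z₀ ρ η μ) (X y) (X y) := by
    intro y hy
    obtain ⟨h1, h2, h3⟩ := hd y hy
    have hadm : IsAdmissible (cone z₀ ρ η μ) ρ (X y) := by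
      refine ⟨fun p hp => differentiableAt_pi.2 fun i =>
        (differentiableAt_pi.1 (h1 p (hsub hp)) i).const_smul (p.1 ^ (-slotWeight e μ i)),
        fun p hp => (pi_norm_le_iff_of_nonneg hρ.le).2 fun i => ?_⟩
      have h4 := h3 p (hsub hp) i
      have h5 := Real.rpow_pos_of_pos hp.1 (slotWeight e μ i)
      simp only [X]
      rw [norm_smul, Real.norm_of_nonneg (Real.rpow_nonneg hp.1.le _), Real.rpow_neg hp.1.le,
        inv_mul_le_iff₀ h5, mul_comm]
      exact h4
    have hev : ∀ t, 0 < t → ∀ z i, t ^ slotWeight e μ i • X y t z i = y t z i := fun t ht z i =>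
      congr_fun (congr_fun (hXu y t ht) z) i
    refine ⟨hadm, fun p hp i => ?_, fun p hp i => ?_⟩
    · rw [SolvesSystem.of_fuchs h hη hηT1 hadm hp, vtdRHS_congr (hXu y p.1 hp.1)]
      refine (h2 p (hsub hp) i).congr_of_eventuallyEq ?_
      filter_upwards [lt_mem_nhds hp.1] with s hs using hev s hs _ _
    · have h4 := (tendsto_rpow_zero (h.slotWeight_pos i)).const_mul ρ
      rw [mul_zero] at h4
      refine squeeze_zero_norm' ?_ h4
      filter_upwards [Ioo_mem_nhdsGT hp.1] with s hs
      rw [hev s hs.1]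
      exact h3 (s, p.2) (hsub (cone_mem_of_le hη hμ hp hs.1 hs.2.le)) i
  obtain ⟨ka, ki⟩ := key x (by simp)
  obtain ⟨ka', ki'⟩ := key x' (by simp)
  have huniq := S.unique hη hηT1 hη1 ka ka' ki ki'
  obtain ⟨T', hT', hT''⟩ := mem_nhdsGT_iff_exists_Ioo_subset.1
    (eventually_mul_rpow_lt (C := η) hμ (half_pos hρ))
  refine ⟨T', hT', ρ / 2, half_pos hρ, fun t ht z hz => ?_⟩
  have h1 : η * t ^ μ < ρ / 2 := hT'' ht
  rw [mem_ball_iff_norm] at hz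
  have hp : (t, z) ∈ cone z₀ ρ η μ := by
    refine ⟨ht.1, ?_⟩
    show 0 < ρ - ‖z - z₀‖ - η * t ^ μ
    linarith
  have h2 : X x t z = X x' t z := huniq _ hp
  rw [← hXu x t ht.1, ← hXu x' t ht.1]
  funext i
  simp only [unscale, h2]

end System

/-! ### Calculus of uniform power bounds as t → 0⁺ -/

section Decay

/-- `f = O(t ^ β)` as `t → 0⁺`, uniformly on the disc of radius `r`. -/
def Decay (z₀ : ℂ) (r β : ℝ) (f : ℝ → ℂ → ℂ) : Prop :=
  ∃ C : ℝ, 0 ≤ C ∧ ∀ᶠ t in 𝓝[>] (0 : ℝ), ∀ z ∈ Metric.ball z₀ r, ‖f t z‖ ≤ C * t ^ β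

variable {z₀ : ℂ} {r r' β β' T : ℝ} {f g : ℝ → ℂ → ℂ}

theorem eventually_pos_lt {T : ℝ} (hT : 0 < T) : ∀ᶠ t in 𝓝[>] (0 : ℝ), t ∈ Ioo 0 T :=
  Ioo_mem_nhdsGT hT

namespace Decay

theorem of_le {C : ℝ} (hT : 0 < T) (hC : 0 ≤ C)
    (h : ∀ t ∈ Ioo 0 T, ∀ z ∈ Metric.ball z₀ r, ‖f t z‖ ≤ C * t ^ β) : Decay z₀ r β f :=
  ⟨C, hC, by filter_upwards [eventually_pos_lt hT] with t ht using h t ht⟩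

theorem congr (hf : Decay z₀ r β f) (hT : 0 < T)
    (h : ∀ t ∈ Ioo 0 T, ∀ z ∈ Metric.ball z₀ r, g t z = f t z) : Decay z₀ r β g := by
  obtain ⟨C, hC, hf⟩ := hf
  refine ⟨C, hC, ?_⟩
  filter_upwards [hf, eventually_pos_lt hT] with t h1 ht z hz
  rw [h t ht z hz]
  exact h1 z hz

theorem mono_exp (hf : Decay z₀ r β f) (h : β' ≤ β) : Decay z₀ r β' f := by
  obtain ⟨C, hC, hf⟩ := hf
  refine ⟨C, hC, ?_⟩
  filter_upwards [hf, eventually_pos_lt one_pos] with t h1 ht z hz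
  exact (h1 z hz).trans
    (mul_le_mul_of_nonneg_left (Real.rpow_le_rpow_of_exponent_ge ht.1 ht.2.le h) hC)

theorem mono_radius (hf : Decay z₀ r β f) (h : r' ≤ r) : Decay z₀ r' β f := by
  obtain ⟨C, hC, hf⟩ := hf
  exact ⟨C, hC, hf.mono fun t h1 z hz => h1 z (Metric.ball_subset_ball h hz)⟩

theorem add (hf : Decay z₀ r β f) (hg : Decay z₀ r β g) :
    Decay z₀ r β (fun t z => f t z + g t z) := by
  obtain ⟨C, hC, hf⟩ := hf
  obtain ⟨C', hC', hg⟩ := hg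
  refine ⟨C + C', by positivity, ?_⟩
  filter_upwards [hf, hg] with t h1 h2 z hz
  rw [add_mul]
  exact (norm_add_le _ _).trans (add_le_add (h1 z hz) (h2 z hz))

theorem sum {ι : Type*} [Fintype ι] {f : ι → ℝ → ℂ → ℂ} (hf : ∀ i, Decay z₀ r β (f i)) :
    Decay z₀ r β (fun t z => ∑ i, f i t z) := by
  choose C hC hf using hf
  refine ⟨∑ i, C i, Finset.sum_nonneg fun i _ => hC i, ?_⟩
  filter_upwards [eventually_all.2 hf] with t h1 z hz
  rw [Finset.sum_mul]
  exact norm_sum_le_of_le _ fun i _ => h1 i z hz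

theorem mul (hf : Decay z₀ r β f) (hg : Decay z₀ r β' g) :
    Decay z₀ r (β + β') (fun t z => f t z * g t z) := by
  obtain ⟨C, hC, hf⟩ := hf
  obtain ⟨C', hC', hg⟩ := hg
  refine ⟨C * C', by positivity, ?_⟩
  filter_upwards [hf, hg, self_mem_nhdsWithin] with t h1 h2 ht z hz
  have ht' : 0 < t := ht
  rw [norm_mul, Real.rpow_add ht', mul_mul_mul_comm]
  have := h1 z hz
  have := h2 z hz
  gcongr

theorem mul_bounded (hf : Decay z₀ r β f) (hg : Decay z₀ r 0 g) :
    Decay z₀ r β (fun t z => f t z * g t z) := by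
  simpa using hf.mul hg

theorem of_bounded {h : ℂ → ℂ} {C : ℝ} (hh : ∀ z ∈ Metric.ball z₀ r, ‖h z‖ ≤ C) :
    Decay z₀ r 0 (fun _ z => h z) :=
  of_le one_pos (abs_nonneg C) fun t _ z hz => by
    rw [Real.rpow_zero, mul_one]
    exact (hh z hz).trans (le_abs_self C)

theorem const (c : ℂ) : Decay z₀ r 0 (fun _ _ => c) :=
  of_bounded fun _ _ => le_rfl

theorem const_mul (c : ℂ) (hf : Decay z₀ r β f) : Decay z₀ r β (fun t z => c * f t z) := by
  simpa using (const c).mul hf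

/-- Cauchy's estimate: the exponent is kept and the disc shrinks. -/
theorem deriv_z (hf : Decay z₀ r β f) (h : r' < r) (hT : 0 < T)
    (hd : ∀ t ∈ Ioo 0 T, DifferentiableOn ℂ (f t) (Metric.ball z₀ r)) :
    Decay z₀ r' β (fun t => deriv (f t)) := by
  obtain ⟨C, hC, hf⟩ := hf
  have hr : 0 < r - r' := sub_pos.2 h
  refine ⟨2 * C / (r - r'), by positivity, ?_⟩
  filter_upwards [hf, eventually_pos_lt hT] with t h1 ht z hz
  exact (norm_deriv_le_of_ball_of_mem h (hd t ht) h1 hz).trans (le_of_eq (by ring))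

theorem tendstoUniformlyOn (hf : Decay z₀ r β f) (hβ : 0 < β) :
    TendstoUniformlyOn f (fun _ => 0) (𝓝[>] 0) (Metric.ball z₀ r) := by
  obtain ⟨C, hC, hf⟩ := hf
  rw [Metric.tendstoUniformlyOn_iff]
  intro ε hε
  filter_upwards [hf, eventually_mul_rpow_lt (C := C) hβ hε] with t h1 h2 z hz
  rw [dist_comm, dist_zero_right]
  exact (h1 z hz).trans_lt h2

theorem tendsto (hf : Decay z₀ r β f) (hβ : 0 < β) {z : ℂ} (hz : z ∈ Metric.ball z₀ r) :
    Tendsto (fun t => f t z) (𝓝[>] 0) (𝓝 0) :=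
  (hf.tendstoUniformlyOn hβ).tendsto_at hz

/-- A strict loss in the exponent buys an arbitrarily small constant. This puts given solutions into
the small ball where uniqueness is known. -/
theorem eventually_le (hf : Decay z₀ r β f) (h : β' < β) {δ : ℝ} (hδ : 0 < δ) :
    ∀ᶠ t in 𝓝[>] (0 : ℝ), ∀ z ∈ Metric.ball z₀ r, ‖f t z‖ ≤ δ * t ^ β' := by
  obtain ⟨C, hC, hf⟩ := hf
  filter_upwards [hf, eventually_mul_rpow_lt (C := C) (sub_pos.2 h) hδ, self_mem_nhdsWithin]
    with t h1 h2 ht z hz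
  have ht' : 0 < t := ht
  refine (h1 z hz).trans ?_
  have h3 : t ^ β = t ^ (β - β') * t ^ β' := by rw [← Real.rpow_add ht', sub_add_cancel]
  rw [h3, ← mul_assoc]
  exact mul_le_mul_of_nonneg_right h2.le (Real.rpow_nonneg ht'.le _)

theorem norm_deriv_bound {C t : ℝ} (ht : 0 < t) {v : ℂ} (h : ‖v‖ ≤ C * t ^ β) :
    ‖t⁻¹ • v‖ ≤ C * t ^ (β - 1) := by
  rw [norm_smul, norm_inv, Real.norm_of_nonneg ht.le, Real.rpow_sub_one ht.ne',
    inv_mul_eq_div, mul_div_assoc']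
  gcongr

theorem integrate (hg : Decay z₀ r β g) (hβ : 0 < β) (hT : 0 < T)
    (hd : ∀ t ∈ Ioo 0 T, ∀ z ∈ Metric.ball z₀ r, HasDerivAt (fun s => f s z) (t⁻¹ • g t z) t)
    (h0 : ∀ z ∈ Metric.ball z₀ r, Tendsto (fun t => f t z) (𝓝[>] 0) (𝓝 0)) :
    Decay z₀ r β f := by
  obtain ⟨C, hC, hg⟩ := hg
  obtain ⟨τ, hτ, hτ'⟩ := mem_nhdsGT_iff_exists_Ioo_subset.1
    (Filter.inter_mem hg (eventually_pos_lt hT))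
  refine of_le (T := τ) (C := C / β) hτ (by positivity) fun t ht z hz => ?_
  have hsub : ∀ s ∈ Ioc 0 t, s ∈ Ioo 0 τ := fun s hs => ⟨hs.1, hs.2.trans_lt ht.2⟩
  exact norm_le_of_norm_deriv_le_rpow hβ hC ht.1 (fun s hs => hd s (hτ' (hsub s hs)).2 z hz)
    (fun s hs => norm_deriv_bound hs.1 ((hτ' (hsub s hs)).1 z hz)) (h0 z hz)

/-- As in `integrate`, the time derivative is O(t^{β-1}) and integrable at 0. With no initial
condition this still yields a limit, approached at the rate t^β. -/
theorem exists_limit (hg : Decay z₀ r β g) (hβ : 0 < β) (hT : 0 < T)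
    (hd : ∀ t ∈ Ioo 0 T, ∀ z ∈ Metric.ball z₀ r, HasDerivAt (fun s => f s z) (t⁻¹ • g t z) t) :
    ∃ l : ℂ → ℂ, (∀ z ∈ Metric.ball z₀ r, Tendsto (fun t => f t z) (𝓝[>] 0) (𝓝 (l z))) ∧
      Decay z₀ r β (fun t z => f t z - l z) := by
  obtain ⟨C, hC, hg⟩ := hg
  obtain ⟨τ, hτ, hτ'⟩ := mem_nhdsGT_iff_exists_Ioo_subset.1
    (Filter.inter_mem hg (eventually_pos_lt hT))
  have key : ∀ z, ∃ l, z ∈ Metric.ball z₀ r → Tendsto (fun t => f t z) (𝓝[>] 0) (𝓝 l) ∧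
      ∀ t ∈ Ioo 0 τ, ‖f t z - l‖ ≤ C / β * t ^ β := by
    intro z
    by_cases hz : z ∈ Metric.ball z₀ r
    · obtain ⟨l, hl⟩ := exists_limit_of_norm_deriv_le_rpow hβ hC hτ
        (fun s hs => hd s (hτ' hs).2 z hz) (fun s hs => norm_deriv_bound hs.1 ((hτ' hs).1 z hz))
      exact ⟨l, fun _ => hl⟩
    · exact ⟨0, fun h => absurd h hz⟩
  choose l hl using key
  exact ⟨l, fun z hz => (hl z hz).1, of_le (T := τ) (C := C / β) hτ (by positivity)
    fun t ht z hz => (hl z hz).2 t ht⟩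

theorem sq_mul_log {b₀ b₁ : ℂ → ℂ} {B : ℝ} (h₀ : ∀ z ∈ Metric.ball z₀ r, ‖b₀ z‖ ≤ B)
    (h₁ : ∀ z ∈ Metric.ball z₀ r, ‖b₁ z‖ ≤ B) (hB : 0 ≤ B) :
    Decay z₀ r 1 (fun t z => (t : ℂ) ^ 2 * (b₀ z * Real.log t + b₁ z)) :=
  of_le (T := 1) (C := 2 * B) one_pos (by positivity) fun t ht z hz => by
    have := norm_sq_mul_log_le ht.1 ht.2.le (h₀ z hz) (h₁ z hz)
    push_cast at this
    linarith

theorem sq : Decay z₀ r 2 (fun t _ => (t : ℂ) ^ 2) :=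
  of_le (T := 1) (C := 1) one_pos zero_le_one fun t ht z _ => by
    rw [norm_pow, Complex.norm_real, Real.norm_of_nonneg ht.1.le, Real.rpow_two, one_mul]

variable {n : ℕ} {𝔡 : VTDData n} {B : ℝ} {u : Fin n → ℝ → ℂ → ℂ} {I : Fin n}

theorem exists_uniform_bound (hu : ∀ J, Decay z₀ r 0 (u J)) :
    ∃ C : ℝ, ∀ᶠ t in 𝓝[>] (0 : ℝ), ∀ z ∈ Metric.ball z₀ r, ∀ J, ‖u J t z‖ ≤ C := by
  choose C hC hu using hu
  refine ⟨∑ J, C J, ?_⟩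
  filter_upwards [eventually_all.2 hu] with t h1 z hz J
  have h2 := h1 J z hz
  rw [Real.rpow_zero, mul_one] at h2
  exact h2.trans (Finset.single_le_sum (fun J _ => hC J) (Finset.mem_univ J))

theorem exp_S (hk : ∀ z ∈ Metric.ball z₀ r, β ≤ 2 * (𝔡.k I z).re)
    (hs : ∀ z ∈ Metric.ball z₀ r, ‖𝔡.s I z‖ ≤ B) (hu : ∀ J, Decay z₀ r 0 (u J)) :
    Decay z₀ r β (fun t z => Complex.exp (2 * 𝔡.S I t z fun J => u J t z)) := by
  obtain ⟨C, hu⟩ := exists_uniform_bound hu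
  refine ⟨_, (Real.exp_pos (2 * (B + (n + 1) * C))).le, ?_⟩
  filter_upwards [hu, eventually_pos_lt one_pos] with t h1 ht z hz
  rw [mul_comm (Real.exp _)]
  exact VTDData.norm_exp_S_le ht.1 ht.2.le (hk z hz) (hs z hz) (h1 z hz)

theorem exp_neg_S (hk : ∀ z ∈ Metric.ball z₀ r, β ≤ 2 - 2 * (𝔡.k I z).re)
    (hs : ∀ z ∈ Metric.ball z₀ r, ‖𝔡.s I z‖ ≤ B) (hu : ∀ J, Decay z₀ r 0 (u J)) :
    Decay z₀ r β (fun t z => (t : ℂ) ^ 2 * Complex.exp (-2 * 𝔡.S I t z fun J => u J t z)) := by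
  obtain ⟨C, hu⟩ := exists_uniform_bound hu
  refine ⟨_, (Real.exp_pos (2 * (B + (n + 1) * C))).le, ?_⟩
  filter_upwards [hu, eventually_pos_lt one_pos] with t h1 ht z hz
  rw [mul_comm (Real.exp _)]
  have := VTDData.norm_exp_neg_S_le ht.1 ht.2.le (hk z hz) (hs z hz) (h1 z hz)
  push_cast at this
  exact this

end Decay

end Decay

/-! ### Closure properties of holomorphic families -/

section Closure

variable {Ω : Set (ℝ × ℂ)} {f g : ℝ → ℂ → ℂ}

namespace HolFamily

theorem add (hf : HolFamily Ω f) (hg : HolFamily Ω g) : HolFamily Ω (fun t z => f t z + g t z) :=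
  ⟨hf.cont.add hg.cont, fun p hp => (hf.diff p hp).add (hg.diff p hp)⟩

theorem mul (hf : HolFamily Ω f) (hg : HolFamily Ω g) : HolFamily Ω (fun t z => f t z * g t z) :=
  ⟨hf.cont.mul hg.cont, fun p hp => (hf.diff p hp).mul (hg.diff p hp)⟩

theorem cexp (hf : HolFamily Ω f) : HolFamily Ω (fun t z => Complex.exp (f t z)) :=
  ⟨hf.cont.cexp, fun p hp => (hf.diff p hp).cexp⟩

theorem sum {ι : Type*} [Fintype ι] {f : ι → ℝ → ℂ → ℂ} (hf : ∀ i, HolFamily Ω (f i)) :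
    HolFamily Ω (fun t z => ∑ i, f i t z) :=
  ⟨continuousOn_finsetSum _ fun i _ => (hf i).cont,
    fun p hp => DifferentiableAt.fun_sum fun i _ => (hf i).diff p hp⟩

theorem time {a : ℝ → ℂ} (ha : ∀ p ∈ Ω, ContinuousAt a p.1) : HolFamily Ω (fun t _ => a t) :=
  ⟨fun p hp => ((ha p hp).comp continuousAt_fst).continuousWithinAt,
    fun _ _ => differentiableAt_const _⟩

theorem const (c : ℂ) : HolFamily Ω (fun _ _ => c) :=
  time fun _ _ => continuousAt_const

theorem space {h : ℂ → ℂ} (hh : ∀ p ∈ Ω, DifferentiableAt ℂ h p.2) : HolFamily Ω (fun _ z => h z) :=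
  ⟨fun p hp => ((hh p hp).continuousAt.comp continuousAt_snd).continuousWithinAt, hh⟩

end HolFamily

end Closure

/-! ### Complexification of the data -/

section Complexification

/-- The holomorphic extension of a real analytic function to a disc. -/
theorem exists_complexification {f : ℝ → ℝ} {θ₀ : ℝ} (hf : AnalyticAt ℝ f θ₀) :
    ∃ r > 0, ∃ F : ℂ → ℂ, DifferentiableOn ℂ F (Metric.ball (θ₀ : ℂ) r) ∧
      (∀ x : ℝ, (F x).im = 0) ∧ ∀ x ∈ Metric.ball θ₀ r, F (x : ℂ) = (f x : ℂ) := by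
  obtain ⟨p, R, hp⟩ := hf
  set q : FormalMultilinearSeries ℂ ℂ ℂ :=
    FormalMultilinearSeries.ofScalars ℂ (fun n => (p.coeff n : ℂ)) with hq
  have hnorm : ∀ n, ‖q n‖ = ‖p n‖ := fun n => by
    rw [FormalMultilinearSeries.norm_apply_eq_norm_coef,
      FormalMultilinearSeries.norm_apply_eq_norm_coef, FormalMultilinearSeries.coeff_ofScalars,
      Complex.norm_real]
  have hrad : q.radius = p.radius := by simp only [FormalMultilinearSeries.radius, hnorm]
  obtain ⟨r, hr, hrR⟩ := ENNReal.lt_iff_exists_nnreal_btwn.1 hp.r_pos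
  have hr0 : (0 : ℝ) < r := by exact_mod_cast hr
  -- Convergence is not needed: the coercion commutes with `tsum` in any case, so the extension is
  -- real at every real point, also outside the disc.
  have hsum : ∀ x : ℝ, q.sum (x : ℂ) = ((p.sum x : ℝ) : ℂ) := fun x => by
    rw [FormalMultilinearSeries.sum, FormalMultilinearSeries.sum, Complex.ofReal_tsum]
    refine tsum_congr fun n => ?_
    rw [FormalMultilinearSeries.apply_eq_pow_smul_coeff,
      FormalMultilinearSeries.apply_eq_pow_smul_coeff, FormalMultilinearSeries.coeff_ofScalars]
    simp
  have hball : ∀ {E : Type} [PseudoMetricSpace E] (x : E), Metric.ball x r ⊆ Metric.eball x R :=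
    fun x => by
      rw [← Metric.eball_ofReal, ENNReal.ofReal_coe_nnreal]
      exact Metric.eball_subset_eball hrR.le
  refine ⟨r, hr0, fun z => q.sum (z - θ₀), ?_, fun x => ?_, fun x hx => ?_⟩
  · have h1 := (q.hasFPowerSeriesOnBall (hrad ▸ hp.r_pos.trans_le hp.r_le)).differentiableOn
    refine h1.comp (by fun_prop) fun z hz => ?_
    rw [hrad]
    refine Metric.eball_subset_eball hp.r_le (hball _ ?_)
    simpa [dist_eq_norm] using hz
  · have := hsum (x - θ₀)
    push_cast at this
    simp only [this, Complex.ofReal_im]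
  · have h1 := hsum (x - θ₀)
    have h2 := hp.sum (y := x - θ₀) (hball _ (by simpa [dist_eq_norm] using hx))
    push_cast at h1
    rw [add_sub_cancel] at h2
    simp only [h1, h2]

theorem im_deriv_eq_zero_of_forall {f : ℂ → ℂ} (h : ∀ x : ℝ, (f x).im = 0) (x : ℝ) :
    (deriv f x).im = 0 := by
  by_cases hf : DifferentiableAt ℂ f x
  · exact im_deriv_eq_zero hf (Eventually.of_forall h)
  · rw [deriv_zero_of_not_differentiableAt hf, Complex.zero_im]

variable {n : ℕ}

/-- `pc` is a holomorphic extension of the data `p` to the disc of radius `r`. -/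
structure IsComplexification (θ₀ r : ℝ) (pc : Fin n → Fin 2 → ℂ → ℂ) (p : Fin n → Fin 2 → ℝ → ℝ) :
    Prop where
  diff : ∀ I A, DifferentiableOn ℂ (pc I A) (Metric.ball (θ₀ : ℂ) r)
  im : ∀ I A (x : ℝ), (pc I A x).im = 0
  eq : ∀ I A, ∀ x ∈ Ioo (θ₀ - r) (θ₀ + r), pc I A x = (p I A x : ℂ)

theorem IsComplexification.mono {θ₀ r r' : ℝ} {pc : Fin n → Fin 2 → ℂ → ℂ}
    {p : Fin n → Fin 2 → ℝ → ℝ} (h : IsComplexification θ₀ r pc p) (hr : r' ≤ r) :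
    IsComplexification θ₀ r' pc p :=
  ⟨fun I A => (h.diff I A).mono (Metric.ball_subset_ball hr), h.im,
    fun I A x hx => h.eq I A x ⟨by linarith [hx.1], by linarith [hx.2]⟩⟩

theorem exists_isComplexification {θ₀ : ℝ} {p : Fin n → Fin 2 → ℝ → ℝ}
    (hp : ∀ I A, AnalyticAt ℝ (p I A) θ₀) :
    ∃ r > 0, ∃ pc, IsComplexification θ₀ r pc p := by
  choose r hr F hF him heq using fun I A => exists_complexification (hp I A)
  obtain ⟨ρ, hρ, hle⟩ : ∃ ρ > 0, ∀ i : Fin n × Fin 2, ρ ≤ r i.1 i.2 :=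
    ((Filter.eventually_all.2 fun i : Fin n × Fin 2 =>
      (gt_mem_nhds (hr i.1 i.2)).filter_mono nhdsWithin_le_nhds).and
      (self_mem_nhdsWithin (s := Ioi (0 : ℝ)) (a := 0))).exists.imp
      fun ρ h => ⟨h.2, fun i => (h.1 i).le⟩
  refine ⟨ρ, hρ, F, fun I A => (hF I A).mono (Metric.ball_subset_ball (hle (I, A))), him,
    fun I A x hx => heq I A x ?_⟩
  rw [Real.ball_eq_Ioo]
  have := hle (I, A)
  exact ⟨by linarith [hx.1], by linarith [hx.2]⟩

/-- The coefficients of the first order system, in terms of the complexified data. -/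
noncomputable def vtdData (pc qc : Fin n → Fin 2 → ℂ → ℂ) : VTDData n where
  k I z := (∑ J, pc J 0 z) + pc I 0 z
  s I z := (∑ J, pc J 1 z) + pc I 1 z
  b₀ I := deriv (deriv (pc I 0))
  b₁ I := deriv (deriv (pc I 1))
  ξ I := deriv (qc I 0)
  W I z := 2 * ((∑ J, pc J 0 z) + pc I 0 z) * qc I 1 z
    * Complex.exp (-2 * ((∑ J, pc J 1 z) + pc I 1 z))

variable {θ₀ R : ℝ} {p q : Fin n → Fin 2 → ℝ → ℝ} {pc qc : Fin n → Fin 2 → ℂ → ℂ}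

theorem isReal_vtdData (hp : IsComplexification θ₀ R pc p) (hq : IsComplexification θ₀ R qc q) :
    (vtdData pc qc).IsReal := by
  have h1 : ∀ I A (x : ℝ), ((∑ J, pc J A x) + pc I A x).im = 0 := fun I A x => by
    refine im_add_eq_zero ?_ (hp.im I A x)
    rw [Complex.im_sum]
    exact Finset.sum_eq_zero fun J _ => hp.im J A x
  have h2 : (2 : ℂ).im = 0 := rfl
  have h3 : (-2 : ℂ).im = 0 := by simp
  exact
    { k := fun I x => h1 I 0 x
      s := fun I x => h1 I 1 x
      b₀ := fun I x => im_deriv_eq_zero_of_forall (im_deriv_eq_zero_of_forall (hp.im I 0)) x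
      b₁ := fun I x => im_deriv_eq_zero_of_forall (im_deriv_eq_zero_of_forall (hp.im I 1)) x
      ξ := fun I x => im_deriv_eq_zero_of_forall (hq.im I 0) x
      W := fun I x => im_mul_eq_zero (im_mul_eq_zero (im_mul_eq_zero h2 (h1 I 0 x)) (hq.im I 1 x))
        (im_exp_eq_zero (im_mul_eq_zero h3 (h1 I 1 x))) }

theorem exists_bound_near {ι : Type*} [Fintype ι] {g : ι → ℂ → ℂ} {z₀ : ℂ}
    (hg : ∀ i, ContinuousAt (g i) z₀) : ∃ B : ℝ, 0 ≤ B ∧ ∀ᶠ z in 𝓝 z₀, ∀ i, ‖g i z‖ ≤ B := by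
  refine ⟨∑ i, (‖g i z₀‖ + 1), by positivity, ?_⟩
  rw [eventually_all]
  intro i
  filter_upwards [(hg i).norm.eventually (gt_mem_nhds (lt_add_one _))] with z hz
  exact hz.le.trans (Finset.single_le_sum (f := fun i => ‖g i z₀‖ + 1)
    (fun i _ => by positivity) (Finset.mem_univ i))

theorem kExp_eq_re (hp : IsComplexification θ₀ R pc p) (I : Fin n) {x : ℝ}
    (hx : x ∈ Ioo (θ₀ - R) (θ₀ + R)) :
    (vtdData pc qc).k I x = (kExp p I x : ℂ) := by
  simp only [vtdData, kExp, hp.eq _ _ x hx]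
  push_cast
  rfl

/-- The strict inequalities at θ₀ persist on a small complex disc by continuity of Re k. All smaller
radii are allowed with the same B, because the uniqueness proof shrinks the disc to the domains of
the given solutions. -/
theorem exists_bounded_vtdData (hR : 0 < R) (hp : IsComplexification θ₀ R pc p)
    (hq : IsComplexification θ₀ R qc q) {e : Fin n → ℝ} {μ : ℝ} (hμ : 0 < μ) (hμe : ∀ I, μ ≤ e I)
    (hk : ∀ I, e I + 2 * μ < 2 * kExp p I θ₀) (hk' : ∀ I, e I + 2 * μ < 2 - 2 * kExp p I θ₀) :
    ∃ B, ∃ ρ₀ > 0, 2 * ρ₀ ≤ R ∧ ∀ ρ, 0 < ρ → ρ ≤ ρ₀ →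
      (vtdData pc qc).Bounded θ₀ ρ B e μ ∧
      ∀ I, ∀ z ∈ Metric.ball (θ₀ : ℂ) (2 * ρ), ‖qc I 1 z‖ ≤ B := by
  have hsum : ∀ I A, DifferentiableOn ℂ (fun z => (∑ J, pc J A z) + pc I A z)
      (Metric.ball (θ₀ : ℂ) R) := fun I A =>
    (DifferentiableOn.fun_sum fun J _ => hp.diff J A).add (hp.diff I A)
  have hb : ∀ I A, DifferentiableOn ℂ (deriv (deriv (pc I A))) (Metric.ball (θ₀ : ℂ) R) :=
    fun I A => ((hp.diff I A).deriv Metric.isOpen_ball).deriv Metric.isOpen_ball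
  have hξ : ∀ I, DifferentiableOn ℂ (deriv (qc I 0)) (Metric.ball (θ₀ : ℂ) R) :=
    fun I => (hq.diff I 0).deriv Metric.isOpen_ball
  have hW : ∀ I, DifferentiableOn ℂ ((vtdData pc qc).W I) (Metric.ball (θ₀ : ℂ) R) := fun I =>
    (((hsum I 0).const_mul 2).mul (hq.diff I 1)).mul ((hsum I 1).const_mul (-2)).cexp
  have hmem : Metric.ball (θ₀ : ℂ) R ∈ 𝓝 (θ₀ : ℂ) := Metric.ball_mem_nhds _ hR
  have hc : ∀ {g : ℂ → ℂ}, DifferentiableOn ℂ g (Metric.ball (θ₀ : ℂ) R) →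
      ContinuousAt g (θ₀ : ℂ) := fun hg => hg.continuousOn.continuousAt hmem
  obtain ⟨B₁, hB₁, h₁⟩ := exists_bound_near fun I => hc (hsum I 1)
  obtain ⟨B₂, hB₂, h₂⟩ := exists_bound_near fun I => hc (hb I 0)
  obtain ⟨B₃, hB₃, h₃⟩ := exists_bound_near fun I => hc (hb I 1)
  obtain ⟨B₄, hB₄, h₄⟩ := exists_bound_near fun I => hc (hξ I)
  obtain ⟨B₅, hB₅, h₅⟩ := exists_bound_near fun I => hc (hW I)
  obtain ⟨B₆, hB₆, h₆⟩ := exists_bound_near fun I => hc (hq.diff I 1)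
  have hθ : θ₀ ∈ Ioo (θ₀ - R) (θ₀ + R) := ⟨by linarith, by linarith⟩
  have hkc : ∀ I, ContinuousAt (fun z => ((vtdData pc qc).k I z).re) (θ₀ : ℂ) := fun I =>
    Complex.continuous_re.continuousAt.comp (hc (hsum I 0))
  have hk₀ : ∀ I, ((vtdData pc qc).k I θ₀).re = kExp p I θ₀ := fun I => by
    rw [kExp_eq_re hp I hθ, Complex.ofReal_re]
  have h₇ : ∀ᶠ z in 𝓝 (θ₀ : ℂ), ∀ I, e I + 2 * μ < 2 * ((vtdData pc qc).k I z).re ∧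
      e I + 2 * μ < 2 - 2 * ((vtdData pc qc).k I z).re := by
    refine eventually_all.2 fun I => ?_
    refine (((hkc I).const_mul 2).eventually (lt_mem_nhds ?_)).and
      ((((hkc I).const_mul 2).const_sub 2).eventually (lt_mem_nhds ?_))
    · simpa only [hk₀] using hk I
    · simpa only [hk₀] using hk' I
  obtain ⟨σ, hσ, hball⟩ := Metric.eventually_nhds_iff_ball.1
    (h₁.and (h₂.and (h₃.and (h₄.and (h₅.and (h₆.and h₇))))))
  refine ⟨B₁ + B₂ + B₃ + B₄ + B₅ + B₆, min 1 (min σ R / 2), by positivity, ?_, fun ρ hρ hle => ?_⟩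
  · linarith [min_le_right (1 : ℝ) (min σ R / 2), min_le_right σ R]
  · have h2ρ : 2 * ρ ≤ min σ R := by linarith [min_le_right (1 : ℝ) (min σ R / 2)]
    have hsub : Metric.ball (θ₀ : ℂ) (2 * ρ) ⊆ Metric.ball (θ₀ : ℂ) R :=
      Metric.ball_subset_ball (h2ρ.trans (min_le_right _ _))
    have key := fun z hz => hball z (Metric.ball_subset_ball (h2ρ.trans (min_le_left _ _)) hz)
    refine ⟨?_, fun I z hz => ?_⟩
    · exact
      { ρ_pos := hρ
        ρ_le := hle.trans (min_le_left _ _)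
        μ_pos := hμ
        μ_le_e := hμe
        -- The mean of the two upper bounds 2k and 2 - 2k is 1.
        e_le := fun I => by linarith [hk I, hk' I]
        B_nonneg := by positivity
        hk := fun I => (hsum I 0).mono hsub
        hs := fun I => (hsum I 1).mono hsub
        hb₀ := fun I => (hb I 0).mono hsub
        hb₁ := fun I => (hb I 1).mono hsub
        hξ := fun I => (hξ I).mono hsub
        hW := fun I => (hW I).mono hsub
        s_le := fun I z hz => by
          have := (key z hz).1 I
          simp only [vtdData]
          linarith
        b₀_le := fun I z hz => by
          have := (key z hz).2.1 I
          simp only [vtdData]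
          linarith
        b₁_le := fun I z hz => by
          have := (key z hz).2.2.1 I
          simp only [vtdData]
          linarith
        ξ_le := fun I z hz => by
          have := (key z hz).2.2.2.1 I
          simp only [vtdData]
          linarith
        W_le := fun I z hz => by
          have := (key z hz).2.2.2.2.1 I
          linarith
        le_k := fun I z hz => ((key z hz).2.2.2.2.2.2 I).1.le
        k_le := fun I z hz => ((key z hz).2.2.2.2.2.2 I).2.le }
    · have := (key z hz).2.2.2.2.2.1 I
      linarith

end Complexification

/-! ### The operator t ∂ₜ on complexified families -/

section Euler

/-- `(0, T) × B(θ₀, r)`, with the complex disc `B(θ₀, r)`. -/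
abbrev cylinder (θ₀ T r : ℝ) : Set (ℝ × ℂ) :=
  Ioo 0 T ×ˢ Metric.ball (θ₀ : ℂ) r

theorem isOpen_cylinder {θ₀ T r : ℝ} : IsOpen (cylinder θ₀ T r) :=
  isOpen_Ioo.prod Metric.isOpen_ball

/-- `t ∂ₜ F = G` on `Ω`. -/
def HasEuler (Ω : Set (ℝ × ℂ)) (F G : ℝ → ℂ → ℂ) : Prop :=
  ∀ p ∈ Ω, HasDerivAt (fun s => F s p.2) (p.1⁻¹ • G p.1 p.2) p.1

variable {Ω : Set (ℝ × ℂ)} {f g f' g' : ℝ → ℂ → ℂ}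

namespace HasEuler

theorem congr_right (h : HasEuler Ω f f') (h' : ∀ p ∈ Ω, g' p.1 p.2 = f' p.1 p.2) :
    HasEuler Ω f g' := fun p hp => by
  rw [h' p hp]; exact h p hp

theorem congr_left (h : HasEuler Ω f f') (hΩ : IsOpen Ω) (h' : ∀ p ∈ Ω, g p.1 p.2 = f p.1 p.2) :
    HasEuler Ω g f' := fun p hp =>
  (h p hp).congr_of_eventuallyEq <| by
    have : Tendsto (fun s : ℝ => (s, p.2)) (𝓝 p.1) (𝓝 p) := by
      refine Continuous.tendsto' (by fun_prop) _ _ rfl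
    filter_upwards [this (hΩ.mem_nhds hp)] with s hs using h' _ hs

theorem add (hf : HasEuler Ω f f') (hg : HasEuler Ω g g') :
    HasEuler Ω (fun t z => f t z + g t z) (fun t z => f' t z + g' t z) := fun p hp =>
  ((hf p hp).add (hg p hp)).congr_deriv (smul_add _ _ _).symm

theorem sub (hf : HasEuler Ω f f') (hg : HasEuler Ω g g') :
    HasEuler Ω (fun t z => f t z - g t z) (fun t z => f' t z - g' t z) := fun p hp =>
  ((hf p hp).sub (hg p hp)).congr_deriv (smul_sub _ _ _).symm

theorem mul (hf : HasEuler Ω f f') (hg : HasEuler Ω g g') :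
    HasEuler Ω (fun t z => f t z * g t z) (fun t z => f' t z * g t z + f t z * g' t z) :=
  fun p hp => ((hf p hp).mul (hg p hp)).congr_deriv (by
    rw [smul_add, smul_mul_assoc, mul_smul_comm])

theorem sum {ι : Type*} [Fintype ι] {f f' : ι → ℝ → ℂ → ℂ} (h : ∀ i, HasEuler Ω (f i) (f' i)) :
    HasEuler Ω (fun t z => ∑ i, f i t z) (fun t z => ∑ i, f' i t z) := fun p hp => by
  rw [Finset.smul_sum]
  exact HasDerivAt.fun_sum fun i _ => h i p hp

theorem cexp (hf : HasEuler Ω f f') :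
    HasEuler Ω (fun t z => Complex.exp (f t z)) (fun t z => Complex.exp (f t z) * f' t z) :=
  fun p hp => (hf p hp).cexp.congr_deriv (mul_smul_comm _ _ _)

theorem space (h : ℂ → ℂ) : HasEuler Ω (fun _ z => h z) (fun _ _ => 0) := fun p _ => by
  rw [smul_zero]; exact hasDerivAt_const _ _

theorem const_mul (c : ℂ) (hf : HasEuler Ω f f') :
    HasEuler Ω (fun t z => c * f t z) (fun t z => c * f' t z) := fun p hp =>
  ((hf p hp).const_mul c).congr_deriv (mul_smul_comm _ _ _)

theorem log (hΩ : ∀ p ∈ Ω, 0 < p.1) :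
    HasEuler Ω (fun t _ => (Real.log t : ℂ)) (fun _ _ => 1) := fun p hp =>
  (Real.hasDerivAt_log (hΩ p hp).ne').ofReal_comp.congr_deriv (by
    rw [Complex.real_smul, mul_one])

theorem mul_log (hΩ : ∀ p ∈ Ω, 0 < p.1) (h : ℂ → ℂ) :
    HasEuler Ω (fun t z => h z * Real.log t) (fun _ z => h z) :=
  ((space h).mul (log hΩ)).congr_right fun p _ => by ring

theorem of_hasDerivAt (hΩ : ∀ p ∈ Ω, 0 < p.1)
    (h : ∀ p ∈ Ω, HasDerivAt (fun s => f s p.2) (g p.1 p.2) p.1) :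
    HasEuler Ω f (fun t z => t * g t z) := fun p hp =>
  (h p hp).congr_deriv (by
    have : (p.1 : ℂ) ≠ 0 := Complex.ofReal_ne_zero.2 (hΩ p hp).ne'
    rw [Complex.real_smul, Complex.ofReal_inv, inv_mul_cancel_left₀ this])

theorem ofReal (hΩ : ∀ p ∈ Ω, 0 < p.1) : HasEuler Ω (fun t _ => (t : ℂ)) (fun t _ => t) :=
  (of_hasDerivAt (g := fun _ _ => 1) hΩ fun p _ =>
    (hasDerivAt_id p.1).ofReal_comp).congr_right fun _ _ => (mul_one _).symm

theorem deriv_z (hΩ : IsOpen Ω) (hpos : ∀ p ∈ Ω, 0 < p.1) (hf : HolFamily Ω f)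
    (hf' : HolFamily Ω f') (h : HasEuler Ω f f') :
    HasEuler Ω (fun t => deriv (f t)) (fun t => deriv (f' t)) := by
  have hc : HolFamily Ω (fun t z => ((t⁻¹ : ℝ) : ℂ) * f' t z) :=
    (HolFamily.time fun p hp => Complex.continuous_ofReal.continuousAt.comp
      (continuousAt_inv₀ (hpos p hp).ne')).mul hf'
  intro p hp
  refine ((HolFamily.deriv_t hΩ hf.diff hc.cont fun p hp => ?_).2 p hp).congr_deriv ?_
  · exact (h p hp).congr_deriv Complex.real_smul
  · rw [deriv_const_mul_field, Complex.real_smul]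

end HasEuler

theorem pos_of_mem_cylinder {θ₀ T r : ℝ} : ∀ p ∈ cylinder θ₀ T r, 0 < p.1 :=
  fun _ hp => hp.1.1

theorem eq_zero_of_hasEuler_zero {θ₀ T r : ℝ} (h : HasEuler (cylinder θ₀ T r) f (fun _ _ => 0))
    (h0 : ∀ z ∈ Metric.ball (θ₀ : ℂ) r, Tendsto (fun t => f t z) (𝓝[>] 0) (𝓝 0)) :
    ∀ p ∈ cylinder θ₀ T r, f p.1 p.2 = 0 := fun p hp => by
  have := norm_le_of_norm_deriv_le_rpow (b := 1) (C := 0) one_pos le_rfl hp.1.1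
    (fun s hs => h (s, p.2) ⟨⟨hs.1, hs.2.trans_lt hp.1.2⟩, hp.2⟩) (fun s _ => by simp) (h0 _ hp.2)
  simpa using this

end Euler

/-! ### Passing between real functions and their extensions -/

section Extension

variable {θ₀ T r : ℝ}

/-- `F` restricts to `f` on `(0, T) × (θ₀ - r, θ₀ + r)`. -/
def Extends (θ₀ T r : ℝ) (f : ℝ → ℝ → ℝ) (F : ℝ → ℂ → ℂ) : Prop :=
  ∀ t ∈ Ioo 0 T, ∀ θ ∈ Ioo (θ₀ - r) (θ₀ + r), F t (θ : ℂ) = (f t θ : ℂ)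

theorem ofReal_mem_ball {θ : ℝ} :
    (θ : ℂ) ∈ Metric.ball (θ₀ : ℂ) r ↔ θ ∈ Ioo (θ₀ - r) (θ₀ + r) := by
  rw [← Real.ball_eq_Ioo, Metric.mem_ball, Metric.mem_ball, Complex.dist_of_im_eq] <;> simp

theorem eq_ofReal_deriv {F : ℝ → ℂ} {f : ℝ → ℝ} {G : ℂ} {t : ℝ} (h : HasDerivAt F G t)
    (hf : ∀ᶠ s in 𝓝 t, F s = (f s : ℂ)) :
    HasDerivAt f (deriv f t) t ∧ G = ((deriv f t : ℝ) : ℂ) := by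
  have h1 : HasDerivAt f G.re t :=
    (Complex.reCLM.hasFDerivAt.comp_hasDerivAt t h).congr_of_eventuallyEq
      (hf.mono fun s hs => by simp [hs])
  have h2 : HasDerivAt (fun _ : ℝ => (0 : ℝ)) G.im t :=
    (Complex.imCLM.hasFDerivAt.comp_hasDerivAt t h).congr_of_eventuallyEq
      (hf.mono fun s hs => by simp [hs])
  have h3 : G.im = 0 := h2.unique (hasDerivAt_const t 0)
  rw [h1.deriv]
  exact ⟨h1, Complex.ext (by simp) (by simp [h3])⟩

variable {f : ℝ → ℝ → ℝ} {F G : ℝ → ℂ → ℂ}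

namespace Extends

theorem hasDerivAt_time (hf : Extends θ₀ T r f F) (h : HasEuler (cylinder θ₀ T r) F G) {t θ : ℝ}
    (ht : t ∈ Ioo 0 T) (hθ : θ ∈ Ioo (θ₀ - r) (θ₀ + r)) :
    HasDerivAt (fun s => f s θ) (deriv (fun s => f s θ) t) t ∧ G t θ = (eulerD f t θ : ℂ) := by
  obtain ⟨h1, h2⟩ := eq_ofReal_deriv (f := fun s => f s θ)
    (h (t, θ) ⟨ht, ofReal_mem_ball.2 hθ⟩) <| by
    filter_upwards [isOpen_Ioo.mem_nhds ht] with s hs using hf s hs θ hθ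
  refine ⟨h1, ?_⟩
  have : (t : ℂ) ≠ 0 := Complex.ofReal_ne_zero.2 ht.1.ne'
  rw [eulerD, Complex.ofReal_mul, ← h2, Complex.real_smul, Complex.ofReal_inv,
    mul_inv_cancel_left₀ this]

theorem eulerD (hf : Extends θ₀ T r f F) (h : HasEuler (cylinder θ₀ T r) F G) :
    Extends θ₀ T r (eulerD f) G := fun _ ht _ hθ => (hf.hasDerivAt_time h ht hθ).2

theorem dTheta (hf : Extends θ₀ T r f F) (h : HolFamily (cylinder θ₀ T r) F) :
    Extends θ₀ T r (dTheta f) (fun t => deriv (F t)) := fun t ht θ hθ =>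
  (eq_ofReal_deriv (h.diff (t, θ) ⟨ht, ofReal_mem_ball.2 hθ⟩).hasDerivAt.comp_ofReal <| by
    filter_upwards [isOpen_Ioo.mem_nhds hθ] with s hs using hf t ht s hs).2

theorem sumPlus {n : ℕ} {P : Fin n → ℝ → ℝ → ℝ} {F : Fin n → ℝ → ℂ → ℂ}
    (h : ∀ I, Extends θ₀ T r (P I) (F I)) (I : Fin n) :
    Extends θ₀ T r (sumPlus P I) (fun t z => (∑ J, F J t z) + F I t z) := fun t ht θ hθ => by
  simp only [fun J => h J t ht θ hθ, _root_.sumPlus]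
  push_cast
  rfl

theorem contDiffOn (hf : Extends θ₀ T r f F)
    (hF : ContDiffOn ℝ 2 (Function.uncurry F) (cylinder θ₀ T r)) :
    ContDiffOn ℝ 2 (Function.uncurry f) (Ioo 0 T ×ˢ Ioo (θ₀ - r) (θ₀ + r)) := by
  have h1 : ContDiff ℝ 2 (fun p : ℝ × ℝ => (p.1, (p.2 : ℂ))) :=
    contDiff_fst.prodMk (Complex.ofRealCLM.contDiff.comp contDiff_snd)
  refine (Complex.reCLM.contDiff.comp_contDiffOn (hF.comp h1.contDiffOn (s := Ioo 0 T ×ˢ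
    Ioo (θ₀ - r) (θ₀ + r)) fun p hp => ⟨hp.1, ofReal_mem_ball.2 hp.2⟩)).congr fun p hp => ?_
  have := hf p.1 hp.1 p.2 hp.2
  simp [Function.uncurry, this]

end Extends

/-- Two holomorphic functions on a disc that agree at the real points are equal. -/
theorem eqOn_ball_of_real {f g : ℂ → ℂ} (hf : DifferentiableOn ℂ f (Metric.ball (θ₀ : ℂ) r))
    (hg : DifferentiableOn ℂ g (Metric.ball (θ₀ : ℂ) r))
    (h : ∀ θ ∈ Ioo (θ₀ - r) (θ₀ + r), f (θ : ℂ) = g θ) : EqOn f g (Metric.ball (θ₀ : ℂ) r) := by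
  intro z hz
  have hr : 0 < r := Metric.pos_of_mem_ball hz
  refine (hf.analyticOnNhd Metric.isOpen_ball).eqOn_of_preconnected_of_frequently_eq
    (hg.analyticOnNhd Metric.isOpen_ball) (convex_ball _ _).isPreconnected
    (Metric.mem_ball_self hr) ?_ hz
  have h1 : Tendsto (fun x : ℝ => (x : ℂ)) (𝓝[≠] θ₀) (𝓝[≠] (θ₀ : ℂ)) :=
    tendsto_nhdsWithin_iff.2 ⟨Complex.continuous_ofReal.continuousAt.mono_left nhdsWithin_le_nhds,
      eventually_mem_nhdsWithin.mono fun x hx => by simpa using hx⟩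
  refine h1.frequently (Eventually.frequently ?_)
  filter_upwards [nhdsWithin_le_nhds (isOpen_Ioo.mem_nhds
    (show θ₀ ∈ Ioo (θ₀ - r) (θ₀ + r) from ⟨by linarith, by linarith⟩))] with θ hθ using h θ hθ

end Extension

/-! ### The complexified field equations -/

section Fields

variable {n : ℕ}

/-- Complexified fields `P`, `Q` with their first and second derivatives `𝒟`, `𝒟²`. -/
structure FieldFamily (n : ℕ) where
  /-- the fields `P` -/
  P : Fin n → ℝ → ℂ → ℂ
  /-- the derivatives `𝒟 P` -/
  DP : Fin n → ℝ → ℂ → ℂ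
  /-- the derivatives `𝒟² P` -/
  DDP : Fin n → ℝ → ℂ → ℂ
  /-- the fields `Q` -/
  Q : Fin n → ℝ → ℂ → ℂ
  /-- the derivatives `𝒟 Q` -/
  DQ : Fin n → ℝ → ℂ → ℂ
  /-- the derivatives `𝒟² Q` -/
  DDQ : Fin n → ℝ → ℂ → ℂ

namespace FieldFamily

variable (F : FieldFamily n)

/-- The sum `P + P_I`. -/
noncomputable def S (I : Fin n) (t : ℝ) (z : ℂ) : ℂ := (∑ J, F.P J t z) + F.P I t z

/-- The derivative `𝒟 (P + P_I)`. -/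
noncomputable def DS (I : Fin n) (t : ℝ) (z : ℂ) : ℂ := (∑ J, F.DP J t z) + F.DP I t z

/-- The families are holomorphic in space and related as their names say. -/
structure Regular (Ω : Set (ℝ × ℂ)) : Prop where
  P : ∀ I, HolFamily Ω (F.P I)
  DP : ∀ I, HolFamily Ω (F.DP I)
  DDP : ∀ I, HolFamily Ω (F.DDP I)
  Q : ∀ I, HolFamily Ω (F.Q I)
  DQ : ∀ I, HolFamily Ω (F.DQ I)
  DDQ : ∀ I, HolFamily Ω (F.DDQ I)
  euler_P : ∀ I, HasEuler Ω (F.P I) (F.DP I)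
  euler_DP : ∀ I, HasEuler Ω (F.DP I) (F.DDP I)
  euler_Q : ∀ I, HasEuler Ω (F.Q I) (F.DQ I)
  euler_DQ : ∀ I, HasEuler Ω (F.DQ I) (F.DDQ I)

/-- The complexified field equations at a point. -/
def SolvesAt (I : Fin n) (t : ℝ) (z : ℂ) : Prop :=
  F.DDP I t z - t ^ 2 * deriv (deriv (F.P I t)) z
      = -(1 / 2) * Complex.exp (-2 * F.S I t z)
        * (F.DQ I t z ^ 2 - (t * deriv (F.Q I t) z) ^ 2) ∧
  F.DDQ I t z - t ^ 2 * deriv (deriv (F.Q I t)) z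
      = 2 * (F.DS I t z * F.DQ I t z
        - t ^ 2 * (deriv (F.S I t) z * deriv (F.Q I t) z))

variable {F} {θ₀ T r : ℝ} {Ω : Set (ℝ × ℂ)} {P Q : Fin n → ℝ → ℝ → ℝ}

namespace Regular

theorem S (h : F.Regular Ω) (I : Fin n) : HolFamily Ω (F.S I) :=
  (HolFamily.sum h.P).add (h.P I)

theorem DS (h : F.Regular Ω) (I : Fin n) : HolFamily Ω (F.DS I) :=
  (HolFamily.sum h.DP).add (h.DP I)

theorem euler_S (h : F.Regular Ω) (I : Fin n) : HasEuler Ω (F.S I) (F.DS I) :=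
  (HasEuler.sum h.euler_P).add (h.euler_P I)

/-- The real field equations at a real point. -/
theorem solvesAt_iff (h : F.Regular (cylinder θ₀ T r)) (hP : ∀ I, Extends θ₀ T r (P I) (F.P I))
    (hQ : ∀ I, Extends θ₀ T r (Q I) (F.Q I)) {t θ : ℝ} (ht : t ∈ Ioo 0 T)
    (hθ : θ ∈ Ioo (θ₀ - r) (θ₀ + r)) (I : Fin n) :
    F.SolvesAt I t θ ↔
      (eulerD (eulerD (P I)) t θ - t ^ 2 * dTheta (dTheta (P I)) t θ
        = -(1 / 2) * Real.exp (-2 * sumPlus P I t θ)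
            * ((eulerD (Q I) t θ) ^ 2 - (t * dTheta (Q I) t θ) ^ 2) ∧
      eulerD (eulerD (Q I)) t θ - t ^ 2 * dTheta (dTheta (Q I)) t θ
        = 2 * (eulerD (sumPlus P I) t θ * eulerD (Q I) t θ
            - t ^ 2 * (dTheta (sumPlus P I) t θ * dTheta (Q I) t θ))) := by
  have hS : Extends θ₀ T r (sumPlus P I) (F.S I) := Extends.sumPlus hP I
  have h1 := ((hP I).eulerD (h.euler_P I)).eulerD (h.euler_DP I) t ht θ hθ
  have h2 := ((hP I).dTheta (h.P I)).dTheta ((h.P I).deriv_z isOpen_cylinder) t ht θ hθ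
  have h3 := ((hQ I).eulerD (h.euler_Q I)).eulerD (h.euler_DQ I) t ht θ hθ
  have h4 := ((hQ I).dTheta (h.Q I)).dTheta ((h.Q I).deriv_z isOpen_cylinder) t ht θ hθ
  have h5 := (hQ I).eulerD (h.euler_Q I) t ht θ hθ
  have h6 := (hQ I).dTheta (h.Q I) t ht θ hθ
  have h7 := hS.eulerD (h.euler_S I) t ht θ hθ
  have h8 := hS.dTheta (h.S I) t ht θ hθ
  have h9 := hS t ht θ hθ
  beta_reduce at h2 h4 h6 h8
  rw [SolvesAt, h1, h2, h3, h4, h5, h6, h7, h8, h9]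
  refine and_congr ?_ ?_
  · rw [← Complex.ofReal_inj]; push_cast; rfl
  · rw [← Complex.ofReal_inj]; push_cast; rfl

/-- Holomorphic fields that solve the real equations solve the complexified ones. -/
theorem solvesAt_of_real (h : F.Regular (cylinder θ₀ T r))
    (hs : ∀ t ∈ Ioo 0 T, ∀ θ ∈ Ioo (θ₀ - r) (θ₀ + r), ∀ I, F.SolvesAt I t (θ : ℂ)) :
    ∀ p ∈ cylinder θ₀ T r, ∀ I, F.SolvesAt I p.1 p.2 := by
  rintro ⟨t, z⟩ ⟨ht, hz⟩ I
  have hsl : ∀ {f : ℝ → ℂ → ℂ}, HolFamily (cylinder θ₀ T r) f →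
      DifferentiableOn ℂ (f t) (Metric.ball (θ₀ : ℂ) r) := fun hf => hf.slice fun w hw => ⟨ht, hw⟩
  have hd : ∀ {f : ℝ → ℂ → ℂ}, HolFamily (cylinder θ₀ T r) f →
      HolFamily (cylinder θ₀ T r) fun t => deriv (f t) := fun hf => hf.deriv_z isOpen_cylinder
  constructor
  · exact eqOn_ball_of_real
      ((hsl (h.DDP I)).sub ((hsl (hd (hd (h.P I)))).const_mul ((t : ℂ) ^ 2)))
      ((((hsl (h.S I)).const_mul (-2)).cexp.const_mul (-(1 / 2))).mul
        (((hsl (h.DQ I)).pow 2).sub (((hsl (hd (h.Q I))).const_mul (t : ℂ)).pow 2)))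
      (fun θ hθ => (hs t ht θ hθ I).1) hz
  · exact eqOn_ball_of_real
      ((hsl (h.DDQ I)).sub ((hsl (hd (hd (h.Q I)))).const_mul ((t : ℂ) ^ 2)))
      ((((hsl (h.DS I)).mul (hsl (h.DQ I))).sub
        (((hsl (hd (h.S I))).mul (hsl (hd (h.Q I)))).const_mul ((t : ℂ) ^ 2))).const_mul 2)
      (fun θ hθ => (hs t ht θ hθ I).2) hz

end Regular

end FieldFamily

end Fields

/-! ### Powers of t with variable complex exponent -/

section Powers

/-- `t ^ k(z)`. -/
noncomputable def powFamily (k : ℂ → ℂ) (t : ℝ) (z : ℂ) : ℂ := Complex.exp (k z * Real.log t)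

variable {θ₀ T r β : ℝ} {Ω : Set (ℝ × ℂ)} {k : ℂ → ℂ}

theorem cexp_mul_log {t : ℝ} (ht : 0 < t) (a : ℝ) :
    Complex.exp (a * Real.log t) = ((t ^ a : ℝ) : ℂ) := by
  rw [Real.rpow_def_of_pos ht, Complex.ofReal_exp, Complex.ofReal_mul, mul_comm]

theorem norm_powFamily {t : ℝ} (ht : 0 < t) (k : ℂ → ℂ) (z : ℂ) :
    ‖powFamily k t z‖ = t ^ (k z).re := by
  rw [powFamily, Complex.norm_exp, Real.rpow_def_of_pos ht, Complex.re_mul_ofReal, mul_comm]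

theorem powFamily_neg_mul (k : ℂ → ℂ) (t : ℝ) (z : ℂ) :
    powFamily (fun z => -k z) t z * powFamily k t z = 1 := by
  rw [powFamily, powFamily, ← Complex.exp_add, neg_mul, neg_add_cancel, Complex.exp_zero]

theorem HasEuler.powFamily (hΩ : ∀ p ∈ Ω, 0 < p.1) (k : ℂ → ℂ) :
    HasEuler Ω (powFamily k) (fun t z => powFamily k t z * k z) :=
  (HasEuler.mul_log hΩ k).cexp

theorem HolFamily.powFamily (hΩ : ∀ p ∈ Ω, 0 < p.1) (hk : ∀ p ∈ Ω, DifferentiableAt ℂ k p.2) :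
    HolFamily Ω (powFamily k) :=
  ((HolFamily.space hk).mul (.time fun p hp => Complex.continuous_ofReal.continuousAt.comp
    (Real.continuousAt_log (hΩ p hp).ne'))).cexp

theorem HolFamily.log (hΩ : ∀ p ∈ Ω, 0 < p.1) : HolFamily Ω (fun t _ => (Real.log t : ℂ)) :=
  .time fun p hp => Complex.continuous_ofReal.continuousAt.comp
    (Real.continuousAt_log (hΩ p hp).ne')

theorem HolFamily.ofReal : HolFamily Ω (fun t _ => (t : ℂ)) :=
  .time fun _ _ => Complex.continuous_ofReal.continuousAt

/-- Regularity in terms of the Euler operator. -/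
theorem contDiffOn_of_hasEuler {f g h : ℝ → ℂ → ℂ} (hΩ : IsOpen Ω) (hpos : ∀ p ∈ Ω, 0 < p.1)
    (hf : HolFamily Ω f) (hg : HolFamily Ω g) (hh : HolFamily Ω h) (hfg : HasEuler Ω f g)
    (hgh : HasEuler Ω g h) : ContDiffOn ℝ 2 (Function.uncurry f) Ω := by
  have hinv : HolFamily Ω (fun t _ => ((t⁻¹ : ℝ) : ℂ)) :=
    .time fun p hp => Complex.continuous_ofReal.continuousAt.comp
      (continuousAt_inv₀ (hpos p hp).ne')
  refine HolFamily.contDiffOn_two (g := fun t z => ((t⁻¹ : ℝ) : ℂ) * g t z)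
    (k := fun t z => -(((t⁻¹ : ℝ) : ℂ) * ((t⁻¹ : ℝ) : ℂ)) * g t z
      + ((t⁻¹ : ℝ) : ℂ) * (((t⁻¹ : ℝ) : ℂ) * h t z)) hΩ hf
    (fun p hp => (hfg p hp).congr_deriv Complex.real_smul) (fun p hp => ?_) (hinv.mul hg).cont
    (((((hinv.mul hinv).cont).neg).mul hg.cont).add ((hinv.mul (hinv.mul hh)).cont))
  have h1 := (hasDerivAt_inv (hpos p hp).ne').ofReal_comp
  refine (h1.mul (hgh p hp)).congr_deriv ?_
  rw [Complex.real_smul]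
  push_cast
  field_simp

namespace Decay

variable {z₀ : ℂ} {g V : ℝ → ℂ → ℂ}

theorem exp_sub_one (h : Decay z₀ r β g) (hβ : 0 < β) :
    Decay z₀ r β (fun t z => Complex.exp (g t z) - 1) := by
  obtain ⟨C, hC, hg⟩ := h
  -- From |e^v - 1| ≤ 2|v| for |v| ≤ 1, which applies once C t^β < 1.
  refine ⟨2 * C, by positivity, ?_⟩
  filter_upwards [hg, eventually_mul_rpow_lt (C := C) hβ one_pos] with t h1 h2 z hz
  have h3 := h1 z hz
  refine (Complex.norm_exp_sub_one_le (h3.trans h2.le)).trans ?_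
  linarith

/-- Integration of `𝒟 V = t ^ k g`. -/
theorem integrate_pow (hg : Decay z₀ r β g) (hβ : 0 < β) (hT : 0 < T)
    (hk : ∀ z ∈ Metric.ball z₀ r, 0 ≤ (k z).re)
    (hd : ∀ t ∈ Ioo 0 T, ∀ z ∈ Metric.ball z₀ r,
      HasDerivAt (fun s => V s z) (t⁻¹ • (powFamily k t z * g t z)) t)
    (h0 : ∀ z ∈ Metric.ball z₀ r, Tendsto (fun t => V t z) (𝓝[>] 0) (𝓝 0)) :
    Decay z₀ r β (fun t z => powFamily (fun z => -k z) t z * V t z) := by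
  obtain ⟨C, hC, hg⟩ := hg
  obtain ⟨τ, hτ, hτ'⟩ := mem_nhdsGT_iff_exists_Ioo_subset.1
    (Filter.inter_mem hg (eventually_pos_lt hT))
  have hτ0 : (0 : ℝ) < τ := hτ
  refine of_le (T := τ) (C := C / β) hτ (by positivity) fun t ht z hz => ?_
  have hsub : ∀ s ∈ Ioc 0 t, s ∈ Ioo 0 τ := fun s hs => ⟨hs.1, hs.2.trans_lt ht.2⟩
  -- The exponent Re k(z) + β varies with z. The resulting constants C/(Re k(z) + β) are at most C/β
  -- because Re k ≥ 0, which makes the bound uniform.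
  have hb : 0 < (k z).re + β := by linarith [hk z hz]
  have h1 := norm_le_of_norm_deriv_le_rpow (b := (k z).re + β) (C := C) hb hC ht.1
    (fun s hs => hd s (hτ' (hsub s hs)).2 z hz) (fun s hs => norm_deriv_bound hs.1 ?_) (h0 z hz)
  · rw [norm_mul, norm_powFamily ht.1]
    have h2 : t ^ (-k z).re * t ^ ((k z).re + β) = t ^ β := by
      rw [← Real.rpow_add ht.1, Complex.neg_re]
      congr 1
      ring
    calc t ^ (-k z).re * ‖V t z‖
        ≤ t ^ (-k z).re * (C / ((k z).re + β) * t ^ ((k z).re + β)) :=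
          mul_le_mul_of_nonneg_left h1 (Real.rpow_nonneg ht.1.le _)
      _ = C / ((k z).re + β) * t ^ β := by rw [mul_left_comm, h2]
      _ ≤ C / β * t ^ β := mul_le_mul_of_nonneg_right
          (div_le_div_of_nonneg_left hC hβ (by linarith [hk z hz])) (Real.rpow_nonneg ht.1.le _)
  · rw [norm_mul, norm_powFamily hs.1, Real.rpow_add hs.1, mul_left_comm]
    exact mul_le_mul_of_nonneg_left ((hτ' (hsub s hs)).1 z hz) (Real.rpow_nonneg hs.1.le _)

theorem powFamily {B : ℝ} (hk : ∀ z ∈ Metric.ball z₀ r, B ≤ (k z).re) :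
    Decay z₀ r B (powFamily k) :=
  of_le (T := 1) (C := 1) one_pos zero_le_one fun t ht z hz => by
    rw [norm_powFamily ht.1, one_mul]
    exact Real.rpow_le_rpow_of_exponent_ge ht.1 ht.2.le (hk z hz)

theorem tendstoLocallyUniformlyOn {A : ℝ → ℂ → ℂ} {f : ℝ → ℝ → ℝ} (h : Decay (θ₀ : ℂ) r β A)
    (hβ : 0 < β) (hT : 0 < T) (hf : Extends θ₀ T r f A) :
    TendstoLocallyUniformlyOn f (fun _ => 0) (𝓝[>] 0) (Ioo (θ₀ - r) (θ₀ + r)) := by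
  refine TendstoUniformlyOn.tendstoLocallyUniformlyOn ?_
  have h1 := h.tendstoUniformlyOn hβ
  rw [Metric.tendstoUniformlyOn_iff] at h1 ⊢
  intro ε hε
  filter_upwards [h1 ε hε, eventually_pos_lt hT] with t h2 ht θ hθ
  have := h2 θ (ofReal_mem_ball.2 hθ)
  rwa [hf t ht θ hθ, dist_zero_left, Complex.norm_real, ← dist_zero_left] at this

end Decay

end Powers

/-! ### From the first order system to the field equations -/

section Construction

variable {n : ℕ}

theorem HolFamily.ofReal_sq {Ω : Set (ℝ × ℂ)} : HolFamily Ω fun t _ => (t : ℂ) ^ 2 := by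
  simpa only [sq] using HolFamily.ofReal.mul HolFamily.ofReal

/-- The spatial part of the conservation law for Q: with g = ∂Q and c = t², the terms t²(∂²Q - 2 ∂S
∂Q) are e^{2S} times the derivative of a flux in the first order unknowns. -/
theorem deriv_flux {S g : ℂ → ℂ} {z c : ℂ} (hS : DifferentiableAt ℂ S z)
    (hg : DifferentiableAt ℂ g z) :
    deriv (fun v => c * Complex.exp (-2 * S v) * g v) z
      = c * Complex.exp (-2 * S z) * (deriv g z - 2 * (deriv S z * g z)) := by
  have h1 := ((hS.hasDerivAt.const_mul (-2)).cexp.const_mul c).mul hg.hasDerivAt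
  exact h1.deriv.trans (by ring)

theorem vtdData_S_eq (pc qc : Fin n → Fin 2 → ℂ → ℂ) (I : Fin n) (t : ℝ) (z : ℂ) (u : Fin n → ℂ) :
    (∑ J, (pc J 0 z * Real.log t + pc J 1 z + u J)) + (pc I 0 z * Real.log t + pc I 1 z + u I)
      = (vtdData pc qc).S I t z u := by
  simp only [VTDData.S, vtdData, Finset.sum_add_distrib, ← Finset.sum_mul]
  ring

/-- The fields that belong to a solution of the first order system. -/
noncomputable def stateFields (pc qc : Fin n → Fin 2 → ℂ → ℂ) (x : ℝ → ℂ → Slot × Fin n → ℂ) :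
    FieldFamily n where
  P I t z := pc I 0 z * Real.log t + pc I 1 z + x t z (.u, I)
  DP I t z := pc I 0 z + x t z (.a, I)
  DDP I t z := vtdRHS (vtdData pc qc) x t z (.a, I)
  Q I t z := qc I 0 z + x t z (.y, I)
  DQ I t z := vtdRHS (vtdData pc qc) x t z (.y, I)
  DDQ I t z := Complex.exp (2 * (vtdData pc qc).S I t z fun J => x t z (.u, J))
    * (2 * ((∑ J, (pc J 0 z + x t z (.a, J))) + (pc I 0 z + x t z (.a, I))))
      * ((vtdData pc qc).W I z + x t z (.w, I))
    + Complex.exp (2 * (vtdData pc qc).S I t z fun J => x t z (.u, J))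
      * vtdRHS (vtdData pc qc) x t z (.w, I)

variable {pc qc : Fin n → Fin 2 → ℂ → ℂ} {x : ℝ → ℂ → Slot × Fin n → ℂ}

theorem stateFields_S (I : Fin n) (t : ℝ) (z : ℂ) :
    (stateFields pc qc x).S I t z = (vtdData pc qc).S I t z fun J => x t z (.u, J) :=
  vtdData_S_eq pc qc I t z _

/-- A decaying solution of the first order system, with holomorphic data. -/
structure IsSystemSolution (θ₀ T r ρ B : ℝ) (e : Fin n → ℝ) (μ : ℝ) (pc qc : Fin n → Fin 2 → ℂ → ℂ)
    (x : ℝ → ℂ → Slot × Fin n → ℂ) : Prop where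
  T_pos : 0 < T
  r_pos : 0 < r
  r_le : r ≤ ρ
  bounded : (vtdData pc qc).Bounded θ₀ ρ B e μ
  diff_p : ∀ I A, DifferentiableOn ℂ (pc I A) (Metric.ball (θ₀ : ℂ) (2 * ρ))
  diff_q : ∀ I A, DifferentiableOn ℂ (qc I A) (Metric.ball (θ₀ : ℂ) (2 * ρ))
  q_le : ∀ I, ∀ z ∈ Metric.ball (θ₀ : ℂ) (2 * ρ), ‖qc I 1 z‖ ≤ B
  hol : HolFamily (cylinder θ₀ T r) x
  solves : SolvesSystem (vtdData pc qc) (cylinder θ₀ T r) x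
  le : ∀ p ∈ cylinder θ₀ T r, ∀ i, ‖x p.1 p.2 i‖ ≤ p.1 ^ slotWeight e μ i

namespace IsSystemSolution

variable {θ₀ T r ρ B μ : ℝ} {e : Fin n → ℝ} (h : IsSystemSolution θ₀ T r ρ B e μ pc qc x)
include h

theorem ball_subset : Metric.ball (θ₀ : ℂ) r ⊆ Metric.ball (θ₀ : ℂ) (2 * ρ) :=
  Metric.ball_subset_ball (by linarith [h.r_le, h.r_pos])

theorem space {g : ℂ → ℂ} (hg : DifferentiableOn ℂ g (Metric.ball (θ₀ : ℂ) (2 * ρ))) :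
    HolFamily (cylinder θ₀ T r) (fun _ z => g z) :=
  .space fun _ hp => hg.differentiableAt (Metric.isOpen_ball.mem_nhds (h.ball_subset hp.2))

theorem euler (i : Slot × Fin n) : HasEuler (cylinder θ₀ T r) (fun t z => x t z i)
    (fun t z => vtdRHS (vtdData pc qc) x t z i) := fun p hp => h.solves p hp i

theorem decay (i : Slot × Fin n) : Decay θ₀ r (slotWeight e μ i) (fun t z => x t z i) :=
  .of_le h.T_pos zero_le_one fun t ht z hz => by
    rw [one_mul]; exact h.le (t, z) ⟨ht, hz⟩ i

theorem μ_le_slotWeight (i : Slot × Fin n) : μ ≤ slotWeight e μ i := by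
  have h1 := h.bounded.μ_pos
  have h2 := h.bounded.μ_le_e i.2
  obtain ⟨j, I⟩ := i
  cases j <;> simp only [slotWeight] at h2 ⊢ <;> linarith

theorem tendsto_zero (i : Slot × Fin n) {z : ℂ} (hz : z ∈ Metric.ball (θ₀ : ℂ) r) :
    Tendsto (fun t => x t z i) (𝓝[>] 0) (𝓝 0) :=
  (h.decay i).tendsto (h.bounded.slotWeight_pos i) hz

theorem hol_exp (c : ℂ) (I : Fin n) : HolFamily (cylinder θ₀ T r) fun t z =>
    Complex.exp (c * (vtdData pc qc).S I t z fun J => x t z (.u, J)) :=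
  ((HolFamily.const c).mul ((((h.space (h.bounded.hk I)).mul (.log pos_of_mem_cylinder)).add
    (h.space (h.bounded.hs I))).add ((HolFamily.sum fun J => h.hol.apply (.u, J)).add
    (h.hol.apply (.u, I))))).cexp

theorem hol_W (I : Fin n) : HolFamily (cylinder θ₀ T r) fun t z =>
    (vtdData pc qc).W I z + x t z (.w, I) :=
  (h.space (h.bounded.hW I)).add (h.hol.apply _)

theorem hol_ξ (I : Fin n) : HolFamily (cylinder θ₀ T r) fun t z =>
    (vtdData pc qc).ξ I z + x t z (.d, I) :=
  (h.space (h.bounded.hξ I)).add (h.hol.apply _)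

theorem hol_flux (I : Fin n) : HolFamily (cylinder θ₀ T r) fun t z =>
    (t : ℂ) ^ 2 * Complex.exp (-2 * (vtdData pc qc).S I t z fun J => x t z (.u, J))
      * ((vtdData pc qc).ξ I z + x t z (.d, I)) :=
  (HolFamily.ofReal_sq.mul (h.hol_exp (-2) I)).mul (h.hol_ξ I)

theorem hol_rhs (i : Slot × Fin n) :
    HolFamily (cylinder θ₀ T r) fun t z => vtdRHS (vtdData pc qc) x t z i := by
  obtain ⟨j, I⟩ := i
  have hW := h.hol_W I
  have hξ := h.hol_ξ I
  cases j <;> simp only [vtdRHS]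
  · exact h.hol.apply _
  · refine (HolFamily.ofReal_sq.mul ((h.hol.apply _).deriv_z isOpen_cylinder)).add
      ((HolFamily.ofReal_sq.mul (((h.space (h.bounded.hb₀ I)).mul (.log pos_of_mem_cylinder)).add
        (h.space (h.bounded.hb₁ I)))).add (((HolFamily.const _).mul ((h.hol_exp 2 I).mul ?_)).add
        ((HolFamily.const _).mul ((HolFamily.ofReal_sq.mul (h.hol_exp (-2) I)).mul ?_))))
    · simpa only [sq] using hW.mul hW
    · simpa only [sq] using hξ.mul hξ
  · exact (h.hol.apply _).deriv_z isOpen_cylinder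
  · exact (h.hol_flux I).deriv_z isOpen_cylinder
  · exact (h.hol_exp 2 I).mul hW
  · exact ((h.hol_exp 2 I).mul hW).deriv_z isOpen_cylinder

/-- A component that satisfies the differentiated equation of another one is its derivative. -/
theorem eq_deriv_of_rhs {i j : Slot × Fin n}
    (hij : ∀ t z, vtdRHS (vtdData pc qc) x t z j
      = deriv (fun v => vtdRHS (vtdData pc qc) x t v i) z) :
    ∀ p ∈ cylinder θ₀ T r, x p.1 p.2 j = deriv (fun v => x p.1 v i) p.2 := by
  have h1 := (h.euler j).sub ((h.euler i).deriv_z isOpen_cylinder pos_of_mem_cylinder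
    (h.hol.apply i) (h.hol_rhs i))
  have h2 := eq_zero_of_hasEuler_zero (h1.congr_right fun p _ => (sub_eq_zero.2 (hij p.1 p.2)).symm)
    fun z hz => ?_
  · exact fun p hp => sub_eq_zero.1 (h2 p hp)
  · rw [← sub_zero (0 : ℂ)]
    refine (h.tendsto_zero j hz).sub ?_
    -- A slightly smaller disc that still contains z leaves room for Cauchy's estimate on the
    -- component to be differentiated.
    obtain ⟨r', hr', hr⟩ := exists_between (Metric.mem_ball.1 hz)
    exact ((h.decay i).deriv_z hr h.T_pos fun t ht => (h.hol.apply i).slice fun w hw =>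
      ⟨ht, hw⟩).tendsto (h.bounded.slotWeight_pos i) (Metric.mem_ball.2 hr')

theorem x_c (I : Fin n) :
    ∀ p ∈ cylinder θ₀ T r, x p.1 p.2 (.c, I) = deriv (fun v => x p.1 v (.u, I)) p.2 :=
  h.eq_deriv_of_rhs fun _ _ => rfl

theorem x_d (I : Fin n) :
    ∀ p ∈ cylinder θ₀ T r, x p.1 p.2 (.d, I) = deriv (fun v => x p.1 v (.y, I)) p.2 :=
  h.eq_deriv_of_rhs fun _ _ => rfl

theorem euler_S (I : Fin n) : HasEuler (cylinder θ₀ T r)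
    (fun t z => (vtdData pc qc).S I t z fun J => x t z (.u, J))
    (fun t z => (∑ J, (pc J 0 z + x t z (.a, J))) + (pc I 0 z + x t z (.a, I))) := by
  have h1 : ∀ J, HasEuler (cylinder θ₀ T r)
      (fun t z => pc J 0 z * Real.log t + pc J 1 z + x t z (.u, J))
      (fun t z => pc J 0 z + x t z (.a, J)) := fun J =>
    (((HasEuler.mul_log pos_of_mem_cylinder _).add (HasEuler.space _)).add
      (h.euler (.u, J))).congr_right fun p _ => by rw [add_zero]; rfl
  exact ((HasEuler.sum h1).add (h1 I)).congr_left isOpen_cylinder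
    fun p _ => (vtdData_S_eq pc qc I p.1 p.2 _).symm

theorem regular : (stateFields pc qc x).Regular (cylinder θ₀ T r) := by
  have hW := h.hol_W
  have hDP : ∀ I, HolFamily (cylinder θ₀ T r) fun t z => pc I 0 z + x t z (.a, I) := fun I =>
    (h.space (h.diff_p I 0)).add (h.hol.apply _)
  refine
    { P := fun I => (((h.space (h.diff_p I 0)).mul (.log pos_of_mem_cylinder)).add
        (h.space (h.diff_p I 1))).add (h.hol.apply _)
      DP := hDP
      DDP := fun I => h.hol_rhs (.a, I)
      Q := fun I => (h.space (h.diff_q I 0)).add (h.hol.apply _)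
      DQ := fun I => h.hol_rhs (.y, I)
      DDQ := fun I => (((h.hol_exp 2 I).mul ((HolFamily.const 2).mul ((HolFamily.sum hDP).add
        (hDP I)))).mul (hW I)).add ((h.hol_exp 2 I).mul (h.hol_rhs _))
      euler_P := fun I => (((HasEuler.mul_log pos_of_mem_cylinder _).add (HasEuler.space _)).add
        (h.euler (.u, I))).congr_right fun p _ => by rw [add_zero]; rfl
      euler_DP := fun I => ((HasEuler.space _).add (h.euler (.a, I))).congr_right
        fun p _ => (zero_add _).symm
      euler_Q := fun I => ((HasEuler.space _).add (h.euler (.y, I))).congr_right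
        fun p _ => (zero_add _).symm
      euler_DQ := fun I => (((h.euler_S I).const_mul 2).cexp.mul
        ((HasEuler.space _).add (h.euler (.w, I)))).congr_right fun p _ => ?_ }
  simp only [stateFields]
  rw [zero_add]

theorem deriv_P (I : Fin n) {t : ℝ} (ht : t ∈ Ioo 0 T) :
    EqOn (deriv ((stateFields pc qc x).P I t)) (fun z => deriv (pc I 0) z * Real.log t
      + deriv (pc I 1) z + x t z (.c, I)) (Metric.ball (θ₀ : ℂ) r) := fun z hz => by
  have hd : ∀ A, DifferentiableAt ℂ (pc I A) z := fun A => (h.diff_p I A).differentiableAt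
    (Metric.isOpen_ball.mem_nhds (h.ball_subset hz))
  have h1 := (((hd 0).hasDerivAt.mul_const (Real.log t : ℂ)).add (hd 1).hasDerivAt).add
    ((h.hol.apply (.u, I)).diff (t, z) ⟨ht, hz⟩).hasDerivAt
  rw [← h.x_c I (t, z) ⟨ht, hz⟩] at h1
  exact h1.deriv

theorem deriv_deriv_P (I : Fin n) {t : ℝ} {z : ℂ} (ht : t ∈ Ioo 0 T)
    (hz : z ∈ Metric.ball (θ₀ : ℂ) r) :
    deriv (deriv ((stateFields pc qc x).P I t)) z = (vtdData pc qc).b₀ I z * Real.log t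
      + (vtdData pc qc).b₁ I z + deriv (fun v => x t v (.c, I)) z := by
  rw [(h.deriv_P I ht).deriv Metric.isOpen_ball hz]
  have hd : ∀ A, DifferentiableAt ℂ (deriv (pc I A)) z := fun A =>
    ((h.diff_p I A).deriv Metric.isOpen_ball).differentiableAt
      (Metric.isOpen_ball.mem_nhds (h.ball_subset hz))
  exact ((((hd 0).hasDerivAt.mul_const (Real.log t : ℂ)).add (hd 1).hasDerivAt).add
    ((h.hol.apply (.c, I)).diff (t, z) ⟨ht, hz⟩).hasDerivAt).deriv

theorem deriv_Q (I : Fin n) {t : ℝ} (ht : t ∈ Ioo 0 T) :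
    EqOn (deriv ((stateFields pc qc x).Q I t)) (fun z => (vtdData pc qc).ξ I z + x t z (.d, I))
      (Metric.ball (θ₀ : ℂ) r) := fun z hz => by
  have hd : DifferentiableAt ℂ (qc I 0) z := (h.diff_q I 0).differentiableAt
    (Metric.isOpen_ball.mem_nhds (h.ball_subset hz))
  have h1 := hd.hasDerivAt.add ((h.hol.apply (.y, I)).diff (t, z) ⟨ht, hz⟩).hasDerivAt
  rw [← h.x_d I (t, z) ⟨ht, hz⟩] at h1
  exact h1.deriv

theorem rhs_w (I : Fin n) {t : ℝ} {z : ℂ} (ht : t ∈ Ioo 0 T)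
    (hz : z ∈ Metric.ball (θ₀ : ℂ) r) :
    vtdRHS (vtdData pc qc) x t z (.w, I)
      = t ^ 2 * Complex.exp (-2 * (stateFields pc qc x).S I t z)
        * (deriv (deriv ((stateFields pc qc x).Q I t)) z - 2 *
          (deriv ((stateFields pc qc x).S I t) z * deriv ((stateFields pc qc x).Q I t) z)) := by
  rw [← deriv_flux ((h.regular.S I).diff (t, z) ⟨ht, hz⟩)
    (((h.regular.Q I).deriv_z isOpen_cylinder).diff (t, z) ⟨ht, hz⟩)]
  simp only [vtdRHS]
  refine EqOn.deriv (s := Metric.ball (θ₀ : ℂ) r) (fun v hv => ?_) Metric.isOpen_ball hz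
  simp only [stateFields_S, h.deriv_Q I ht hv]

/-- With c = ∂u and d = ∂y established, the a-component of the system is the equation for P, where
t²∂c and the terms with b₀, b₁ add up to t²∂²P. The w-component multiplied by e^{2S} is the equation
for Q. -/
theorem solvesAt : ∀ p ∈ cylinder θ₀ T r, ∀ I, (stateFields pc qc x).SolvesAt I p.1 p.2 := by
  rintro ⟨t, z⟩ ⟨ht, hz⟩ I
  have hQ := h.deriv_Q I ht hz
  have hE : Complex.exp (2 * (stateFields pc qc x).S I t z)
      * Complex.exp (-2 * (stateFields pc qc x).S I t z) = 1 := by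
    rw [← Complex.exp_add, neg_mul, add_neg_cancel, Complex.exp_zero]
  constructor
  · have h1 : (stateFields pc qc x).DQ I t z = Complex.exp (2 * (stateFields pc qc x).S I t z)
        * ((vtdData pc qc).W I z + x t z (.w, I)) := by rw [stateFields_S]; rfl
    have h2 : (stateFields pc qc x).DDP I t z = vtdRHS (vtdData pc qc) x t z (.a, I) := rfl
    dsimp only at hQ ⊢
    rw [h.deriv_deriv_P I ht hz, h1, h2, hQ]
    simp only [vtdRHS, ← stateFields_S]
    linear_combination (1 / 2) * Complex.exp (2 * (stateFields pc qc x).S I t z)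
        * ((vtdData pc qc).W I z + x t z (.w, I)) ^ 2 * hE
  · have h1 : (stateFields pc qc x).DQ I t z = Complex.exp (2 * (stateFields pc qc x).S I t z)
        * ((vtdData pc qc).W I z + x t z (.w, I)) := by rw [stateFields_S]; rfl
    have h2 : (stateFields pc qc x).DDQ I t z = Complex.exp (2 * (stateFields pc qc x).S I t z)
        * (2 * (stateFields pc qc x).DS I t z) * ((vtdData pc qc).W I z + x t z (.w, I))
        + Complex.exp (2 * (stateFields pc qc x).S I t z)
          * vtdRHS (vtdData pc qc) x t z (.w, I) := by rw [stateFields_S]; rfl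
    dsimp only
    rw [h2, h.rhs_w I ht hz, h1]
    linear_combination t ^ 2 * (deriv (deriv ((stateFields pc qc x).Q I t)) z - 2 *
          (deriv ((stateFields pc qc x).S I t) z * deriv ((stateFields pc qc x).Q I t) z)) * hE

end IsSystemSolution

end Construction

/-! ### Remainders of the constructed solution -/

section Existence

variable {n : ℕ} {θ₀ T r ρ B μ : ℝ} {e : Fin n → ℝ} {pc qc : Fin n → Fin 2 → ℂ → ℂ}
  {x : ℝ → ℂ → Slot × Fin n → ℂ}

theorem isAnalyticRemainder_of_decay {G : ℝ → ℂ → ℂ} {f : ℝ → ℝ → ℝ} {β : ℝ}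
    (hC : ContDiffOn ℝ 2 (Function.uncurry G) (cylinder θ₀ T r))
    (hG : HolFamily (cylinder θ₀ T r) G)
    (hd : Decay θ₀ r β G) (hβ : 0 < β) (hf : Extends θ₀ T r f G) :
    IsAnalyticRemainder θ₀ T r f :=
  ⟨G, hC, fun _ ht => hG.slice fun _ hw => ⟨ht, hw⟩, hd.tendstoUniformlyOn hβ, hf⟩

theorem VTDData.exp_two_S (𝔡 : VTDData n) (I : Fin n) (t : ℝ) (z : ℂ) (u : Fin n → ℂ) :
    Complex.exp (2 * 𝔡.S I t z u) = powFamily (fun z => 2 * 𝔡.k I z) t z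
      * Complex.exp (2 * 𝔡.s I z) * Complex.exp (2 * ((∑ J, u J) + u I)) := by
  rw [powFamily, ← Complex.exp_add, ← Complex.exp_add, VTDData.S]
  congr 1
  ring

/-- This relation makes t^{2k} q₁ solve the leading order equation 𝒟y = t^{2k} e^{2s} W, as 𝒟 t^{2k}
= 2k t^{2k}. -/
theorem vtdData_W_mul_exp (pc qc : Fin n → Fin 2 → ℂ → ℂ) (I : Fin n) (z : ℂ) :
    (vtdData pc qc).W I z * Complex.exp (2 * (vtdData pc qc).s I z)
      = 2 * (vtdData pc qc).k I z * qc I 1 z := by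
  simp only [vtdData]
  rw [mul_assoc, ← Complex.exp_add, neg_mul, neg_add_cancel, Complex.exp_zero, mul_one]

namespace IsSystemSolution

theorem mono (h : IsSystemSolution θ₀ T r ρ B e μ pc qc x) {r' : ℝ} (hr' : 0 < r') (hr : r' ≤ r) :
    IsSystemSolution θ₀ T r' ρ B e μ pc qc x :=
  have hsub : cylinder θ₀ T r' ⊆ cylinder θ₀ T r :=
    prod_mono subset_rfl (Metric.ball_subset_ball hr)
  { h with
    r_pos := hr'
    r_le := hr.trans h.r_le
    hol := h.hol.mono hsub
    solves := fun p hp => h.solves p (hsub hp)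
    le := fun p hp => h.le p (hsub hp) }

variable (h : IsSystemSolution θ₀ T r ρ B e μ pc qc x)
include h

theorem decay_μ (i : Slot × Fin n) : Decay θ₀ r μ (fun t z => x t z i) :=
  (h.decay i).mono_exp (h.μ_le_slotWeight i)

theorem decay_zero (i : Slot × Fin n) : Decay θ₀ r 0 (fun t z => x t z i) :=
  (h.decay i).mono_exp (h.bounded.slotWeight_pos i).le

theorem decay_sum_u (I : Fin n) : Decay θ₀ r μ
    (fun t z => 2 * ((∑ J, x t z (.u, J)) + x t z (.u, I))) :=
  .const_mul 2 (.add (.sum fun J => h.decay_μ (.u, J)) (h.decay_μ (.u, I)))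

theorem decay_exp_s (I : Fin n) :
    Decay θ₀ r 0 (fun _ z => Complex.exp (2 * (vtdData pc qc).s I z)) :=
  .of_bounded (C := Real.exp (2 * B)) fun z hz => by
    have h1 := h.bounded.s_le I z (h.ball_subset hz)
    rw [Complex.norm_exp]
    refine Real.exp_le_exp.2 ((Complex.re_le_norm _).trans ?_)
    rw [norm_mul, Complex.norm_two]
    linarith

theorem decay_W (I : Fin n) : Decay θ₀ r 0 (fun _ z => (vtdData pc qc).W I z) :=
  .of_bounded fun z hz => h.bounded.W_le I z (h.ball_subset hz)

theorem decay_W_add (I : Fin n) :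
    Decay θ₀ r 0 (fun t z => (vtdData pc qc).W I z + x t z (.w, I)) :=
  (h.decay_W I).add (h.decay_zero _)

theorem decay_ξ_add (I : Fin n) :
    Decay θ₀ r 0 (fun t z => (vtdData pc qc).ξ I z + x t z (.d, I)) :=
  (Decay.of_bounded fun z hz => h.bounded.ξ_le I z (h.ball_subset hz)).add (h.decay_zero _)

/-- The complexified remainder `κ`. -/
theorem decay_κ (I : Fin n) :
    Decay θ₀ r μ fun t z => powFamily (fun z => -(2 * (vtdData pc qc).k I z)) t z
      * (x t z (.y, I) - powFamily (fun z => 2 * (vtdData pc qc).k I z) t z * qc I 1 z) := by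
  have hk : ∀ z ∈ Metric.ball (θ₀ : ℂ) r, e I + 2 * μ ≤ (2 * (vtdData pc qc).k I z).re :=
    fun z hz => by
      have := h.bounded.le_k I z (h.ball_subset hz)
      simpa using this
  have hpos : 0 < e I + 2 * μ := by linarith [h.bounded.μ_pos, h.bounded.e_pos I]
  -- The function g with 𝒟(y - t^{2k} q₁) = t^{2k} g. It comes from e^{2S} = t^{2k} e^{2s} e^{2(Σu +
  -- u_I)}; the leading term e^{2s} W cancels against 2k q₁.
  have hg : Decay θ₀ r μ (fun t z =>
      ((Complex.exp (2 * ((∑ J, x t z (.u, J)) + x t z (.u, I))) - 1)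
        * ((vtdData pc qc).W I z + x t z (.w, I)) + x t z (.w, I))
        * Complex.exp (2 * (vtdData pc qc).s I z)) :=
    ((((h.decay_sum_u I).exp_sub_one h.bounded.μ_pos).mul_bounded (h.decay_W_add I)).add
      (h.decay_μ (.w, I))).mul_bounded (h.decay_exp_s I)
  refine hg.integrate_pow h.bounded.μ_pos h.T_pos (fun z hz => hpos.le.trans (hk z hz))
    (fun t ht z hz => ?_) fun z hz => ?_
  · have h1 := ((h.euler (.y, I)).sub ((HasEuler.powFamily pos_of_mem_cylinder
      fun z => 2 * (vtdData pc qc).k I z).mul (HasEuler.space (qc I 1)))) (t, z) ⟨ht, hz⟩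
    refine h1.congr_deriv ?_
    dsimp only
    congr 1
    simp only [vtdRHS]
    rw [VTDData.exp_two_S]
    linear_combination powFamily (fun z => 2 * (vtdData pc qc).k I z) t z
      * vtdData_W_mul_exp pc qc I z
  · rw [← sub_zero (0 : ℂ)]
    refine (h.tendsto_zero _ hz).sub (((Decay.powFamily hk).mul_bounded
      (Decay.of_bounded fun z hz => h.q_le I z (h.ball_subset hz))).tendsto hpos hz)

theorem contDiffOn_u (I : Fin n) :
    ContDiffOn ℝ 2 (Function.uncurry fun t z => x t z (.u, I)) (cylinder θ₀ T r) :=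
  contDiffOn_of_hasEuler isOpen_cylinder pos_of_mem_cylinder (h.hol.apply (.u, I))
    (h.hol.apply (.a, I)) (h.hol_rhs (.a, I)) (h.euler (.u, I)) (h.euler (.a, I))

omit h in
theorem contDiffOn_powFamily {k : ℂ → ℂ}
    (hk : ∀ p ∈ cylinder θ₀ T r, DifferentiableAt ℂ k p.2) :
    ContDiffOn ℝ 2 (Function.uncurry (powFamily k)) (cylinder θ₀ T r) := by
  have h1 := HolFamily.powFamily pos_of_mem_cylinder hk
  have h2 := HasEuler.powFamily (Ω := cylinder θ₀ T r) pos_of_mem_cylinder k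
  exact contDiffOn_of_hasEuler isOpen_cylinder pos_of_mem_cylinder h1 (h1.mul (.space hk))
    ((h1.mul (.space hk)).mul (.space hk)) h2
    ((h2.mul (.space k)).congr_right fun _ _ => by ring)

omit h in
theorem contDiffOn_space {g : ℂ → ℂ} (hg : HolFamily (cylinder θ₀ T r) fun _ z => g z) :
    ContDiffOn ℝ 2 (Function.uncurry fun (_ : ℝ) z => g z) (cylinder θ₀ T r) :=
  contDiffOn_of_hasEuler isOpen_cylinder pos_of_mem_cylinder hg (.const 0) (.const 0)
    (.space _) (.space fun _ => 0)

theorem contDiffOn_P (I : Fin n) :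
    ContDiffOn ℝ 2 (Function.uncurry ((stateFields pc qc x).P I)) (cylinder θ₀ T r) :=
  contDiffOn_of_hasEuler isOpen_cylinder pos_of_mem_cylinder (h.regular.P I) (h.regular.DP I)
    (h.regular.DDP I) (h.regular.euler_P I) (h.regular.euler_DP I)

theorem contDiffOn_Q (I : Fin n) :
    ContDiffOn ℝ 2 (Function.uncurry ((stateFields pc qc x).Q I)) (cylinder θ₀ T r) :=
  contDiffOn_of_hasEuler isOpen_cylinder pos_of_mem_cylinder (h.regular.Q I) (h.regular.DQ I)
    (h.regular.DDQ I) (h.regular.euler_Q I) (h.regular.euler_DQ I)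

theorem contDiffOn_y (I : Fin n) :
    ContDiffOn ℝ 2 (Function.uncurry fun t z => x t z (.y, I)) (cylinder θ₀ T r) := by
  refine ((h.contDiffOn_Q I).sub (contDiffOn_space (h.space (h.diff_q I 0)))).congr fun p _ => ?_
  simp [Function.uncurry, stateFields]

theorem diff_two_k (I : Fin n) :
    ∀ p ∈ cylinder θ₀ T r, DifferentiableAt ℂ (fun z => 2 * (vtdData pc qc).k I z) p.2 :=
  fun _ hp => ((h.bounded.hk I).differentiableAt
    (Metric.isOpen_ball.mem_nhds (h.ball_subset hp.2))).const_mul 2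

theorem hol_κ (I : Fin n) : HolFamily (cylinder θ₀ T r) fun t z =>
    powFamily (fun z => -(2 * (vtdData pc qc).k I z)) t z
      * (x t z (.y, I) - powFamily (fun z => 2 * (vtdData pc qc).k I z) t z * qc I 1 z) := by
  have h1 := (HolFamily.powFamily pos_of_mem_cylinder (h.diff_two_k I)).mul
    (h.space (h.diff_q I 1))
  refine (HolFamily.powFamily pos_of_mem_cylinder fun p hp => (h.diff_two_k I p hp).fun_neg).mul
    ⟨(h.hol.apply _).cont.sub h1.cont, fun p hp => ((h.hol.apply _).diff p hp).sub (h1.diff p hp)⟩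

theorem contDiffOn_κ (I : Fin n) : ContDiffOn ℝ 2 (Function.uncurry fun t z =>
    powFamily (fun z => -(2 * (vtdData pc qc).k I z)) t z
      * (x t z (.y, I) - powFamily (fun z => 2 * (vtdData pc qc).k I z) t z * qc I 1 z))
    (cylinder θ₀ T r) :=
  (contDiffOn_powFamily fun p hp => (h.diff_two_k I p hp).fun_neg).mul
    ((h.contDiffOn_y I).sub ((contDiffOn_powFamily (h.diff_two_k I)).mul
      (contDiffOn_space (h.space (h.diff_q I 1)))))

theorem decay_π {ε : ℝ} (I : Fin n) :
    Decay θ₀ r (-ε + e I) (fun t z => powFamily (fun _ => ((-ε : ℝ) : ℂ)) t z * x t z (.u, I)) :=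
  (Decay.powFamily fun _ _ => by rw [Complex.ofReal_re]).mul (h.decay (.u, I))

end IsSystemSolution

end Existence

/-! ### Existence with velocity dominated asymptotics -/

section Existence

variable {n : ℕ} {θ₀ T r ρ B μ : ℝ} {e : Fin n → ℝ} {p q : Fin n → Fin 2 → ℝ → ℝ}
  {pc qc : Fin n → Fin 2 → ℂ → ℂ} {x : ℝ → ℂ → Slot × Fin n → ℂ}

theorem extends_re {G : ℝ → ℂ → ℂ}
    (h : ∀ t ∈ Ioo 0 T, ∀ θ ∈ Ioo (θ₀ - r) (θ₀ + r), (G t (θ : ℂ)).im = 0) :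
    Extends θ₀ T r (fun t θ => (G t θ).re) G := fun t ht θ hθ =>
  Complex.ext (by simp) (by simp [h t ht θ hθ])

theorem powFamily_ofReal {t : ℝ} (ht : 0 < t) {k : ℂ → ℂ} {z : ℂ} {a : ℝ} (hk : k z = a) :
    powFamily k t z = ((t ^ a : ℝ) : ℂ) := by
  rw [powFamily, hk, cexp_mul_log ht]

theorem ofReal_rpow_neg_mul {t : ℝ} (ht : 0 < t) (a : ℝ) :
    ((t ^ a : ℝ) : ℂ) * ((t ^ (-a) : ℝ) : ℂ) = 1 := by
  rw [← Complex.ofReal_mul, ← Real.rpow_add ht, add_neg_cancel, Real.rpow_zero, Complex.ofReal_one]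

namespace IsSystemSolution

variable (h : IsSystemSolution θ₀ T r ρ B e μ pc qc x) (hp : IsComplexification θ₀ r pc p)
  (hq : IsComplexification θ₀ r qc q)
  (hx : ∀ t ∈ Ioo 0 T, ∀ θ ∈ Ioo (θ₀ - r) (θ₀ + r), ∀ i, (x t (θ : ℂ) i).im = 0)

include hp hx in
theorem extends_P (I : Fin n) :
    Extends θ₀ T r (fun t θ => ((stateFields pc qc x).P I t θ).re) ((stateFields pc qc x).P I) :=
  extends_re fun t ht θ hθ => im_add_eq_zero (im_add_eq_zero
    (im_mul_eq_zero (hp.im I 0 θ) (Complex.ofReal_im _)) (hp.im I 1 θ)) (hx t ht θ hθ _)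

include hq hx in
theorem extends_Q (I : Fin n) :
    Extends θ₀ T r (fun t θ => ((stateFields pc qc x).Q I t θ).re) ((stateFields pc qc x).Q I) :=
  extends_re fun t ht θ hθ => im_add_eq_zero (hq.im I 0 θ) (hx t ht θ hθ _)

include h hp hq hx

theorem solvesVacuum : SolvesVacuum (fun I t θ => ((stateFields pc qc x).P I t θ).re)
    (fun I t θ => ((stateFields pc qc x).Q I t θ).re) T (Ioo (θ₀ - r) (θ₀ + r)) :=
  ⟨fun I => (extends_P hp hx I).contDiffOn (h.contDiffOn_P I),
    fun I => (extends_Q hq hx I).contDiffOn (h.contDiffOn_Q I),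
    fun t ht θ hθ I => (h.regular.solvesAt_iff (extends_P hp hx) (extends_Q hq hx) ht hθ I).1
      (h.solvesAt (t, θ) ⟨ht, ofReal_mem_ball.2 hθ⟩ I)⟩

/-- The remainders are π = t^{-ε} u = O(t^{e-ε}), which vanishes at t = 0⁺ thanks to the margin ε <
e, and κ = t^{-2k} y - q₁, which is O(t^μ) by `decay_κ`. -/
theorem isSolutionOfForm {ε : Fin n → ℝ} (hε : ∀ I, ε I < e I) :
    IsSolutionOfForm θ₀ p q ε T r (fun I t θ => ((stateFields pc qc x).P I t θ).re)
      (fun I t θ => ((stateFields pc qc x).Q I t θ).re) := by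
  have hk : ∀ I, ∀ θ ∈ Ioo (θ₀ - r) (θ₀ + r),
      2 * (vtdData pc qc).k I θ = ((2 * kExp p I θ : ℝ) : ℂ) := fun I θ hθ => by
    rw [kExp_eq_re hp I hθ]; push_cast; rfl
  have hk' : ∀ I, ∀ θ ∈ Ioo (θ₀ - r) (θ₀ + r),
      -(2 * (vtdData pc qc).k I θ) = ((-(2 * kExp p I θ) : ℝ) : ℂ) := fun I θ hθ => by
    rw [hk I θ hθ]; push_cast; rfl
  set π : Fin n → ℝ → ℂ → ℂ := fun I t z =>
    powFamily (fun _ => ((-ε I : ℝ) : ℂ)) t z * x t z (.u, I) with hπ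
  set κ : Fin n → ℝ → ℂ → ℂ := fun I t z => powFamily (fun z => -(2 * (vtdData pc qc).k I z)) t z
      * (x t z (.y, I) - powFamily (fun z => 2 * (vtdData pc qc).k I z) t z * qc I 1 z) with hκ
  have hπe : ∀ I, ∀ t ∈ Ioo 0 T, ∀ θ ∈ Ioo (θ₀ - r) (θ₀ + r),
      π I t θ = ((t ^ (-ε I) : ℝ) : ℂ) * x t θ (.u, I) := fun I t ht θ hθ => by
    simp only [hπ]
    rw [powFamily_ofReal ht.1 rfl]
  have hκe : ∀ I, ∀ t ∈ Ioo 0 T, ∀ θ ∈ Ioo (θ₀ - r) (θ₀ + r),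
      κ I t θ = ((t ^ (-(2 * kExp p I θ)) : ℝ) : ℂ)
        * (x t θ (.y, I) - ((t ^ (2 * kExp p I θ) : ℝ) : ℂ) * qc I 1 θ) := fun I t ht θ hθ => by
    simp only [hκ]
    rw [powFamily_ofReal (k := fun z => -(2 * (vtdData pc qc).k I z)) ht.1 (hk' I θ hθ),
      powFamily_ofReal (k := fun z => 2 * (vtdData pc qc).k I z) ht.1 (hk I θ hθ)]
  have hπx : ∀ I, Extends θ₀ T r (fun t θ => (π I t θ).re) (π I) := fun I =>
    extends_re fun t ht θ hθ => by
      rw [hπe I t ht θ hθ]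
      exact im_mul_eq_zero (Complex.ofReal_im _) (hx t ht θ hθ _)
  have hκx : ∀ I, Extends θ₀ T r (fun t θ => (κ I t θ).re) (κ I) := fun I =>
    extends_re fun t ht θ hθ => by
      rw [hκe I t ht θ hθ]
      refine im_mul_eq_zero (Complex.ofReal_im _) ?_
      rw [Complex.sub_im, hx t ht θ hθ, im_mul_eq_zero (Complex.ofReal_im _) (hq.im I 1 θ),
        sub_zero]
  refine ⟨h.T_pos, h.r_pos, h.solvesVacuum hp hq hx, fun I t θ => (π I t θ).re,
    fun I t θ => (κ I t θ).re, fun I => ?_, fun I => ?_, fun t ht θ hθ I => ⟨?_, ?_⟩⟩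
  · have hc : ∀ z ∈ cylinder θ₀ T r, DifferentiableAt ℂ (fun _ : ℂ => ((-ε I : ℝ) : ℂ)) z.2 :=
      fun _ _ => differentiableAt_const _
    exact isAnalyticRemainder_of_decay (G := π I) ((contDiffOn_powFamily hc).mul (h.contDiffOn_u I))
      ((HolFamily.powFamily pos_of_mem_cylinder hc).mul (h.hol.apply _)) (h.decay_π I)
      (by linarith [hε I]) (hπx I)
  · exact isAnalyticRemainder_of_decay (h.contDiffOn_κ I) (h.hol_κ I) (h.decay_κ I)
      h.bounded.μ_pos (hκx I)
  · rw [← Complex.ofReal_inj, ← extends_P hp hx I t ht θ hθ, pVTD]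
    push_cast
    rw [← hπx I t ht θ hθ, hπe I t ht θ hθ, ← mul_assoc, ofReal_rpow_neg_mul ht.1,
      ← hp.eq I 0 θ hθ, ← hp.eq I 1 θ hθ, one_mul]
    rfl
  · rw [← Complex.ofReal_inj, ← extends_Q hq hx I t ht θ hθ, qVTD]
    push_cast
    rw [← hκx I t ht θ hθ, hκe I t ht θ hθ, ← mul_assoc, ofReal_rpow_neg_mul ht.1,
      ← hq.eq I 0 θ hθ, ← hq.eq I 1 θ hθ, one_mul]
    simp only [stateFields]
    ring

/-- By the field equations the two AVTD expressions equal the dropped terms. The first is t²∂²P + ½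
e^{-2S} (t∂Q)², the second t^{-2k} e^{2S} times the w-component of the right-hand side. Both are
O(t^μ), and Cauchy's estimate for the spatial derivatives requires r' < r. -/
theorem isAVTD {r' : ℝ} (hr' : r' < r) :
    IsAVTD p (Ioo (θ₀ - r') (θ₀ + r')) (fun I t θ => ((stateFields pc qc x).P I t θ).re)
      (fun I t θ => ((stateFields pc qc x).Q I t θ).re) := by
  intro I
  have hμ := h.bounded.μ_pos
  have he := h.bounded.e_pos I
  have hle := h.bounded.e_le I
  have hP := extends_P (qc := qc) hp hx
  have hQ := extends_Q (pc := pc) hq hx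
  have hreg := h.regular
  have hexp : Decay θ₀ r (e I + 2 * μ) (fun t z => (t : ℂ) ^ 2
      * Complex.exp (-2 * (vtdData pc qc).S I t z fun J => x t z (.u, J))) :=
    .exp_neg_S (u := fun J t z => x t z (.u, J))
      (fun z hz => h.bounded.k_le I z (h.ball_subset hz))
      (fun z hz => h.bounded.s_le I z (h.ball_subset hz)) fun J => h.decay_zero (.u, J)
  have hS : Extends θ₀ T r (sumPlus (fun I t θ => ((stateFields pc qc x).P I t θ).re) I)
      ((stateFields pc qc x).S I) := Extends.sumPlus hP I
  constructor
  · have h1 : Decay θ₀ r' μ fun t z => (t : ℂ) ^ 2 * ((vtdData pc qc).b₀ I z * Real.log t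
        + (vtdData pc qc).b₁ I z) :=
      ((Decay.sq_mul_log (fun z hz => h.bounded.b₀_le I z (h.ball_subset hz))
        (fun z hz => h.bounded.b₁_le I z (h.ball_subset hz)) h.bounded.B_nonneg).mono_exp
        (by linarith)).mono_radius hr'.le
    have h2 : Decay θ₀ r' μ fun t z => (t : ℂ) ^ 2 * deriv (fun v => x t v (.c, I)) z :=
      ((Decay.sq.mul ((h.decay (.c, I)).deriv_z hr' h.T_pos fun t ht =>
        (h.hol.apply (.c, I)).slice fun w hw => ⟨ht, hw⟩))).mono_exp
        (by simp only [slotWeight]; linarith)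
    have h3 : Decay θ₀ r' μ fun t z => (t : ℂ) ^ 2
        * Complex.exp (-2 * (vtdData pc qc).S I t z fun J => x t z (.u, J))
        * ((vtdData pc qc).ξ I z + x t z (.d, I)) * ((vtdData pc qc).ξ I z + x t z (.d, I)) :=
      (((hexp.mul_bounded (h.decay_ξ_add I)).mul_bounded (h.decay_ξ_add I)).mono_exp
        (by linarith)).mono_radius hr'.le
    refine ((h1.add h2).add (h3.const_mul (1 / 2))).congr h.T_pos
      (g := fun t z => (stateFields pc qc x).DDP I t z + 1 / 2
        * Complex.exp (-2 * (stateFields pc qc x).S I t z) * (stateFields pc qc x).DQ I t z ^ 2)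
      (fun t ht z hz => ?_) |>.tendstoLocallyUniformlyOn hμ h.T_pos fun t ht θ hθ' => ?_
    · have hz' : z ∈ Metric.ball (θ₀ : ℂ) r := Metric.ball_subset_ball hr'.le hz
      have h4 := (h.solvesAt (t, z) ⟨ht, hz'⟩ I).1
      dsimp only at h4
      rw [h.deriv_deriv_P I ht hz', h.deriv_Q I ht hz'] at h4
      rw [← stateFields_S]
      linear_combination h4
    · have hθ : θ ∈ Ioo (θ₀ - r) (θ₀ + r) := ⟨by linarith [hθ'.1], by linarith [hθ'.2]⟩
      dsimp only
      rw [((hP I).eulerD (hreg.euler_P I)).eulerD (hreg.euler_DP I) t ht θ hθ,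
        (hQ I).eulerD (hreg.euler_Q I) t ht θ hθ, hS t ht θ hθ]
      push_cast
      rfl
  · have h1 : Decay θ₀ r' μ fun t z => vtdRHS (vtdData pc qc) x t z (.w, I) :=
      ((hexp.mul_bounded (h.decay_ξ_add I)).deriv_z hr' h.T_pos fun t ht =>
        (h.hol_flux I).slice fun w hw => ⟨ht, hw⟩).mono_exp (by linarith)
    have h2 : Decay θ₀ r' 0 fun t z =>
        Complex.exp (2 * ((∑ J, x t z (.u, J)) + x t z (.u, I))) := by
      refine ((((h.decay_sum_u I).exp_sub_one hμ).mono_exp hμ.le).add (Decay.const 1)).mono_radius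
        hr'.le |>.congr h.T_pos fun t _ z _ => by ring
    refine ((h1.mul_bounded ((h.decay_exp_s I).mono_radius hr'.le)).mul_bounded h2).congr h.T_pos
      (g := fun t z => powFamily (fun z => -(2 * (vtdData pc qc).k I z)) t z
        * ((stateFields pc qc x).DDQ I t z - 2 * ((stateFields pc qc x).DS I t z
          * (stateFields pc qc x).DQ I t z))) (fun t ht z hz => ?_)
      |>.tendstoLocallyUniformlyOn hμ h.T_pos fun t ht θ hθ' => ?_
    · have h3 : powFamily (fun z => -(2 * (vtdData pc qc).k I z)) t z
          * Complex.exp (2 * (vtdData pc qc).S I t z fun J => x t z (.u, J))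
          = Complex.exp (2 * (vtdData pc qc).s I z)
            * Complex.exp (2 * ((∑ J, x t z (.u, J)) + x t z (.u, I))) := by
        rw [VTDData.exp_two_S, ← mul_assoc, ← mul_assoc,
          powFamily_neg_mul (fun z => 2 * (vtdData pc qc).k I z), one_mul]
      have h4 : (stateFields pc qc x).DDQ I t z - 2 * ((stateFields pc qc x).DS I t z
          * (stateFields pc qc x).DQ I t z)
          = Complex.exp (2 * (vtdData pc qc).S I t z fun J => x t z (.u, J))
            * vtdRHS (vtdData pc qc) x t z (.w, I) := by
        simp only [stateFields, FieldFamily.DS]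
        rw [show vtdRHS (vtdData pc qc) x t z (.y, I)
          = Complex.exp (2 * (vtdData pc qc).S I t z fun J => x t z (.u, J))
            * ((vtdData pc qc).W I z + x t z (.w, I)) from rfl]
        ring
      rw [h4, ← mul_assoc, h3]
      ring
    · have hθ : θ ∈ Ioo (θ₀ - r) (θ₀ + r) := ⟨by linarith [hθ'.1], by linarith [hθ'.2]⟩
      have hk : -(2 * (vtdData pc qc).k I θ) = ((-(2 * kExp p I θ) : ℝ) : ℂ) := by
        rw [kExp_eq_re hp I hθ]; push_cast; rfl
      dsimp only
      rw [powFamily_ofReal (k := fun z => -(2 * (vtdData pc qc).k I z)) ht.1 hk,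
        ((hQ I).eulerD (hreg.euler_Q I)).eulerD (hreg.euler_DQ I) t ht θ hθ,
        (hQ I).eulerD (hreg.euler_Q I) t ht θ hθ, hS.eulerD (hreg.euler_S I) t ht θ hθ]
      push_cast
      rfl

end IsSystemSolution

/-- Local existence of asymptotically velocity-terms dominated solutions with given data. -/
theorem exists_isSolutionOfForm (hpq : AdmissibleData θ₀ p q) {ε : Fin n → ℝ}
    (hε : ∀ I, 0 < ε I ∧ ε I < min (2 * kExp p I θ₀) (2 * (1 - kExp p I θ₀))) :
    ∃ (T r : ℝ) (P Q : Fin n → ℝ → ℝ → ℝ),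
      IsSolutionOfForm θ₀ p q ε T r P Q ∧ IsAVTD p (Ioo (θ₀ - r) (θ₀ + r)) P Q := by
  obtain ⟨R, hR, pc, hpc⟩ := exists_isComplexification hpq.1
  obtain ⟨R', hR', qc, hqc⟩ := exists_isComplexification hpq.2.1
  have hp := hpc.mono (min_le_left R R')
  have hq := hqc.mono (min_le_right R R')
  -- The margin above ε has to hold 3μ: one μ for e = ε + μ, so that π → 0, and 2μ for the
  -- rescaling.
  obtain ⟨μ, hμ0, hμ⟩ : ∃ μ > 0, ∀ I,
      3 * μ < min (2 * kExp p I θ₀) (2 * (1 - kExp p I θ₀)) - ε I := by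
    have h1 : ∀ᶠ μ in 𝓝[>] (0 : ℝ), ∀ I,
        3 * μ < min (2 * kExp p I θ₀) (2 * (1 - kExp p I θ₀)) - ε I := by
      refine eventually_all.2 fun I => nhdsWithin_le_nhds ?_
      refine (continuous_const.mul continuous_id).continuousAt.eventually (gt_mem_nhds ?_)
      simpa using (hε I).2
    exact (h1.and self_mem_nhdsWithin).exists.imp fun μ h => ⟨h.2, h.1⟩
  have hμ1 : ∀ I, (ε I + μ) + 2 * μ < 2 * kExp p I θ₀ := fun I => by
    linarith [hμ I, min_le_left (2 * kExp p I θ₀) (2 * (1 - kExp p I θ₀))]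
  have hμ2 : ∀ I, (ε I + μ) + 2 * μ < 2 - 2 * kExp p I θ₀ := fun I => by
    linarith [hμ I, min_le_right (2 * kExp p I θ₀) (2 * (1 - kExp p I θ₀))]
  obtain ⟨B, ρ, hρ, hρR, hB⟩ := exists_bounded_vtdData (lt_min hR hR') hp hq hμ0
    (e := fun I => ε I + μ) (fun I => by linarith [(hε I).1]) hμ1 hμ2
  obtain ⟨hb, hqB⟩ := hB ρ hρ le_rfl
  obtain ⟨T, hT, r, hr, -, hrρ, x, hx, hsol, hle, hre⟩ :=
    exists_system_solution hb (isReal_vtdData hp hq)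
  have h : IsSystemSolution θ₀ T r ρ B (fun I => ε I + μ) μ pc qc x :=
    { T_pos := hT
      r_pos := hr
      r_le := hrρ
      bounded := hb
      diff_p := fun I A => (hp.diff I A).mono (Metric.ball_subset_ball hρR)
      diff_q := fun I A => (hq.diff I A).mono (Metric.ball_subset_ball hρR)
      q_le := hqB
      hol := hx
      solves := hsol
      le := hle }
  have hre' : ∀ t ∈ Ioo 0 T, ∀ θ ∈ Ioo (θ₀ - r) (θ₀ + r), ∀ i, (x t (θ : ℂ) i).im = 0 :=
    fun t ht θ hθ => hre t θ ⟨ht, ofReal_mem_ball.2 hθ⟩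
  have hp' := hp.mono (show r ≤ min R R' by linarith)
  have hq' := hq.mono (show r ≤ min R R' by linarith)
  -- The radius is halved because the AVTD estimates hold on discs smaller than that of the
  -- solution.
  refine ⟨T, r / 2, _, _, (h.mono (half_pos hr) (half_le_self hr.le)).isSolutionOfForm
    (hp'.mono (half_le_self hr.le)) (hq'.mono (half_le_self hr.le)) (fun t ht θ hθ =>
      hre' t ht θ ⟨by linarith [hθ.1], by linarith [hθ.2]⟩) fun I => by linarith,
    h.isAVTD hp' hq' hre' (half_lt_self hr)⟩

end Existence

/-! ### From the field equations to the first order system -/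

section State

variable {n : ℕ} {θ₀ T r ρ B μ : ℝ} {pc qc : Fin n → Fin 2 → ℂ → ℂ} {F : FieldFamily n}

theorem HolFamily.of_differentiableOn {g : ℂ → ℂ}
    (hg : DifferentiableOn ℂ g (Metric.ball (θ₀ : ℂ) r)) :
    HolFamily (cylinder θ₀ T r) (fun _ z => g z) :=
  .space fun _ hp => hg.differentiableAt (Metric.isOpen_ball.mem_nhds hp.2)

/-- The solution of the first order system that belongs to given fields. -/
noncomputable def fieldState (pc qc : Fin n → Fin 2 → ℂ → ℂ) (F : FieldFamily n) (t : ℝ) (z : ℂ) :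
    Slot × Fin n → ℂ
  | (.u, I) => F.P I t z - (pc I 0 z * Real.log t + pc I 1 z)
  | (.a, I) => F.DP I t z - pc I 0 z
  | (.c, I) => deriv (F.P I t) z - (deriv (pc I 0) z * Real.log t + deriv (pc I 1) z)
  | (.w, I) => Complex.exp (-2 * F.S I t z) * F.DQ I t z - (vtdData pc qc).W I z
  | (.y, I) => F.Q I t z - qc I 0 z
  | (.d, I) => deriv (F.Q I t) z - deriv (qc I 0) z

theorem fieldState_S (I : Fin n) (t : ℝ) (z : ℂ) :
    ((vtdData pc qc).S I t z fun J => fieldState pc qc F t z (.u, J)) = F.S I t z := by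
  rw [← vtdData_S_eq]
  simp only [fieldState, add_sub_cancel]
  rfl

theorem exp_two_mul_exp_neg_two (s : ℂ) : Complex.exp (2 * s) * Complex.exp (-2 * s) = 1 := by
  rw [← Complex.exp_add, neg_mul, add_neg_cancel, Complex.exp_zero]

/-- Fields that solve the complexified equations on a disc on which the data are holomorphic. -/
structure FieldFamily.IsSolution (F : FieldFamily n) (θ₀ T r : ℝ) (pc qc : Fin n → Fin 2 → ℂ → ℂ) :
    Prop where
  diff_p : ∀ I A, DifferentiableOn ℂ (pc I A) (Metric.ball (θ₀ : ℂ) r)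
  diff_q : ∀ I A, DifferentiableOn ℂ (qc I A) (Metric.ball (θ₀ : ℂ) r)
  regular : F.Regular (cylinder θ₀ T r)
  solvesAt : ∀ p ∈ cylinder θ₀ T r, ∀ I, F.SolvesAt I p.1 p.2

namespace FieldFamily.IsSolution

variable (h : F.IsSolution θ₀ T r pc qc)
include h

theorem deriv_p (I : Fin n) (A : Fin 2) :
    DifferentiableOn ℂ (deriv (pc I A)) (Metric.ball (θ₀ : ℂ) r) :=
  (h.diff_p I A).deriv Metric.isOpen_ball

theorem diff_W (I : Fin n) :
    DifferentiableOn ℂ ((vtdData pc qc).W I) (Metric.ball (θ₀ : ℂ) r) := by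
  have h1 : ∀ A, DifferentiableOn ℂ (fun z => (∑ J, pc J A z) + pc I A z)
      (Metric.ball (θ₀ : ℂ) r) := fun A =>
    (DifferentiableOn.fun_sum fun J _ => h.diff_p J A).add (h.diff_p I A)
  exact (((h1 0).const_mul 2).mul (h.diff_q I 1)).mul ((h1 1).const_mul (-2)).cexp

theorem holFamily_fieldState (i : Slot × Fin n) :
    HolFamily (cylinder θ₀ T r) fun t z => fieldState pc qc F t z i := by
  have hr := h.regular
  have hlog := HolFamily.log (Ω := cylinder θ₀ T r) pos_of_mem_cylinder
  have hsub : ∀ {f g : ℝ → ℂ → ℂ}, HolFamily (cylinder θ₀ T r) f →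
      HolFamily (cylinder θ₀ T r) g → HolFamily (cylinder θ₀ T r) fun t z => f t z - g t z :=
    fun hf hg => ⟨hf.cont.sub hg.cont, fun p hp => (hf.diff p hp).sub (hg.diff p hp)⟩
  obtain ⟨j, I⟩ := i
  cases j <;> simp only [fieldState]
  · exact hsub (hr.P I) (((HolFamily.of_differentiableOn (h.diff_p I 0)).mul hlog).add
      (HolFamily.of_differentiableOn (h.diff_p I 1)))
  · exact hsub (hr.DP I) (HolFamily.of_differentiableOn (h.diff_p I 0))
  · exact hsub ((hr.P I).deriv_z isOpen_cylinder)
      (((HolFamily.of_differentiableOn (h.deriv_p I 0)).mul hlog).add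
        (HolFamily.of_differentiableOn (h.deriv_p I 1)))
  · exact hsub (((HolFamily.const (-2)).mul (hr.S I)).cexp.mul (hr.DQ I))
      (HolFamily.of_differentiableOn (h.diff_W I))
  · exact hsub (hr.Q I) (HolFamily.of_differentiableOn (h.diff_q I 0))
  · exact hsub ((hr.Q I).deriv_z isOpen_cylinder)
      (HolFamily.of_differentiableOn ((h.diff_q I 0).deriv Metric.isOpen_ball))

theorem fieldState_c (I : Fin n) {t : ℝ} {z : ℂ} (ht : t ∈ Ioo 0 T)
    (hz : z ∈ Metric.ball (θ₀ : ℂ) r) :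
    fieldState pc qc F t z (.c, I) = deriv (fun v => fieldState pc qc F t v (.u, I)) z := by
  have hd : ∀ A, HasDerivAt (pc I A) (deriv (pc I A) z) z := fun A =>
    ((h.diff_p I A).differentiableAt (Metric.isOpen_ball.mem_nhds hz)).hasDerivAt
  exact (((h.regular.P I).diff (t, z) ⟨ht, hz⟩).hasDerivAt.sub
    (((hd 0).mul_const (Real.log t : ℂ)).add (hd 1))).deriv.symm

theorem fieldState_d (I : Fin n) {t : ℝ} {z : ℂ} (ht : t ∈ Ioo 0 T)
    (hz : z ∈ Metric.ball (θ₀ : ℂ) r) :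
    fieldState pc qc F t z (.d, I) = deriv (fun v => fieldState pc qc F t v (.y, I)) z :=
  (((h.regular.Q I).diff (t, z) ⟨ht, hz⟩).hasDerivAt.sub
    ((h.diff_q I 0).differentiableAt (Metric.isOpen_ball.mem_nhds hz)).hasDerivAt).deriv.symm

theorem deriv_fieldState_c (I : Fin n) {t : ℝ} {z : ℂ} (ht : t ∈ Ioo 0 T)
    (hz : z ∈ Metric.ball (θ₀ : ℂ) r) :
    deriv (fun v => fieldState pc qc F t v (.c, I)) z = deriv (deriv (F.P I t)) z
      - ((vtdData pc qc).b₀ I z * Real.log t + (vtdData pc qc).b₁ I z) := by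
  have hd : ∀ A, HasDerivAt (deriv (pc I A)) (deriv (deriv (pc I A)) z) z := fun A =>
    ((h.deriv_p I A).differentiableAt (Metric.isOpen_ball.mem_nhds hz)).hasDerivAt
  exact ((((h.regular.P I).deriv_z isOpen_cylinder).diff (t, z) ⟨ht, hz⟩).hasDerivAt.sub
    (((hd 0).mul_const (Real.log t : ℂ)).add (hd 1))).deriv

omit h in
theorem rhs_y (I : Fin n) (t : ℝ) (z : ℂ) :
    vtdRHS (vtdData pc qc) (fieldState pc qc F) t z (.y, I) = F.DQ I t z := by
  simp only [vtdRHS, fieldState_S]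
  simp only [fieldState]
  linear_combination F.DQ I t z * exp_two_mul_exp_neg_two (F.S I t z)

omit h in
theorem rhs_d (I : Fin n) (t : ℝ) (z : ℂ) :
    vtdRHS (vtdData pc qc) (fieldState pc qc F) t z (.d, I) = deriv (F.DQ I t) z := by
  rw [show F.DQ I t = fun v => vtdRHS (vtdData pc qc) (fieldState pc qc F) t v (.y, I) from
    funext fun v => (rhs_y I t v).symm]
  rfl

/-- Converse of `IsSystemSolution.solvesAt`. The equations for u and y hold by definition of a and
w, those for c and d are their spatial derivatives, and those for a and w are the field equations,
the latter as a conservation law. -/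
theorem euler_fieldState (i : Slot × Fin n) :
    HasEuler (cylinder θ₀ T r) (fun t z => fieldState pc qc F t z i)
      (fun t z => vtdRHS (vtdData pc qc) (fieldState pc qc F) t z i) := by
  have hr := h.regular
  have hlog := fun g : ℂ → ℂ => HasEuler.mul_log (Ω := cylinder θ₀ T r) pos_of_mem_cylinder g
  obtain ⟨j, I⟩ := i
  cases j
  · exact ((hr.euler_P I).sub ((hlog (pc I 0)).add (.space (pc I 1)))).congr_right
      fun p _ => by simp only [vtdRHS, fieldState, add_zero]
  · refine ((hr.euler_DP I).sub (.space (pc I 0))).congr_right fun p hp => ?_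
    have h1 := (h.solvesAt p hp I).1
    have h2 := h.deriv_fieldState_c (qc := qc) I hp.1 hp.2
    simp only [vtdRHS, fieldState_S]
    rw [h2]
    simp only [fieldState, vtdData]
    linear_combination -h1 - (1 / 2) * Complex.exp (-2 * F.S I p.1 p.2) * F.DQ I p.1 p.2 ^ 2
      * exp_two_mul_exp_neg_two (F.S I p.1 p.2)
  · refine (((hr.euler_P I).deriv_z isOpen_cylinder pos_of_mem_cylinder (hr.P I) (hr.DP I)).sub
      ((hlog (deriv (pc I 0))).add (.space (deriv (pc I 1))))).congr_right fun p hp => ?_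
    simp only [vtdRHS, fieldState, add_zero]
    exact (((hr.DP I).diff p hp).hasDerivAt.sub ((h.diff_p I 0).differentiableAt
      (Metric.isOpen_ball.mem_nhds hp.2)).hasDerivAt).deriv
  · refine ((((hr.euler_S I).const_mul (-2)).cexp.mul (hr.euler_DQ I)).sub
      (.space ((vtdData pc qc).W I))).congr_right fun p hp => ?_
    have h1 := (h.solvesAt p hp I).2
    have h2 := deriv_flux (c := (p.1 : ℂ) ^ 2) ((hr.S I).diff p hp)
      (((hr.Q I).deriv_z isOpen_cylinder).diff p hp)
    simp only [vtdRHS, fieldState_S]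
    simp only [fieldState, vtdData, add_sub_cancel]
    rw [h2]
    linear_combination -Complex.exp (-2 * F.S I p.1 p.2) * h1
  · exact ((hr.euler_Q I).sub (.space (qc I 0))).congr_right fun p _ => by
      rw [rhs_y, sub_zero]
  · exact (((hr.euler_Q I).deriv_z isOpen_cylinder pos_of_mem_cylinder (hr.Q I) (hr.DQ I)).sub
      (.space (deriv (qc I 0)))).congr_right fun p _ => by rw [rhs_d, sub_zero]

theorem solvesSystem :
    SolvesSystem (vtdData pc qc) (cylinder θ₀ T r) (fieldState pc qc F) :=
  fun p hp i => h.euler_fieldState i p hp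

end FieldFamily.IsSolution

end State

/-! ### Decay of a given solution, bootstrapped from its leading order -/

section Asymptotics

theorem Decay.of_tendstoUniformlyOn {z₀ : ℂ} {r : ℝ} {K : ℝ → ℂ → ℂ}
    (h : TendstoUniformlyOn K (fun _ => 0) (𝓝[>] 0) (Metric.ball z₀ r)) : Decay z₀ r 0 K := by
  refine ⟨1, zero_le_one, ?_⟩
  filter_upwards [Metric.tendstoUniformlyOn_iff.1 h 1 one_pos] with t h1 z hz
  have := h1 z hz
  rw [dist_zero_left] at this
  rw [Real.rpow_zero, one_mul]
  exact this.le

/-- Freezing z lets the uniform lemmas serve pointwise, with a dummy disc. It is needed in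
`limit_w`, where the limit l is not known in advance to be bounded on the disc. -/
theorem Decay.at_point {z₀ z : ℂ} {r β : ℝ} {f : ℝ → ℂ → ℂ} (h : Decay z₀ r β f)
    (hz : z ∈ Metric.ball z₀ r) : Decay 0 1 β fun t _ => f t z := by
  obtain ⟨C, hC, hf⟩ := h
  exact ⟨C, hC, hf.mono fun t h1 _ _ => h1 z hz⟩

theorem eq_zero_of_tendsto_mul_log {c l : ℂ}
    (h : Tendsto (fun t : ℝ => c * Real.log t) (𝓝[>] 0) (𝓝 l)) : c = 0 := by
  by_contra hc
  have h1 := ((h.const_mul c⁻¹).congr fun t => inv_mul_cancel_left₀ hc _).norm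
  have h2 : Tendsto (fun t : ℝ => ‖(Real.log t : ℂ)‖) (𝓝[>] 0) atTop := by
    simp only [Complex.norm_real, Real.norm_eq_abs]
    exact tendsto_abs_atBot_atTop.comp Real.tendsto_log_nhdsGT_zero
  exact not_tendsto_nhds_of_tendsto_atTop h2 _ h1

variable {n : ℕ} {θ₀ T ρ B μ ε : ℝ} {pc qc : Fin n → Fin 2 → ℂ → ℂ} {F : FieldFamily n}
  {K : Fin n → ℝ → ℂ → ℂ}

/-- A solution with the prescribed leading order behaviour. -/
structure FieldFamily.IsAsymptotic (F : FieldFamily n) (θ₀ T ρ B μ ε : ℝ)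
    (pc qc : Fin n → Fin 2 → ℂ → ℂ) (K : Fin n → ℝ → ℂ → ℂ) : Prop where
  T_pos : 0 < T
  ε_pos : 0 < ε
  bounded : (vtdData pc qc).Bounded θ₀ ρ B (fun _ => μ) μ
  q_le : ∀ I, ∀ z ∈ Metric.ball (θ₀ : ℂ) (2 * ρ), ‖qc I 1 z‖ ≤ B
  isSolution : F.IsSolution θ₀ T (2 * ρ) pc qc
  decay_u : ∀ I, Decay θ₀ (2 * ρ) ε fun t z => fieldState pc qc F t z (.u, I)
  y_eq : ∀ I, ∀ t ∈ Ioo 0 T, ∀ z ∈ Metric.ball (θ₀ : ℂ) (2 * ρ), fieldState pc qc F t z (.y, I)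
    = powFamily (fun z => 2 * (vtdData pc qc).k I z) t z * (qc I 1 z + K I t z)
  tendsto_K : ∀ I, TendstoUniformlyOn (K I) (fun _ => 0) (𝓝[>] 0) (Metric.ball (θ₀ : ℂ) (2 * ρ))

namespace FieldFamily.IsAsymptotic

variable (h : F.IsAsymptotic θ₀ T ρ B μ ε pc qc K)
include h

theorem slice (i : Slot × Fin n) {r : ℝ} (hr : r ≤ 2 * ρ) :
    ∀ t ∈ Ioo 0 T, DifferentiableOn ℂ (fun z => fieldState pc qc F t z i)
      (Metric.ball (θ₀ : ℂ) r) := fun _ ht =>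
  (h.isSolution.holFamily_fieldState i).slice fun _ hw => ⟨ht, Metric.ball_subset_ball hr hw⟩

theorem hasDerivAt (i : Slot × Fin n) {r : ℝ} (hr : r ≤ 2 * ρ) :
    ∀ t ∈ Ioo 0 T, ∀ z ∈ Metric.ball (θ₀ : ℂ) r,
      HasDerivAt (fun s => fieldState pc qc F s z i)
        (t⁻¹ • vtdRHS (vtdData pc qc) (fieldState pc qc F) t z i) t := fun t ht z hz =>
  h.isSolution.solvesSystem (t, z) ⟨ht, Metric.ball_subset_ball hr hz⟩ i

theorem two_k_le (I : Fin n) :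
    ∀ z ∈ Metric.ball (θ₀ : ℂ) (2 * ρ), 3 * μ ≤ (2 * (vtdData pc qc).k I z).re := fun z hz => by
  have := h.bounded.le_k I z hz
  simp only [Complex.mul_re, Complex.re_ofNat, Complex.im_ofNat, zero_mul, sub_zero]
  linarith

/-- Start of the bootstrap, from the leading order of y alone. The target exponent for all
components is 3μ, the value of e + 2μ for e = μ; it exceeds every weight, since these are at most
2μ. Each spatial derivative costs some radius, from 2ρ down to ρ. -/
theorem decay_y (I : Fin n) :
    Decay θ₀ (2 * ρ) (3 * μ) fun t z => fieldState pc qc F t z (.y, I) :=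
  ((Decay.powFamily (h.two_k_le I)).mul_bounded ((Decay.of_bounded (h.q_le I)).add
    (.of_tendstoUniformlyOn (h.tendsto_K I)))).congr h.T_pos (h.y_eq I)

theorem decay_d (I : Fin n) :
    Decay θ₀ (7 / 4 * ρ) (3 * μ) fun t z => fieldState pc qc F t z (.d, I) := by
  have hρ := h.bounded.ρ_pos
  exact ((h.decay_y I).deriv_z (by linarith) h.T_pos (h.slice _ le_rfl)).congr h.T_pos
    fun t ht z hz => h.isSolution.fieldState_d I ht
      (Metric.ball_subset_ball (by linarith) hz)

/-- Boundedness of c suffices at this stage, because c enters the right-hand sides only through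
t²∂c. -/
theorem decay_c_zero (I : Fin n) :
    Decay θ₀ (7 / 4 * ρ) 0 fun t z => fieldState pc qc F t z (.c, I) := by
  have hρ := h.bounded.ρ_pos
  exact (((h.decay_u I).mono_exp h.ε_pos.le).deriv_z (by linarith) h.T_pos
    (h.slice _ le_rfl)).congr h.T_pos
    fun t ht z hz => h.isSolution.fieldState_c I ht
      (Metric.ball_subset_ball (by linarith) hz)

theorem decay_ξ_add (I : Fin n) : Decay θ₀ (7 / 4 * ρ) 0 fun t z =>
    (vtdData pc qc).ξ I z + fieldState pc qc F t z (.d, I) := by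
  have hρ := h.bounded.ρ_pos
  have hμ := h.bounded.μ_pos
  exact ((Decay.of_bounded (h.bounded.ξ_le I)).mono_radius (by linarith)).add
    ((h.decay_d I).mono_exp (by linarith))

theorem decay_exp_neg_S (I : Fin n) : Decay θ₀ (7 / 4 * ρ) (3 * μ) fun t z => (t : ℂ) ^ 2
    * Complex.exp (-2 * (vtdData pc qc).S I t z fun J => fieldState pc qc F t z (.u, J)) := by
  have hρ := h.bounded.ρ_pos
  exact (Decay.exp_neg_S (u := fun J t z => fieldState pc qc F t z (.u, J))
    (fun z hz => by linarith [h.bounded.k_le I z hz]) (h.bounded.s_le I)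
    fun J => (h.decay_u J).mono_exp h.ε_pos.le).mono_radius (by linarith)

theorem decay_exp_S (I : Fin n) : Decay θ₀ (2 * ρ) (3 * μ) fun t z =>
    Complex.exp (2 * (vtdData pc qc).S I t z fun J => fieldState pc qc F t z (.u, J)) :=
  Decay.exp_S (u := fun J t z => fieldState pc qc F t z (.u, J))
    (fun z hz => by linarith [h.bounded.le_k I z hz]) (h.bounded.s_le I)
    fun J => (h.decay_u J).mono_exp h.ε_pos.le

/-- The flux needs only y, d and boundedness of u, not the momentum. Hence w can be treated first,
before anything is known about a. -/
theorem decay_rhs_w (I : Fin n) : Decay θ₀ (3 / 2 * ρ) (3 * μ) fun t z =>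
    vtdRHS (vtdData pc qc) (fieldState pc qc F) t z (.w, I) := by
  have hρ := h.bounded.ρ_pos
  have hr := h.isSolution.regular
  refine ((h.decay_exp_neg_S I).mul_bounded (h.decay_ξ_add I)).deriv_z (by linarith) h.T_pos
    fun t ht => ?_
  simp only [fieldState_S]
  refine HolFamily.slice (Ω := cylinder θ₀ T (2 * ρ)) (f := fun t z => (t : ℂ) ^ 2
    * Complex.exp (-2 * F.S I t z) * ((vtdData pc qc).ξ I z + fieldState pc qc F t z (.d, I)))
    ((HolFamily.ofReal_sq.mul ((HolFamily.const (-2)).mul (hr.S I)).cexp).mul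
    ((HolFamily.of_differentiableOn (h.bounded.hξ I)).add
      (h.isSolution.holFamily_fieldState (.d, I)))) fun w hw =>
    ⟨ht, Metric.ball_subset_ball (by linarith) hw⟩

/-- The limit of `e ^ (-2 (P + P_I)) 𝒟 Q` is determined by the leading order of `Q`. -/
theorem limit_w (I : Fin n) {l : ℂ → ℂ}
    (hl : Decay θ₀ (3 / 2 * ρ) (3 * μ) fun t z => fieldState pc qc F t z (.w, I) - l z) :
    ∀ z ∈ Metric.ball (θ₀ : ℂ) (3 / 2 * ρ), l z = 0 := by
  intro z hz
  have hρ := h.bounded.ρ_pos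
  have hμ := h.bounded.μ_pos
  have hz2 : z ∈ Metric.ball (θ₀ : ℂ) (2 * ρ) := Metric.ball_subset_ball (by linarith) hz
  obtain ⟨β, hβ, hβε, hβμ⟩ : ∃ β > 0, β ≤ ε ∧ β ≤ 3 * μ :=
    ⟨min ε (3 * μ), lt_min h.ε_pos (by linarith), min_le_left _ _, min_le_right _ _⟩
  have hk := h.two_k_le I z hz2
  have hk0 : 2 * (vtdData pc qc).k I z ≠ 0 := fun h0 => by
    rw [h0, Complex.zero_re] at hk
    linarith
  have hu : ∀ J, Decay 0 1 β fun t _ => fieldState pc qc F t z (.u, J) := fun J =>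
    ((h.decay_u J).at_point hz2).mono_exp hβε
  have hw : Decay 0 1 β fun t _ => fieldState pc qc F t z (.w, I) - l z :=
    (hl.at_point hz).mono_exp hβμ
  have hWw : Decay 0 1 0 fun t _ => (vtdData pc qc).W I z + fieldState pc qc F t z (.w, I) :=
    ((Decay.const ((vtdData pc qc).W I z + l z)).add (hw.mono_exp hβ.le)).congr one_pos
      fun t _ v _ => by ring
  have hg : Decay 0 1 β fun t _ => ((Complex.exp (2 * ((∑ J, fieldState pc qc F t z (.u, J))
      + fieldState pc qc F t z (.u, I))) - 1)
      * ((vtdData pc qc).W I z + fieldState pc qc F t z (.w, I))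
      + (fieldState pc qc F t z (.w, I) - l z)) * Complex.exp (2 * (vtdData pc qc).s I z) :=
    (((((Decay.sum hu).add (hu I)).const_mul 2).exp_sub_one hβ).mul_bounded hWw |>.add
      hw).mul_bounded (Decay.const _)
  -- The coefficient of t^{2k} in y that a limit l of w would produce, obtained by integrating 𝒟y ≈
  -- t^{2k} e^{2s} (W + l).
  obtain ⟨c, hc⟩ : ∃ c, c = ((vtdData pc qc).W I z + l z) * Complex.exp (2 * (vtdData pc qc).s I z)
    / (2 * (vtdData pc qc).k I z) := ⟨_, rfl⟩
  have hc' : c * (2 * (vtdData pc qc).k I z)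
      = ((vtdData pc qc).W I z + l z) * Complex.exp (2 * (vtdData pc qc).s I z) := by
    rw [hc, div_mul_cancel₀ _ hk0]
  have hV := hg.integrate_pow (k := fun _ => 2 * (vtdData pc qc).k I z)
    (V := fun t _ => fieldState pc qc F t z (.y, I)
      - powFamily (fun z => 2 * (vtdData pc qc).k I z) t z * c) hβ h.T_pos
    (fun _ _ => by linarith) (fun t ht v _ => ?_) (fun v _ => ?_)
  · have h1 := hV.tendsto hβ (Metric.mem_ball_self one_pos)
    have h2 : Tendsto (fun t => qc I 1 z + K I t z - c) (𝓝[>] 0) (𝓝 (qc I 1 z + 0 - c)) :=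
      (((h.tendsto_K I).tendsto_at hz2).const_add _).sub_const _
    -- By the prescribed form t^{-2k}(y - t^{2k} c) = q₁ + K - c, and this tends to 0. Hence q₁ = c,
    -- and comparison with e^{2s} W = 2k q₁ leaves e^{2s} l = 0.
    have h3 := tendsto_nhds_unique h2 <| h1.congr' <| by
      filter_upwards [eventually_pos_lt h.T_pos] with t ht
      rw [h.y_eq I t ht z hz2]
      have := powFamily_neg_mul (fun z => 2 * (vtdData pc qc).k I z) t z
      simp only [powFamily] at this ⊢
      linear_combination (qc I 1 z + K I t z - c) * this
    have h4 := vtdData_W_mul_exp pc qc I z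
    have h5 : l z * Complex.exp (2 * (vtdData pc qc).s I z) = 0 := by
      linear_combination -(2 * (vtdData pc qc).k I z) * h3 - hc' - h4
    exact (mul_eq_zero.1 h5).resolve_right (Complex.exp_ne_zero _)
  · refine ((h.hasDerivAt (.y, I) le_rfl t ht z hz2).sub
      ((HasEuler.powFamily (Ω := cylinder θ₀ T (2 * ρ)) pos_of_mem_cylinder
        (fun z => 2 * (vtdData pc qc).k I z) (t, z) ⟨ht, hz2⟩).mul_const c)).congr_deriv ?_
    rw [smul_mul_assoc, ← smul_sub]
    congr 1
    simp only [vtdRHS]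
    rw [VTDData.exp_two_S]
    simp only [powFamily]
    linear_combination -Complex.exp (2 * (vtdData pc qc).k I z * Real.log t) * hc'
  · have h1 := (h.decay_y I).tendsto (by linarith) hz2
    have h2 := ((Decay.powFamily (h.two_k_le I)).tendsto (by linarith) hz2).mul_const c
    simpa using h1.sub h2

theorem decay_w (I : Fin n) :
    Decay θ₀ (3 / 2 * ρ) (3 * μ) fun t z => fieldState pc qc F t z (.w, I) := by
  have hρ := h.bounded.ρ_pos
  obtain ⟨l, -, hl⟩ := (h.decay_rhs_w I).exists_limit (by linarith [h.bounded.μ_pos]) h.T_pos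
    (h.hasDerivAt (.w, I) (by linarith))
  exact hl.congr h.T_pos fun t _ z hz => by rw [h.limit_w I hl z hz, sub_zero]

theorem decay_W_add (I : Fin n) : Decay θ₀ (3 / 2 * ρ) 0 fun t z =>
    (vtdData pc qc).W I z + fieldState pc qc F t z (.w, I) := by
  have hρ := h.bounded.ρ_pos
  have hμ := h.bounded.μ_pos
  exact ((Decay.of_bounded (h.bounded.W_le I)).mono_radius (by linarith)).add
    ((h.decay_w I).mono_exp (by linarith))

theorem decay_rhs_a (I : Fin n) : Decay θ₀ (3 / 2 * ρ) (3 * μ) fun t z =>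
    vtdRHS (vtdData pc qc) (fieldState pc qc F) t z (.a, I) := by
  have hρ := h.bounded.ρ_pos
  have hμ := h.bounded.e_le I
  have h1 : Decay θ₀ (3 / 2 * ρ) (3 * μ) fun t z =>
      (t : ℂ) ^ 2 * deriv (fun v => fieldState pc qc F t v (.c, I)) z :=
    (Decay.sq.mul ((h.decay_c_zero I).deriv_z (by linarith) h.T_pos
      (h.slice _ (by linarith)))).mono_exp (by linarith)
  have h2 : Decay θ₀ (3 / 2 * ρ) (3 * μ) fun t z =>
      (t : ℂ) ^ 2 * ((vtdData pc qc).b₀ I z * Real.log t + (vtdData pc qc).b₁ I z) :=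
    ((Decay.sq_mul_log (h.bounded.b₀_le I) (h.bounded.b₁_le I) h.bounded.B_nonneg).mono_exp
      (by linarith)).mono_radius (by linarith)
  have h3 := (((h.decay_exp_S I).mono_radius (by linarith)).mul_bounded
    (h.decay_W_add I)).mul_bounded (h.decay_W_add I)
  have h4 := (((h.decay_exp_neg_S I).mul_bounded (h.decay_ξ_add I)).mul_bounded
    (h.decay_ξ_add I)).mono_radius (r' := 3 / 2 * ρ) (by linarith)
  refine (h1.add (h2.add ((h3.const_mul (-1 / 2)).add (h4.const_mul (1 / 2))))).congr h.T_pos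
    fun t _ z _ => ?_
  simp only [vtdRHS]
  ring

/-- The limit of `𝒟 u` vanishes, since `u` would grow logarithmically otherwise. -/
theorem decay_a (I : Fin n) :
    Decay θ₀ (3 / 2 * ρ) (3 * μ) fun t z => fieldState pc qc F t z (.a, I) := by
  have hρ := h.bounded.ρ_pos
  have hμ : 0 < 3 * μ := by linarith [h.bounded.μ_pos]
  obtain ⟨l, -, hl⟩ := (h.decay_rhs_a I).exists_limit hμ h.T_pos
    (h.hasDerivAt (.a, I) (by linarith))
  -- The Euler derivative of u - l ln t is a - l = O(t^{3μ}), so u - l ln t converges. As u → 0, the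
  -- term l ln t converges too, which forces l = 0.
  obtain ⟨m, hm, -⟩ := hl.exists_limit hμ h.T_pos
    (f := fun t z => fieldState pc qc F t z (.u, I) - l z * Real.log t) fun t ht z hz => by
      refine ((h.hasDerivAt (.u, I) (by linarith) t ht z hz).sub (HasEuler.mul_log
        (Ω := cylinder θ₀ T (3 / 2 * ρ)) pos_of_mem_cylinder l (t, z) ⟨ht, hz⟩)).congr_deriv ?_
      rw [← smul_sub]
      rfl
  refine hl.congr h.T_pos fun t _ z hz => ?_
  have h1 := ((h.decay_u I).tendsto h.ε_pos
    (Metric.ball_subset_ball (by linarith) hz)).sub (hm z hz)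
  rw [eq_zero_of_tendsto_mul_log (c := l z) (h1.congr fun t => by ring), sub_zero]

/-- Replaces the given rate t^ε, with ε > 0 arbitrary, by a rate fixed by the data. This is why
solutions with different exponents ε can be compared. -/
theorem decay_u' (I : Fin n) :
    Decay θ₀ (3 / 2 * ρ) (3 * μ) fun t z => fieldState pc qc F t z (.u, I) := by
  have hρ := h.bounded.ρ_pos
  exact (h.decay_a I).integrate (by linarith [h.bounded.μ_pos]) h.T_pos
    (h.hasDerivAt (.u, I) (by linarith)) fun z hz =>
      (h.decay_u I).tendsto h.ε_pos (Metric.ball_subset_ball (by linarith) hz)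

theorem decay_c (I : Fin n) :
    Decay θ₀ ρ (3 * μ) fun t z => fieldState pc qc F t z (.c, I) := by
  have hρ := h.bounded.ρ_pos
  exact ((h.decay_u' I).deriv_z (by linarith) h.T_pos (h.slice _ (by linarith))).congr h.T_pos
    fun t ht z hz => h.isSolution.fieldState_c I ht (Metric.ball_subset_ball (by linarith) hz)

theorem decay (i : Slot × Fin n) :
    Decay θ₀ ρ (3 * μ) fun t z => fieldState pc qc F t z i := by
  have hρ := h.bounded.ρ_pos
  obtain ⟨j, I⟩ := i
  cases j
  · exact (h.decay_u' I).mono_radius (by linarith)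
  · exact (h.decay_a I).mono_radius (by linarith)
  · exact h.decay_c I
  · exact (h.decay_w I).mono_radius (by linarith)
  · exact (h.decay_y I).mono_radius (by linarith)
  · exact (h.decay_d I).mono_radius (by linarith)

/-- The rescaled first order unknowns become arbitrarily small. -/
theorem eventually_le : ∀ᶠ t in 𝓝[>] (0 : ℝ), ∀ i, ∀ z ∈ Metric.ball (θ₀ : ℂ) ρ,
    ‖fieldState pc qc F t z i‖ ≤ ρ * t ^ slotWeight (fun _ => μ) μ i := by
  refine eventually_all.2 fun i => (h.decay i).eventually_le ?_ h.bounded.ρ_pos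
  have hμ := h.bounded.μ_pos
  obtain ⟨j, I⟩ := i
  cases j <;> simp only [slotWeight] <;> linarith

end FieldFamily.IsAsymptotic

end Asymptotics

/-! ### Uniqueness of solutions with given data -/

section Uniqueness

variable {n : ℕ} {θ₀ T r : ℝ} {p q : Fin n → Fin 2 → ℝ → ℝ} {ε : Fin n → ℝ}
  {P Q : Fin n → ℝ → ℝ → ℝ}

theorem exists_hasEuler {Ω : Set (ℝ × ℂ)} {f : ℝ → ℂ → ℂ} (hΩ : IsOpen Ω)
    (hpos : ∀ p ∈ Ω, 0 < p.1) (hC : ContDiffOn ℝ 2 (Function.uncurry f) Ω) (hf : HolFamily Ω f) :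
    ∃ G H : ℝ → ℂ → ℂ, HolFamily Ω G ∧ HolFamily Ω H ∧ HasEuler Ω f G ∧ HasEuler Ω G H := by
  obtain ⟨g, k, -, hg, hk, hfg, hgk⟩ := HolFamily.of_contDiffOn_two hΩ hC hf.diff
  exact ⟨_, _, HolFamily.ofReal.mul hg, (HolFamily.ofReal.mul hg).add
    (HolFamily.ofReal.mul (HolFamily.ofReal.mul hk)), .of_hasDerivAt hpos hfg,
    (HasEuler.ofReal hpos).mul (.of_hasDerivAt hpos hgk)⟩

theorem exists_pos_forall_lt {ι : Type*} [Finite ι] {m : ι → ℝ} (hm : ∀ i, 0 < m i) :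
    ∃ δ > 0, ∀ i, δ < m i :=
  ((eventually_all.2 fun i => nhdsWithin_le_nhds (gt_mem_nhds (hm i))).and
    (self_mem_nhdsWithin (s := Ioi (0 : ℝ)) (a := 0))).exists.imp fun _ h => ⟨h.2, h.1⟩

/-- The holomorphic extension of a solution of the prescribed form. -/
theorem IsSolutionOfForm.exists_isAsymptotic {R ρ B μ : ℝ} {pc qc : Fin n → Fin 2 → ℂ → ℂ}
    (h : IsSolutionOfForm θ₀ p q ε T r P Q) (hε : ∀ I, 0 < ε I) (hp : IsComplexification θ₀ R pc p)
    (hq : IsComplexification θ₀ R qc q) (hρR : 2 * ρ ≤ R) (hρr : 2 * ρ ≤ r)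
    (hb : (vtdData pc qc).Bounded θ₀ ρ B (fun _ => μ) μ)
    (hqB : ∀ I, ∀ z ∈ Metric.ball (θ₀ : ℂ) (2 * ρ), ‖qc I 1 z‖ ≤ B) :
    ∃ (F : FieldFamily n) (ε' : ℝ) (K : Fin n → ℝ → ℂ → ℂ),
      F.IsAsymptotic θ₀ T ρ B μ ε' pc qc K ∧ (∀ I, Extends θ₀ T (2 * ρ) (P I) (F.P I)) ∧
      ∀ I, Extends θ₀ T (2 * ρ) (Q I) (F.Q I) := by
  obtain ⟨hT, hr, ⟨-, -, hsol⟩, π, κ, hπ, hκ, hform⟩ := h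
  choose Fπ hπC hπd hπt hπe using hπ
  choose Fκ hκC hκd hκt hκe using hκ
  obtain ⟨ε', hε', hεlt⟩ := exists_pos_forall_lt hε
  have hp' := hp.mono hρR
  have hq' := hq.mono hρR
  have hball : Metric.ball (θ₀ : ℂ) (2 * ρ) ⊆ Metric.ball (θ₀ : ℂ) r :=
    Metric.ball_subset_ball hρr
  have hsub : cylinder θ₀ T (2 * ρ) ⊆ cylinder θ₀ T r := prod_mono subset_rfl hball
  have hIoo : ∀ θ ∈ Ioo (θ₀ - 2 * ρ) (θ₀ + 2 * ρ), θ ∈ Ioo (θ₀ - r) (θ₀ + r) := fun θ hθ =>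
    ⟨by linarith [hθ.1], by linarith [hθ.2]⟩
  have hpos : ∀ p ∈ cylinder θ₀ T (2 * ρ), 0 < p.1 := pos_of_mem_cylinder
  have hol : ∀ {f : ℝ → ℂ → ℂ}, ContDiffOn ℝ 2 (Function.uncurry f) (cylinder θ₀ T r) →
      (∀ t ∈ Ioo 0 T, DifferentiableOn ℂ (f t) (Metric.ball (θ₀ : ℂ) r)) →
      HolFamily (cylinder θ₀ T (2 * ρ)) f := fun hC hd =>
    HolFamily.mono ⟨hC.continuousOn, fun p hp =>
      (hd p.1 hp.1).differentiableAt (Metric.isOpen_ball.mem_nhds hp.2)⟩ hsub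
  have hsp : ∀ {g : ℂ → ℂ}, DifferentiableOn ℂ g (Metric.ball (θ₀ : ℂ) (2 * ρ)) →
      HolFamily (cylinder θ₀ T (2 * ρ)) fun _ z => g z := HolFamily.of_differentiableOn
  have hkd : ∀ I, ∀ p ∈ cylinder θ₀ T (2 * ρ),
      DifferentiableAt ℂ (fun z => 2 * (vtdData pc qc).k I z) p.2 := fun I p hp =>
    ((hb.hk I).differentiableAt (Metric.isOpen_ball.mem_nhds hp.2)).const_mul 2
  have hεd : ∀ I, ∀ p ∈ cylinder θ₀ T (2 * ρ), DifferentiableAt ℂ (fun _ : ℂ => (ε I : ℂ)) p.2 :=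
    fun I p hp => differentiableAt_const _
  set P₀ : Fin n → ℝ → ℂ → ℂ := fun I t z => pc I 0 z * Real.log t + pc I 1 z with hP₀
  -- The form (*) itself, read with the extended data and remainders and with complex exponents,
  -- defines the holomorphic extension of the fields.
  set Pc : Fin n → ℝ → ℂ → ℂ := fun I t z =>
    P₀ I t z + powFamily (fun _ => (ε I : ℂ)) t z * Fπ I t z with hPc
  set Qc : Fin n → ℝ → ℂ → ℂ := fun I t z =>
    qc I 0 z + powFamily (fun z => 2 * (vtdData pc qc).k I z) t z * (qc I 1 z + Fκ I t z) with hQc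
  have hP₀h : ∀ I, HolFamily (cylinder θ₀ T (2 * ρ)) (P₀ I) := fun I =>
    ((hsp (hp'.diff I 0)).mul (.log hpos)).add (hsp (hp'.diff I 1))
  have hPh : ∀ I, HolFamily (cylinder θ₀ T (2 * ρ)) (Pc I) := fun I =>
    (hP₀h I).add ((HolFamily.powFamily hpos (hεd I)).mul (hol (hπC I) (hπd I)))
  have hQh : ∀ I, HolFamily (cylinder θ₀ T (2 * ρ)) (Qc I) := fun I =>
    (hsp (hq'.diff I 0)).add ((HolFamily.powFamily hpos (hkd I)).mul
      ((hsp (hq'.diff I 1)).add (hol (hκC I) (hκd I))))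
  have hP₀C : ∀ I, ContDiffOn ℝ 2 (Function.uncurry (P₀ I)) (cylinder θ₀ T (2 * ρ)) := fun I =>
    contDiffOn_of_hasEuler isOpen_cylinder hpos (hP₀h I) (hsp (hp'.diff I 0)) (.const 0)
      (((HasEuler.mul_log hpos _).add (.space _)).congr_right fun _ _ => (add_zero _).symm)
      (.space _)
  have hPC : ∀ I, ContDiffOn ℝ 2 (Function.uncurry (Pc I)) (cylinder θ₀ T (2 * ρ)) := fun I =>
    (hP₀C I).add ((IsSystemSolution.contDiffOn_powFamily (hεd I)).mul ((hπC I).mono hsub))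
  have hQC : ∀ I, ContDiffOn ℝ 2 (Function.uncurry (Qc I)) (cylinder θ₀ T (2 * ρ)) := fun I =>
    (IsSystemSolution.contDiffOn_space (hsp (hq'.diff I 0))).add
      ((IsSystemSolution.contDiffOn_powFamily (hkd I)).mul
      ((IsSystemSolution.contDiffOn_space (hsp (hq'.diff I 1))).add ((hκC I).mono hsub)))
  choose DP DDP hDP hDDP eP eDP using fun I => exists_hasEuler isOpen_cylinder hpos (hPC I) (hPh I)
  choose DQ DDQ hDQ hDDQ eQ eDQ using fun I => exists_hasEuler isOpen_cylinder hpos (hQC I) (hQh I)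
  set F : FieldFamily n := ⟨Pc, DP, DDP, Qc, DQ, DDQ⟩ with hF
  have hreg : F.Regular (cylinder θ₀ T (2 * ρ)) :=
    ⟨hPh, hDP, hDDP, hQh, hDQ, hDDQ, eP, eDP, eQ, eDQ⟩
  have hPe : ∀ I, Extends θ₀ T (2 * ρ) (P I) (F.P I) := fun I t ht θ hθ => by
    simp only [hF, hPc, hP₀]
    rw [(hform t ht θ (hIoo θ hθ) I).1, pVTD, powFamily_ofReal ht.1 rfl,
      hπe I t ht θ (hIoo θ hθ), hp'.eq I 0 θ hθ, hp'.eq I 1 θ hθ]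
    push_cast
    rfl
  have hQe : ∀ I, Extends θ₀ T (2 * ρ) (Q I) (F.Q I) := fun I t ht θ hθ => by
    have hk : 2 * (vtdData pc qc).k I θ = ((2 * kExp p I θ : ℝ) : ℂ) := by
      rw [kExp_eq_re hp' I hθ]; push_cast; rfl
    simp only [hF, hQc]
    rw [(hform t ht θ (hIoo θ hθ) I).2, qVTD,
      powFamily_ofReal (k := fun z => 2 * (vtdData pc qc).k I z) ht.1 hk,
      hκe I t ht θ (hIoo θ hθ), hq'.eq I 0 θ hθ, hq'.eq I 1 θ hθ]
    push_cast
    ring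
  refine ⟨F, ε', Fκ, ?_, hPe, hQe⟩
  exact
    { T_pos := hT
      ε_pos := hε'
      bounded := hb
      q_le := hqB
      isSolution :=
        { diff_p := hp'.diff
          diff_q := hq'.diff
          regular := hreg
          solvesAt := hreg.solvesAt_of_real fun t ht θ hθ I =>
            (hreg.solvesAt_iff hPe hQe ht hθ I).2 (hsol t ht θ (hIoo θ hθ) I) }
      decay_u := fun I => ((((Decay.powFamily (k := fun _ => (ε I : ℂ)) (B := ε I)
          fun _ _ => by rw [Complex.ofReal_re]).mul_bounded
          ((Decay.of_tendstoUniformlyOn (hπt I)).mono_radius hρr))).mono_exp (hεlt I).le).congr hT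
        fun t _ z _ => by simp only [fieldState, hF, hPc, hP₀, add_sub_cancel_left]
      y_eq := fun I t _ z _ => by simp only [fieldState, hF, hQc, add_sub_cancel_left]
      tendsto_K := fun I => (hκt I).mono hball }

/-- Solutions of the prescribed form with the same data agree near `(0, θ₀)`. -/
theorem IsSolutionOfForm.unique {ε' : Fin n → ℝ} {T' r' : ℝ} {P' Q' : Fin n → ℝ → ℝ → ℝ}
    (hpq : AdmissibleData θ₀ p q) (hε : ∀ I, 0 < ε I) (hε' : ∀ I, 0 < ε' I)
    (h : IsSolutionOfForm θ₀ p q ε T r P Q) (h' : IsSolutionOfForm θ₀ p q ε' T' r' P' Q') :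
    ∃ T₁ > 0, ∃ r₁ > 0, ∀ t ∈ Ioo 0 T₁, ∀ θ ∈ Ioo (θ₀ - r₁) (θ₀ + r₁), ∀ I,
      P I t θ = P' I t θ ∧ Q I t θ = Q' I t θ := by
  obtain ⟨R₁, hR₁, pc, hpc⟩ := exists_isComplexification hpq.1
  obtain ⟨R₂, hR₂, qc, hqc⟩ := exists_isComplexification hpq.2.1
  have hp := hpc.mono (min_le_left R₁ R₂)
  have hq := hqc.mono (min_le_right R₁ R₂)
  have hk := hpq.2.2.self_of_nhds
  -- With e = μ the requirement e + 2μ < min(2k, 2 - 2k) becomes a bound on 3μ, independent of the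
  -- exponents ε and ε'.
  obtain ⟨μ, hμ, hμk⟩ := exists_pos_forall_lt (m := fun I =>
      min (2 * kExp p I θ₀ / 3) ((2 - 2 * kExp p I θ₀) / 3)) fun I =>
    lt_min (by linarith [(hk I).1]) (by linarith [(hk I).2])
  obtain ⟨B, ρ₀, hρ₀, hρR, hB⟩ := exists_bounded_vtdData (lt_min hR₁ hR₂) hp hq hμ
    (e := fun _ => μ) (fun _ => le_rfl)
    (fun I => by linarith [(lt_min_iff.1 (hμk I)).1]) fun I => by
      linarith [(lt_min_iff.1 (hμk I)).2]
  obtain ⟨ρ, hρ, hρρ₀, hρr, hρr'⟩ : ∃ ρ > 0, ρ ≤ ρ₀ ∧ 2 * ρ ≤ r ∧ 2 * ρ ≤ r' := by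
    have hr := h.2.1
    have hr' := h'.2.1
    refine ⟨min ρ₀ (min r r' / 2), by positivity, min_le_left _ _, ?_, ?_⟩
    · linarith [min_le_right ρ₀ (min r r' / 2), min_le_left r r']
    · linarith [min_le_right ρ₀ (min r r' / 2), min_le_right r r']
  obtain ⟨hb, hqB⟩ := hB ρ hρ hρρ₀
  obtain ⟨F, δ, K, hF, hFP, hFQ⟩ := h.exists_isAsymptotic hε hp hq (by linarith) hρr hb hqB
  obtain ⟨F', δ', K', hF', hFP', hFQ'⟩ := h'.exists_isAsymptotic hε' hp hq (by linarith) hρr' hb hqB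
  -- Before the time τ both solutions are defined and their rescaled unknowns lie in the ball of
  -- radius ρ, where the solution of the Fuchsian system is unique.
  obtain ⟨τ, hτ, hτs⟩ := mem_nhdsGT_iff_exists_Ioo_subset.1
    ((eventually_pos_lt h.1).and ((eventually_pos_lt h'.1).and
      (hF.eventually_le.and hF'.eventually_le)))
  have hball : Metric.ball (θ₀ : ℂ) ρ ⊆ Metric.ball (θ₀ : ℂ) (2 * ρ) :=
    Metric.ball_subset_ball (by linarith)
  obtain ⟨T₁, hT₁, r₁, hr₁, heq⟩ := system_unique hb (T := τ) hτ
    (x := fieldState pc qc F) (x' := fieldState pc qc F') <| by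
    rintro y (rfl | rfl)
    · refine ⟨fun p hp => ?_, fun p hp => ?_, fun p hp i => (hτs hp.1).2.2.1 i p.2 hp.2⟩
      · exact (holFamily_pi hF.isSolution.holFamily_fieldState).diff p ⟨(hτs hp.1).1, hball hp.2⟩
      · exact hF.isSolution.solvesSystem p ⟨(hτs hp.1).1, hball hp.2⟩
    · refine ⟨fun p hp => ?_, fun p hp => ?_, fun p hp i => (hτs hp.1).2.2.2 i p.2 hp.2⟩
      · exact (holFamily_pi hF'.isSolution.holFamily_fieldState).diff p
          ⟨(hτs hp.1).2.1, hball hp.2⟩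
      · exact hF'.isSolution.solvesSystem p ⟨(hτs hp.1).2.1, hball hp.2⟩
  refine ⟨min T₁ τ, lt_min hT₁ hτ, min r₁ ρ, lt_min hr₁ hρ, fun t ht θ hθ I => ?_⟩
  have ht' := hτs (show t ∈ Ioo 0 τ from ⟨ht.1, ht.2.trans_le (min_le_right _ _)⟩)
  have hθ' : θ ∈ Ioo (θ₀ - 2 * ρ) (θ₀ + 2 * ρ) :=
    ⟨by linarith [hθ.1, min_le_right r₁ ρ], by linarith [hθ.2, min_le_right r₁ ρ]⟩
  have key := heq t ⟨ht.1, ht.2.trans_le (min_le_left _ _)⟩ θ (ofReal_mem_ball.2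
    ⟨by linarith [hθ.1, min_le_left r₁ ρ], by linarith [hθ.2, min_le_left r₁ ρ]⟩)
  have hu := congrFun key (.u, I)
  have hy := congrFun key (.y, I)
  simp only [fieldState, sub_left_inj] at hu hy
  rw [hFP I t ht'.1 θ hθ', hFP' I t ht'.2.1 θ hθ'] at hu
  rw [hFQ I t ht'.1 θ hθ', hFQ' I t ht'.2.1 θ hθ'] at hy
  exact ⟨Complex.ofReal_inj.1 hu, Complex.ofReal_inj.1 hy⟩

end Uniqueness

/-! ### The data as limits of the solution -/

section Freedom

variable {n : ℕ} {θ₀ θ T r : ℝ} {p q : Fin n → Fin 2 → ℝ → ℝ} {ε : Fin n → ℝ}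
  {P Q : Fin n → ℝ → ℝ → ℝ}

theorem IsAnalyticRemainder.tendsto {f : ℝ → ℝ → ℝ} (h : IsAnalyticRemainder θ₀ T r f)
    (hT : 0 < T) (hθ : θ ∈ Ioo (θ₀ - r) (θ₀ + r)) :
    Tendsto (fun t => f t θ) (𝓝[>] 0) (𝓝 0) := by
  obtain ⟨F, -, -, hF, hf⟩ := h
  have h1 := Complex.continuous_re.continuousAt.tendsto.comp
    (hF.tendsto_at (ofReal_mem_ball.2 hθ))
  refine h1.congr' ?_
  filter_upwards [eventually_pos_lt hT] with t ht
  simp [hf t ht θ hθ]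

namespace IsSolutionOfForm

theorem tendsto_P (h : IsSolutionOfForm θ₀ p q ε T r P Q) (hε : ∀ I, 0 < ε I)
    (hθ : θ ∈ Ioo (θ₀ - r) (θ₀ + r)) (I : Fin n) :
    Tendsto (fun t => P I t θ - p I 0 θ * Real.log t) (𝓝[>] 0) (𝓝 (p I 1 θ)) := by
  obtain ⟨hT, -, -, π, κ, hπ, -, hform⟩ := h
  have h1 := (((tendsto_rpow_zero (hε I)).mul ((hπ I).tendsto hT hθ)).const_add (p I 1 θ))
  rw [mul_zero, add_zero] at h1
  refine h1.congr' ?_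
  filter_upwards [eventually_pos_lt hT] with t ht
  rw [(hform t ht θ hθ I).1, pVTD]
  ring

theorem tendsto_rpow_mul_Q (h : IsSolutionOfForm θ₀ p q ε T r P Q)
    (hθ : θ ∈ Ioo (θ₀ - r) (θ₀ + r)) (I : Fin n) :
    Tendsto (fun t => t ^ (-(2 * kExp p I θ)) * (Q I t θ - q I 0 θ)) (𝓝[>] 0)
      (𝓝 (q I 1 θ)) := by
  obtain ⟨hT, -, -, π, κ, -, hκ, hform⟩ := h
  have h1 := ((hκ I).tendsto hT hθ).const_add (q I 1 θ)
  rw [add_zero] at h1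
  refine h1.congr' ?_
  filter_upwards [eventually_pos_lt hT] with t ht
  have h2 : t ^ (-(2 * kExp p I θ)) * t ^ (2 * kExp p I θ) = 1 := by
    rw [← Real.rpow_add ht.1, neg_add_cancel, Real.rpow_zero]
  rw [(hform t ht θ hθ I).2, qVTD]
  linear_combination -(q I 1 θ + κ I t θ) * h2

theorem tendsto_Q (h : IsSolutionOfForm θ₀ p q ε T r P Q)
    (hθ : θ ∈ Ioo (θ₀ - r) (θ₀ + r)) (I : Fin n) (hk : 0 < kExp p I θ) :
    Tendsto (fun t => Q I t θ) (𝓝[>] 0) (𝓝 (q I 0 θ)) := by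
  have h1 := ((tendsto_rpow_zero (mul_pos two_pos hk)).mul
    (h.tendsto_rpow_mul_Q hθ I)).const_add (q I 0 θ)
  rw [zero_mul, add_zero] at h1
  refine h1.congr' ?_
  filter_upwards [self_mem_nhdsWithin] with t ht
  have h2 : t ^ (2 * kExp p I θ) * t ^ (-(2 * kExp p I θ)) = 1 := by
    rw [← Real.rpow_add ht, add_neg_cancel, Real.rpow_zero]
  linear_combination (Q I t θ - q I 0 θ) * h2

/-- The data are determined by the solution. -/
theorem data_eq {p' q' : Fin n → Fin 2 → ℝ → ℝ} {ε' : Fin n → ℝ} {T' r' : ℝ}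
    (hpq : AdmissibleData θ₀ p q) (hε : ∀ I, 0 < ε I) (hε' : ∀ I, 0 < ε' I)
    (h : IsSolutionOfForm θ₀ p q ε T r P Q) (h' : IsSolutionOfForm θ₀ p' q' ε' T' r' P Q)
    (I : Fin n) (A : Fin 2) : p I A =ᶠ[𝓝 θ₀] p' I A ∧ q I A =ᶠ[𝓝 θ₀] q' I A := by
  have key : ∀ᶠ θ in 𝓝 θ₀, p I A θ = p' I A θ ∧ q I A θ = q' I A θ := by
    have hr := h.2.1
    have hr' := h'.2.1
    filter_upwards [hpq.2.2,
      isOpen_Ioo.mem_nhds (show θ₀ ∈ Ioo (θ₀ - r) (θ₀ + r) from ⟨by linarith, by linarith⟩),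
      isOpen_Ioo.mem_nhds (show θ₀ ∈ Ioo (θ₀ - r') (θ₀ + r') from ⟨by linarith, by linarith⟩)]
      with θ hk hθ hθ'
    -- The two expansions of P_J make (p_{J0} - p'_{J0}) ln t converge as t → 0⁺, so its coefficient
    -- vanishes.
    have hp0 : ∀ J, p J 0 θ = p' J 0 θ := fun J => by
      have h1 := (h'.tendsto_P hε' hθ' J).sub (h.tendsto_P hε hθ J)
      have h2 := Complex.continuous_ofReal.continuousAt.tendsto.comp h1
      have h3 := eq_zero_of_tendsto_mul_log (c := ((p J 0 θ - p' J 0 θ : ℝ) : ℂ)) <|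
        h2.congr fun t => by
          simp only [Function.comp_apply]
          push_cast
          ring
      exact sub_eq_zero.1 (Complex.ofReal_eq_zero.1 h3)
    have hp1 : ∀ J, p J 1 θ = p' J 1 θ := fun J => by
      have h1 := h.tendsto_P hε hθ J
      rw [hp0 J] at h1
      exact tendsto_nhds_unique h1 (h'.tendsto_P hε' hθ' J)
    -- The exponent k is built from the p_{J0} of all indices, which is why their equality comes
    -- first for every J. Both expansions of Q_I now involve the same power t^{2k}.
    have hkk : kExp p I θ = kExp p' I θ := by simp only [kExp, hp0]
    have hq0 : q I 0 θ = q' I 0 θ := tendsto_nhds_unique (h.tendsto_Q hθ I (hk I).1)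
      (h'.tendsto_Q hθ' I (hkk ▸ (hk I).1))
    have hq1 : q I 1 θ = q' I 1 θ := by
      have h1 := h.tendsto_rpow_mul_Q hθ I
      rw [hkk, hq0] at h1
      exact tendsto_nhds_unique h1 (h'.tendsto_rpow_mul_Q hθ' I)
    fin_cases A
    · exact ⟨hp0 I, hq0⟩
    · exact ⟨hp1 I, hq1⟩
  exact ⟨key.mono fun _ hθ => hθ.1, key.mono fun _ hθ => hθ.2⟩

end IsSolutionOfForm

end Freedom

/-! ### Existence, uniqueness and freedom of the data -/

theorem theorem4 (D : ℕ) (hD : 4 ≤ D) (θ₀ : ℝ)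
    (p q : Fin (D - 3) → Fin 2 → ℝ → ℝ) (hpq : AdmissibleData θ₀ p q) :
    -- existence, for every choice of the exponents in the allowed range
    (∀ ε : Fin (D - 3) → ℝ,
      (∀ I, 0 < ε I ∧ ε I < min (2 * kExp p I θ₀) (2 * (1 - kExp p I θ₀))) →
      ∃ (T r : ℝ) (P Q : Fin (D - 3) → ℝ → ℝ → ℝ),
        IsSolutionOfForm θ₀ p q ε T r P Q ∧ IsAVTD p (Ioo (θ₀ - r) (θ₀ + r)) P Q) ∧
    -- uniqueness near `(0, θ₀)`, also for different choices of the exponents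
    (∀ ε ε' : Fin (D - 3) → ℝ, (∀ I, 0 < ε I) → (∀ I, 0 < ε' I) →
      ∀ (T r T' r' : ℝ) (P Q P' Q' : Fin (D - 3) → ℝ → ℝ → ℝ),
        IsSolutionOfForm θ₀ p q ε T r P Q → IsSolutionOfForm θ₀ p q ε' T' r' P' Q' →
        ∃ T₁ > 0, ∃ r₁ > 0, ∀ t ∈ Ioo 0 T₁, ∀ θ ∈ Ioo (θ₀ - r₁) (θ₀ + r₁), ∀ I,
          P I t θ = P' I t θ ∧ Q I t θ = Q' I t θ) ∧
    -- the `4 (D - 3)` functions are free: different data have different solutions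
    (∀ p' q' : Fin (D - 3) → Fin 2 → ℝ → ℝ, AdmissibleData θ₀ p' q' →
      ∀ ε ε' : Fin (D - 3) → ℝ, (∀ I, 0 < ε I) → (∀ I, 0 < ε' I) →
      ∀ (T r T' r' : ℝ) (P Q : Fin (D - 3) → ℝ → ℝ → ℝ),
        IsSolutionOfForm θ₀ p q ε T r P Q → IsSolutionOfForm θ₀ p' q' ε' T' r' P Q →
        ∀ I A, p I A =ᶠ[𝓝 θ₀] p' I A ∧ q I A =ᶠ[𝓝 θ₀] q' I A) :=
  ⟨fun _ hε => exists_isSolutionOfForm hpq hε,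
    fun _ _ hε hε' _ _ _ _ _ _ _ _ h h' => h.unique hpq hε hε' h',
    fun _ _ _ _ _ hε hε' _ _ _ _ _ _ h h' I A => h.data_eq hpq hε hε' h' I A⟩
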